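/- **Theorem (cyclic cohomology of jets).** Let $k$ be a commutative ring containing $\mathbb{Q}$ (that is, a commutative $\mathbb{Q}$-algebra), let $A$ be a commutative unital $k$-algebra and let $(A,L)$ be a Lie–Rinehart algebra over $k$ such that $L$ is a finitely generated projective $A$-module of constant rank. Let $\mathcal{V}L$ be the universal enveloping algebra of $(A,L)$, with its canonical filtration $\mathcal{V}L_{\le p}$, and let $$\mathcal{J}^\infty L=\operatorname{Hom}_A(\mathcal{V}L,A)=\varprojlim_p \operatorname{Hom}_A(\mathcal{V}L_{\le p},A)$$ be the Hopf algebroid of $\infty$-jets of $L$ over $A$. Its structure is the following, for $\phi\in\mathcal{J}^\infty L$, $D,E\in\mathcal{V}L$, $a\in A$: source and target $s(a)(D)=a\,D(1)$, $t(a)(D)=D(a)$; product dual to the coproduct of $\mathcal{V}L$; counit $\epsilon(\phi)=\phi(1)$; coproduct dual to the product of $\mathcal{V}L$, i.e. $\phi(DE)=\phi_{(1)}\bigl(D\,\phi_{(2)}(E)\bigr)$; antipode $(S\phi)(D)=(\nabla_D\phi)(1)$, where $\nabla$ is the Grothendieck connection, the action of $\mathcal{V}L$ on $\mathcal{J}^\infty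 L$ given by $\nabla_a\phi=a\phi$ for $a \in A$ and $(\nabla_X\phi)(D)=X(\phi(D))-\phi(XD)$ for $X\in L$. Let $C^0=A$ and let $C^n=\mathcal{J}^\infty L\,\widehat\otimes_A\cdots\widehat\otimes_A\,\mathcal{J}^\infty L$ ($n$ factors, completed tensor product in which $t(a)\phi\otimes\psi=\phi\otimes s(a)\psi$). The canonical map, which sends $\phi_1\otimes\cdots\otimes\phi_n$ to $D_1\otimes\cdots\otimes D_n\mapsto\phi_1(D_1\phi_2(D_2\cdots\phi_n(D_n)\cdots))$, identifies $C^n$ with $\operatorname{Hom}_A(\mathcal{V}L\otimes_A\cdots\otimes_A\mathcal{V}L,A)$, where the tensor products relate right multiplication by $A$ on one factor to left multiplication on the next one. Consider on $C^\bullet$ the Hopf-cyclic structure: the cofaces are $\delta_0=1\otimes -$, $\delta_i$ = coproduct in the $i$-th factor for $1\le i\le n$, and $\delta_{n+1}=-\otimes 1$ (in degree $0$: $\delta_0=t$, $\delta_1=s$); the codegeneracy $\sigma_i$ is the counit in the factor number $i+1$; and $$\tau_n(h^1\otimes\cdots\otimes h^n)=S(h^1)\cdot(h^2\otimes\cdots\otimes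 h^n\otimes 1)$$ with the diagonal multiplication. Put $b=\sum_i(-1)^i\delta_i$, $\lambda=(-1)^n\tau_n$ on $C^n$, and $B=\bigl(\sum_{j=0}^{n}\lambda^j\bigr)\,\sigma_n\tau_{n+1}\,(1-\lambda):C^{n+1}\to C^n$. Let $HH^\bullet(\mathcal{J}^\infty L)$ be the cohomology of $(C^\bullet,b)$ and let $HC^\bullet(\mathcal{J}^\infty L)$ be the cyclic cohomology of the mixed complex $(C^\bullet,b,B)$, that is, the cohomology of the complex with $\mathrm{Tot}^n=C^n\oplus C^{n-2}\oplus C^{n-4}\oplus\cdots$ and differential $b+B$. Let $H^n(L,A)=\operatorname{Ext}^n_{\mathcal{V}L}(A,A)$ be the Lie–Rinehart cohomology of $L$ with values in $A$. Then, for all $n\ge 0$, there are canonical isomorphisms of $k$-modules $$HH^n(\mathcal{J}^\infty L)\cong H^n(L,A),\qquad HC^n(\mathcal{J}^\infty L)\cong\bigoplus_{i\ge 0,\ 2i\le n}H^{n-2i}(L,A).$$ Here "canonical" means the following. The augmented bar complex $\cdots\to\mathcal{V}L\otimes_A\mathcal{V}L\to\mathcal{V}L\to A$ is a resolution of $A$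 by projective left $\mathcal{V}L$-modules, and the first isomorphism is the one that it induces: the class of a cocycle $\phi\in C^n$ goes to the class in $\operatorname{Ext}^n_{\mathcal{V}L}(A,A)$ of the cocycle $D_0\otimes D_1\otimes\cdots\otimes D_n\mapsto D_0\bigl(\phi(D_1\otimes\cdots\otimes D_n)\bigr)$. The second isomorphism can be chosen compatibly with Connes' maps: composed with the projection to the summand $i=0$, it is the canonical map $I:HC^n\to HH^n$, $(f_n,f_{n-2},\dots)\mapsto f_n$, followed by the first isomorphism; and it carries the periodicity operator $S:HC^n\to HC^{n+2}$ to the inclusion which sends the summand number $i$ identically to the summand number $i+1$. -/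

import Mathlib

open CategoryTheory TensorProduct DirectSum
open scoped ModuleCat.Algebra

set_option linter.unusedSectionVars false

universe u

namespace LieRinehart

noncomputable section

section Enveloping

variable (k A L : Type u) [CommRing k] [CommRing A] [Algebra k A] [LieRing L] [LieAlgebra k L]
  [Module A L] [LieRingModule L A] [LieRinehartRing A L] [LieRinehartAlgebra k A L]

/-- The defining relations of the universal enveloping algebra of a Lie-Rinehart algebra `(A, L)`:
`A` is mapped by a homomorphism of `k`-algebras, `L` by a homomorphism of `k`-Lie algebras, and
`a · X = aX`, `X · a - a · X = X(a)`. -/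
inductive EnvRel : FreeAlgebra k (A ⊕ L) → FreeAlgebra k (A ⊕ L) → Prop
  | add_A (a b : A) : EnvRel (FreeAlgebra.ι k (Sum.inl (a + b)))
      (FreeAlgebra.ι k (Sum.inl a) + FreeAlgebra.ι k (Sum.inl b))
  | mul_A (a b : A) : EnvRel (FreeAlgebra.ι k (Sum.inl (a * b)))
      (FreeAlgebra.ι k (Sum.inl a) * FreeAlgebra.ι k (Sum.inl b))
  | algebraMap_A (c : k) : EnvRel (FreeAlgebra.ι k (Sum.inl (algebraMap k A c)))
      (algebraMap k _ c)
  | add_L (X Y : L) : EnvRel (FreeAlgebra.ι k (Sum.inr (X + Y)))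
      (FreeAlgebra.ι k (Sum.inr X) + FreeAlgebra.ι k (Sum.inr Y))
  | smul_L (c : k) (X : L) : EnvRel (FreeAlgebra.ι k (Sum.inr (c • X)))
      (c • FreeAlgebra.ι k (Sum.inr X))
  | lie_L (X Y : L) : EnvRel (FreeAlgebra.ι k (Sum.inr ⁅X, Y⁆))
      (FreeAlgebra.ι k (Sum.inr X) * FreeAlgebra.ι k (Sum.inr Y)
        - FreeAlgebra.ι k (Sum.inr Y) * FreeAlgebra.ι k (Sum.inr X))
  | smul_A_L (a : A) (X : L) : EnvRel (FreeAlgebra.ι k (Sum.inr (a • X)))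
      (FreeAlgebra.ι k (Sum.inl a) * FreeAlgebra.ι k (Sum.inr X))
  | anchor (a : A) (X : L) : EnvRel (FreeAlgebra.ι k (Sum.inl ⁅X, a⁆))
      (FreeAlgebra.ι k (Sum.inr X) * FreeAlgebra.ι k (Sum.inl a)
        - FreeAlgebra.ι k (Sum.inl a) * FreeAlgebra.ι k (Sum.inr X))

/-- The universal enveloping algebra `𝒱L` of the Lie-Rinehart algebra `(A, L)`. -/
def Env : Type u := RingQuot (EnvRel k A L)

instance : Ring (Env k A L) := inferInstanceAs (Ring (RingQuot (EnvRel k A L)))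

instance : Algebra k (Env k A L) := inferInstanceAs (Algebra k (RingQuot (EnvRel k A L)))

namespace Env

/-- The projection from the free algebra. -/
def mk : FreeAlgebra k (A ⊕ L) →ₐ[k] Env k A L := RingQuot.mkAlgHom k (EnvRel k A L)

variable {k A L} in
theorem mk_rel {x y : FreeAlgebra k (A ⊕ L)} (h : EnvRel k A L x y) :
    mk k A L x = mk k A L y := RingQuot.mkAlgHom_rel k h

/-- The canonical homomorphism of `k`-algebras `i_A : A → 𝒱L`. -/
def iA : A →ₐ[k] Env k A L where
  toFun a := mk k A L (FreeAlgebra.ι k (Sum.inl a))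
  map_one' := by
    have h := mk_rel (EnvRel.algebraMap_A (k := k) (A := A) (L := L) 1)
    simpa using h
  map_mul' a b := by rw [mk_rel (EnvRel.mul_A a b), map_mul]
  map_zero' := by
    have h := mk_rel (EnvRel.algebraMap_A (k := k) (A := A) (L := L) 0)
    simpa using h
  map_add' a b := by rw [mk_rel (EnvRel.add_A a b), map_add]
  commutes' c := by rw [mk_rel (EnvRel.algebraMap_A c), AlgHom.commutes]

/-- The canonical `k`-linear map `i_L : L → 𝒱L`; it is a homomorphism of `k`-Lie algebras by
`iL_lie`. -/
def iL : L →ₗ[k] Env k A L where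
  toFun X := mk k A L (FreeAlgebra.ι k (Sum.inr X))
  map_add' X Y := by rw [mk_rel (EnvRel.add_L X Y), map_add]
  map_smul' c X := by rw [mk_rel (EnvRel.smul_L c X), map_smul]; rfl

theorem iL_lie (X Y : L) :
    iL k A L ⁅X, Y⁆ = iL k A L X * iL k A L Y - iL k A L Y * iL k A L X := by
  change mk k A L (FreeAlgebra.ι k (Sum.inr ⁅X, Y⁆)) = _
  rw [mk_rel (EnvRel.lie_L X Y), map_sub, map_mul, map_mul]; rfl

theorem iA_mul_iL (a : A) (X : L) : iA k A L a * iL k A L X = iL k A L (a • X) := by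
  change _ = mk k A L (FreeAlgebra.ι k (Sum.inr (a • X)))
  rw [mk_rel (EnvRel.smul_A_L a X), map_mul]; rfl

theorem iL_mul_iA (a : A) (X : L) :
    iL k A L X * iA k A L a - iA k A L a * iL k A L X = iA k A L ⁅X, a⁆ := by
  change _ = mk k A L (FreeAlgebra.ι k (Sum.inl ⁅X, a⁆))
  rw [mk_rel (EnvRel.anchor a X), map_sub, map_mul, map_mul]; rfl

section lift

variable {k A L} {W : Type*} [Ring W] [Algebra k W] (f : A →ₐ[k] W) (g : L →ₗ[k] W)
  (h₀ : ∀ X Y, g ⁅X, Y⁆ = g X * g Y - g Y * g X)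
  (h₁ : ∀ a X, f a * g X = g (a • X)) (h₂ : ∀ a X, g X * f a - f a * g X = f ⁅X, a⁆)

/-- The universal property of `𝒱L`. -/
def lift : Env k A L →ₐ[k] W :=
  RingQuot.liftAlgHom k ⟨FreeAlgebra.lift k (Sum.elim f g), by
    intro x y h
    induction h with
    | add_A a b => simp
    | mul_A a b => simp
    | algebraMap_A c => simp
    | add_L X Y => simp
    | smul_L c X => simp
    | lie_L X Y => simp [h₀]
    | smul_A_L a X => simp [h₁]
    | anchor a X => simp [h₂]⟩

@[simp]
theorem lift_iA (a : A) : lift f g h₀ h₁ h₂ (iA k A L a) = f a := by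
  change RingQuot.liftAlgHom k _ (RingQuot.mkAlgHom k (EnvRel k A L) _) = _
  rw [RingQuot.liftAlgHom_mkAlgHom_apply]
  simp

@[simp]
theorem lift_iL (X : L) : lift f g h₀ h₁ h₂ (iL k A L X) = g X := by
  change RingQuot.liftAlgHom k _ (RingQuot.mkAlgHom k (EnvRel k A L) _) = _
  rw [RingQuot.liftAlgHom_mkAlgHom_apply]
  simp

end lift

/-- `𝒱L` is generated by `A` and `L`. -/
theorem induction {P : Env k A L → Prop} (hA : ∀ a, P (iA k A L a)) (hL : ∀ X, P (iL k A L X))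
    (hadd : ∀ D E, P D → P E → P (D + E)) (hmul : ∀ D E, P D → P E → P (D * E)) (D : Env k A L) :
    P D := by
  obtain ⟨x, rfl⟩ := RingQuot.mkAlgHom_surjective k (EnvRel k A L) D
  induction x using FreeAlgebra.induction with
  | grade0 c =>
    have h := hA (algebraMap k A c)
    rw [AlgHom.commutes] at h
    rw [AlgHom.commutes]
    exact h
  | grade1 x =>
    cases x with
    | inl a => exact hA a
    | inr X => exact hL X
  | mul x y hx hy => rw [map_mul]; exact hmul _ _ hx hy
  | add x y hx hy => rw [map_add]; exact hadd _ _ hx hy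

end Env

/-- The anchor `X ↦ (a ↦ X(a))`, as a `k`-linear map. -/
def anchorEnd : L →ₗ[k] Module.End k A where
  toFun X :=
    { toFun := fun a => ⁅X, a⁆
      map_add' := fun a b => lie_add X a b
      map_smul' := fun c a => lie_smul c X a }
  map_add' X Y := by ext a; exact add_lie X Y a
  map_smul' c X := by ext a; exact smul_lie c X a

@[simp]
theorem anchorEnd_apply (X : L) (a : A) : anchorEnd k A L X a = ⁅X, a⁆ := rfl

/-- The canonical action of `𝒱L` on `A`: elements of `A` act by multiplication, elements of `L`
through the anchor. -/
def anchorAction : Env k A L →ₐ[k] Module.End k A :=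
  Env.lift (Algebra.lmul k A) (anchorEnd k A L)
    (by intro X Y; ext b; simp)
    (by intro a X; ext b; simp)
    (by intro a X; ext b; simp [mul_comm])

instance : Module (Env k A L) A := Module.compHom A (anchorAction k A L).toRingHom

variable {k A L} in
theorem env_smul_def (D : Env k A L) (a : A) : D • a = anchorAction k A L D a := rfl

@[simp]
theorem iA_smul (a b : A) : Env.iA k A L a • b = a * b := by
  rw [env_smul_def, anchorAction, Env.lift_iA]; simp

@[simp]
theorem iL_smul (X : L) (b : A) : Env.iL k A L X • b = ⁅X, b⁆ := by
  rw [env_smul_def, anchorAction, Env.lift_iL]; simp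

instance : IsScalarTower k (Env k A L) A where
  smul_assoc c D a := by rw [env_smul_def, map_smul]; rfl

end Enveloping

section Modules

variable (k A L : Type u) [CommRing k] [CommRing A] [Algebra k A] [LieRing L] [LieAlgebra k L]
  [Module A L] [LieRingModule L A] [LieRinehartRing A L] [LieRinehartAlgebra k A L]
  (M N Q : Type u)
  [AddCommGroup M] [Module k M] [Module (Env k A L) M] [IsScalarTower k (Env k A L) M]
  [AddCommGroup N] [Module k N] [Module (Env k A L) N] [IsScalarTower k (Env k A L) N]
  [AddCommGroup Q] [Module k Q] [Module (Env k A L) Q] [IsScalarTower k (Env k A L) Q]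

/-- The action of an element of `𝒱L` on a `𝒱L`-module, as a `k`-linear map. -/
def op (D : Env k A L) : M →ₗ[k] M := Algebra.lsmul k k M D

@[simp]
theorem op_apply (D : Env k A L) (m : M) : op k A L M D m = D • m := rfl

/-- `Hom_A(M, N)` for `𝒱L`-modules `M` and `N`, where `A` acts through `i_A : A → 𝒱L`. -/
def HomA : Submodule k (M →ₗ[k] N) where
  carrier := {f | ∀ (a : A) (m : M), f (Env.iA k A L a • m) = Env.iA k A L a • f m}
  add_mem' hf hg a m := by simp [hf a m, hg a m]
  zero_mem' a m := by simp
  smul_mem' c f hf a m := by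
    rw [LinearMap.smul_apply, LinearMap.smul_apply, hf a m]
    exact (op k A L N (Env.iA k A L a)).map_smul c (f m) |>.symm

variable {k A L M N Q}

theorem HomA.map_iA (f : HomA k A L M N) (a : A) (m : M) :
    f.1 (Env.iA k A L a • m) = Env.iA k A L a • f.1 m := f.2 a m

theorem env_smul_smul (D : Env k A L) (c : k) (m : M) : D • c • m = c • D • m :=
  (op k A L M D).map_smul c m

theorem iA_smul_comm (a b : A) (m : M) :
    Env.iA k A L a • Env.iA k A L b • m = Env.iA k A L b • Env.iA k A L a • m := by
  rw [← mul_smul, ← map_mul, mul_comm, map_mul, mul_smul]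

theorem iL_smul_iA_smul (X : L) (a : A) (m : M) :
    Env.iL k A L X • Env.iA k A L a • m
      = Env.iA k A L a • Env.iL k A L X • m + Env.iA k A L ⁅X, a⁆ • m := by
  rw [← Env.iL_mul_iA, sub_smul, mul_smul, mul_smul]
  abel

theorem iL_lie_smul (X Y : L) (m : M) :
    Env.iL k A L ⁅X, Y⁆ • m
      = Env.iL k A L X • Env.iL k A L Y • m - Env.iL k A L Y • Env.iL k A L X • m := by
  rw [Env.iL_lie, sub_smul, mul_smul, mul_smul]

theorem iL_smul_smul (a : A) (X : L) (m : M) :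
    Env.iL k A L (a • X) • m = Env.iA k A L a • Env.iL k A L X • m := by
  rw [← Env.iA_mul_iL, mul_smul]

theorem HomA.hom_ext {f g : HomA k A L M N} (h : ∀ m, f.1 m = g.1 m) : f = g :=
  Subtype.ext (LinearMap.ext h)

variable (k A L M N Q)

/-- The action of `A` on `Hom_A(M, N)`. -/
def HomA.actA : A →ₐ[k] Module.End k (HomA k A L M N) where
  toFun a :=
    { toFun := fun f => ⟨op k A L N (Env.iA k A L a) ∘ₗ f.1, fun b m => by
        simp [HomA.map_iA, iA_smul_comm a b]⟩
      map_add' := fun f g => HomA.hom_ext fun m => by simp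
      map_smul' := fun c f => HomA.hom_ext fun m => env_smul_smul _ _ _ }
  map_one' := LinearMap.ext fun f => HomA.hom_ext fun m => by simp
  map_mul' a b := LinearMap.ext fun f => HomA.hom_ext fun m => by simp [mul_smul]
  map_zero' := LinearMap.ext fun f => HomA.hom_ext fun m => by simp
  map_add' a b := LinearMap.ext fun f => HomA.hom_ext fun m => by simp [add_smul]
  commutes' c := LinearMap.ext fun f => HomA.hom_ext fun m => by simp

@[simp]
theorem HomA.actA_apply (a : A) (f : HomA k A L M N) (m : M) :
    (HomA.actA k A L M N a f).1 m = Env.iA k A L a • f.1 m := rfl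

/-- The connection `(∇_X f)(m) = X(f(m)) - f(Xm)` on `Hom_A(M, N)`. -/
def HomA.actL : L →ₗ[k] Module.End k (HomA k A L M N) where
  toFun X :=
    { toFun := fun f => ⟨op k A L N (Env.iL k A L X) ∘ₗ f.1 - f.1 ∘ₗ op k A L M (Env.iL k A L X),
        fun b m => by
          simp only [LinearMap.sub_apply, LinearMap.comp_apply, op_apply, HomA.map_iA,
            iL_smul_iA_smul, map_add, smul_sub]
          abel⟩
      map_add' := fun f g => HomA.hom_ext fun m => by
        simp only [LinearMap.sub_apply, LinearMap.comp_apply, op_apply, Submodule.coe_add,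
          LinearMap.add_apply, smul_add]
        abel
      map_smul' := fun c f => HomA.hom_ext fun m => by
        simp [smul_sub] }
  map_add' X Y := LinearMap.ext fun f => HomA.hom_ext fun m => by
    simp only [LinearMap.sub_apply, LinearMap.comp_apply, op_apply, Submodule.coe_add,
      LinearMap.add_apply, map_add, add_smul, LinearMap.coe_mk, AddHom.coe_mk]
    abel
  map_smul' c X := LinearMap.ext fun f => HomA.hom_ext fun m => by
    simp [smul_sub]

@[simp]
theorem HomA.actL_apply (X : L) (f : HomA k A L M N) (m : M) :
    (HomA.actL k A L M N X f).1 m = Env.iL k A L X • f.1 m - f.1 (Env.iL k A L X • m) := rfl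

variable {k A L M N} in
theorem HomA.actL_lie (X Y : L) : HomA.actL k A L M N ⁅X, Y⁆
    = HomA.actL k A L M N X * HomA.actL k A L M N Y
      - HomA.actL k A L M N Y * HomA.actL k A L M N X := by
  refine LinearMap.ext fun f => HomA.hom_ext fun m => ?_
  change Env.iL k A L ⁅X, Y⁆ • f.1 m - f.1 (Env.iL k A L ⁅X, Y⁆ • m)
    = (Env.iL k A L X • (Env.iL k A L Y • f.1 m - f.1 (Env.iL k A L Y • m))
        - (Env.iL k A L Y • f.1 (Env.iL k A L X • m)
          - f.1 (Env.iL k A L Y • Env.iL k A L X • m)))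
      - (Env.iL k A L Y • (Env.iL k A L X • f.1 m - f.1 (Env.iL k A L X • m))
        - (Env.iL k A L X • f.1 (Env.iL k A L Y • m)
          - f.1 (Env.iL k A L X • Env.iL k A L Y • m)))
  simp only [iL_lie_smul, smul_sub, map_sub]
  abel

variable {k A L M N} in
theorem HomA.actA_mul_actL (a : A) (X : L) : HomA.actA k A L M N a * HomA.actL k A L M N X
    = HomA.actL k A L M N (a • X) := by
  refine LinearMap.ext fun f => HomA.hom_ext fun m => ?_
  change Env.iA k A L a • (Env.iL k A L X • f.1 m - f.1 (Env.iL k A L X • m))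
    = Env.iL k A L (a • X) • f.1 m - f.1 (Env.iL k A L (a • X) • m)
  simp only [iL_smul_smul, HomA.map_iA, smul_sub]

variable {k A L M N} in
theorem HomA.actL_mul_actA (a : A) (X : L) : HomA.actL k A L M N X * HomA.actA k A L M N a
    - HomA.actA k A L M N a * HomA.actL k A L M N X = HomA.actA k A L M N ⁅X, a⁆ := by
  refine LinearMap.ext fun f => HomA.hom_ext fun m => ?_
  change (Env.iL k A L X • Env.iA k A L a • f.1 m
        - Env.iA k A L a • f.1 (Env.iL k A L X • m))
      - Env.iA k A L a • (Env.iL k A L X • f.1 m - f.1 (Env.iL k A L X • m))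
    = Env.iA k A L ⁅X, a⁆ • f.1 m
  simp only [iL_smul_iA_smul, smul_sub]
  abel

/-- The (Grothendieck) connection on `Hom_A(M, N)` is flat, so that `Hom_A(M, N)` becomes a
`𝒱L`-module. -/
def HomA.act : Env k A L →ₐ[k] Module.End k (HomA k A L M N) :=
  Env.lift (W := Module.End k (HomA k A L M N)) (HomA.actA k A L M N) (HomA.actL k A L M N)
    (by intro X Y; rw [HomA.actL_lie]) HomA.actA_mul_actL
    (by intro X Y; rw [← HomA.actL_mul_actA])

@[simp]
theorem HomA.act_iA (a : A) : HomA.act k A L M N (Env.iA k A L a) = HomA.actA k A L M N a :=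
  Env.lift_iA ..

@[simp]
theorem HomA.act_iL (X : L) : HomA.act k A L M N (Env.iL k A L X) = HomA.actL k A L M N X :=
  Env.lift_iL ..

/-- The relations defining `M ⊗_A N`. -/
def tensRel : Submodule k (M ⊗[k] N) :=
  Submodule.span k {x | ∃ (a : A) (m : M) (n : N),
    x = (Env.iA k A L a • m) ⊗ₜ[k] n - m ⊗ₜ[k] (Env.iA k A L a • n)}

/-- The tensor product `M ⊗_A N` of two `𝒱L`-modules (both regarded as `A`-modules through
`i_A : A → 𝒱L`). -/
def Tens : Type u := (M ⊗[k] N) ⧸ tensRel k A L M N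

instance : AddCommGroup (Tens k A L M N) :=
  inferInstanceAs (AddCommGroup ((M ⊗[k] N) ⧸ tensRel k A L M N))

instance : Module k (Tens k A L M N) :=
  inferInstanceAs (Module k ((M ⊗[k] N) ⧸ tensRel k A L M N))

variable {M N} in
/-- The class of `m ⊗ n`. -/
def Tens.tmul (m : M) (n : N) : Tens k A L M N := (tensRel k A L M N).mkQ (m ⊗ₜ[k] n)

variable {k A L M N Q}

theorem Tens.smul_tmul (a : A) (m : M) (n : N) :
    Tens.tmul k A L (Env.iA k A L a • m) n = Tens.tmul k A L m (Env.iA k A L a • n) :=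
  (Submodule.Quotient.eq _).2 (Submodule.subset_span ⟨a, m, n, rfl⟩)

theorem Tens.hom_ext {R : Type*} [AddCommGroup R] [Module k R]
    {f g : Tens k A L M N →ₗ[k] R}
    (h : ∀ m n, f (Tens.tmul k A L m n) = g (Tens.tmul k A L m n)) : f = g := by
  apply Submodule.linearMap_qext
  ext m n
  exact h m n

variable (k A L M N) in
/-- The universal bilinear map. -/
def Tens.mk₂ : M →ₗ[k] N →ₗ[k] Tens k A L M N :=
  (TensorProduct.mk k M N).compr₂ (tensRel k A L M N).mkQ

@[simp]
theorem Tens.mk₂_apply (m : M) (n : N) : Tens.mk₂ k A L M N m n = Tens.tmul k A L m n := rfl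

theorem Tens.add_tmul (m m' : M) (n : N) :
    Tens.tmul k A L (m + m') n = Tens.tmul k A L m n + Tens.tmul k A L m' n :=
  (Tens.mk₂ k A L M N).map_add₂ m m' n

theorem Tens.sub_tmul (m m' : M) (n : N) :
    Tens.tmul k A L (m - m') n = Tens.tmul k A L m n - Tens.tmul k A L m' n :=
  (Tens.mk₂ k A L M N).map_sub₂ m m' n

theorem Tens.ksmul_tmul (c : k) (m : M) (n : N) :
    Tens.tmul k A L (c • m) n = c • Tens.tmul k A L m n :=
  (Tens.mk₂ k A L M N).map_smul₂ c m n

theorem Tens.tmul_add (m : M) (n n' : N) :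
    Tens.tmul k A L m (n + n') = Tens.tmul k A L m n + Tens.tmul k A L m n' :=
  (Tens.mk₂ k A L M N m).map_add n n'

theorem Tens.tmul_sub (m : M) (n n' : N) :
    Tens.tmul k A L m (n - n') = Tens.tmul k A L m n - Tens.tmul k A L m n' :=
  (Tens.mk₂ k A L M N m).map_sub n n'

theorem Tens.tmul_ksmul (c : k) (m : M) (n : N) :
    Tens.tmul k A L m (c • n) = c • Tens.tmul k A L m n :=
  (Tens.mk₂ k A L M N m).map_smul c n

/-- A `k`-bilinear map on `M × N` which is balanced over `A` factors through `M ⊗_A N`. -/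
def Tens.lift {R : Type*} [AddCommGroup R] [Module k R] (f : M →ₗ[k] N →ₗ[k] R)
    (hf : ∀ a m n, f (Env.iA k A L a • m) n = f m (Env.iA k A L a • n)) :
    Tens k A L M N →ₗ[k] R :=
  (tensRel k A L M N).liftQ (TensorProduct.lift f) (by
    rw [tensRel, Submodule.span_le]
    rintro x ⟨a, m, n, rfl⟩
    simp [hf])

@[simp]
theorem Tens.lift_tmul {R : Type*} [AddCommGroup R] [Module k R] (f : M →ₗ[k] N →ₗ[k] R)
    (hf : ∀ a m n, f (Env.iA k A L a • m) n = f m (Env.iA k A L a • n))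
    (m : M) (n : N) : Tens.lift f hf (Tens.tmul k A L m n) = f m n := rfl

variable (k A L M N) in
/-- The action of an element of `A` on `M ⊗_A N`. -/
def Tens.opA (a : A) : Module.End k (Tens k A L M N) :=
  Tens.lift (Tens.mk₂ k A L M N ∘ₗ op k A L M (Env.iA k A L a)) (fun b m n => by
    simp [iA_smul_comm a b, Tens.smul_tmul b])

@[simp]
theorem Tens.opA_tmul (a : A) (m : M) (n : N) :
    Tens.opA k A L M N a (Tens.tmul k A L m n) = Tens.tmul k A L (Env.iA k A L a • m) n := rfl

variable (k A L M N) in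
/-- The action of an element of `L` on `M ⊗_A N`. -/
def Tens.opL (X : L) : Module.End k (Tens k A L M N) :=
  Tens.lift (Tens.mk₂ k A L M N ∘ₗ op k A L M (Env.iL k A L X)
      + (Tens.mk₂ k A L M N).compl₂ (op k A L N (Env.iL k A L X))) (fun b m n => by
    simp only [LinearMap.add_apply, LinearMap.comp_apply, LinearMap.compl₂_apply, op_apply,
      Tens.mk₂_apply, iL_smul_iA_smul, Tens.add_tmul, Tens.tmul_add, Tens.smul_tmul b,
      Tens.smul_tmul ⁅X, b⁆]
    abel)

@[simp]
theorem Tens.opL_tmul (X : L) (m : M) (n : N) :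
    Tens.opL k A L M N X (Tens.tmul k A L m n)
      = Tens.tmul k A L (Env.iL k A L X • m) n + Tens.tmul k A L m (Env.iL k A L X • n) := rfl

variable (k A L M N) in
/-- The action of `A` on `M ⊗_A N`. -/
def Tens.actA : A →ₐ[k] Module.End k (Tens k A L M N) where
  toFun := Tens.opA k A L M N
  map_one' := Tens.hom_ext fun m n => by simp
  map_mul' a b := Tens.hom_ext fun m n => by simp [mul_smul]
  map_zero' := Tens.hom_ext fun m n => by
    rw [Tens.opA_tmul, map_zero, zero_smul]
    exact (Tens.mk₂ k A L M N).map_zero₂ n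
  map_add' a b := Tens.hom_ext fun m n => by simp [add_smul, Tens.add_tmul]
  commutes' c := Tens.hom_ext fun m n => by
    simp [Tens.ksmul_tmul]

variable (k A L M N) in
/-- The diagonal action `X(m ⊗ n) = Xm ⊗ n + m ⊗ Xn` of `L` on `M ⊗_A N`. -/
def Tens.actL : L →ₗ[k] Module.End k (Tens k A L M N) where
  toFun := Tens.opL k A L M N
  map_add' X Y := Tens.hom_ext fun m n => by
    simp only [Tens.opL_tmul, map_add, add_smul, Tens.add_tmul, Tens.tmul_add,
      LinearMap.add_apply]
    abel
  map_smul' c X := Tens.hom_ext fun m n => by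
    simp [Tens.ksmul_tmul, Tens.tmul_ksmul]

theorem Tens.actL_lie (X Y : L) : Tens.actL k A L M N ⁅X, Y⁆
    = Tens.actL k A L M N X * Tens.actL k A L M N Y
      - Tens.actL k A L M N Y * Tens.actL k A L M N X := by
  refine Tens.hom_ext fun m n => ?_
  change Tens.opL k A L M N ⁅X, Y⁆ (Tens.tmul k A L m n)
    = Tens.opL k A L M N X (Tens.opL k A L M N Y (Tens.tmul k A L m n))
      - Tens.opL k A L M N Y (Tens.opL k A L M N X (Tens.tmul k A L m n))
  simp only [Tens.opL_tmul, iL_lie_smul, Tens.sub_tmul, Tens.tmul_sub, map_add]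
  abel

theorem Tens.actA_mul_actL (a : A) (X : L) : Tens.actA k A L M N a * Tens.actL k A L M N X
    = Tens.actL k A L M N (a • X) := by
  refine Tens.hom_ext fun m n => ?_
  change Tens.opA k A L M N a (Tens.opL k A L M N X (Tens.tmul k A L m n))
    = Tens.opL k A L M N (a • X) (Tens.tmul k A L m n)
  simp only [Tens.opL_tmul, Tens.opA_tmul, iL_smul_smul, Tens.smul_tmul a, map_add]

theorem Tens.actL_mul_actA (a : A) (X : L) : Tens.actL k A L M N X * Tens.actA k A L M N a
    - Tens.actA k A L M N a * Tens.actL k A L M N X = Tens.actA k A L M N ⁅X, a⁆ := by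
  refine Tens.hom_ext fun m n => ?_
  change Tens.opL k A L M N X (Tens.opA k A L M N a (Tens.tmul k A L m n))
      - Tens.opA k A L M N a (Tens.opL k A L M N X (Tens.tmul k A L m n))
    = Tens.opA k A L M N ⁅X, a⁆ (Tens.tmul k A L m n)
  simp only [Tens.opL_tmul, Tens.opA_tmul, iL_smul_iA_smul, Tens.add_tmul, map_add]
  abel

variable (k A L M N) in
/-- The action of `𝒱L` on `M ⊗_A N` through the (left) coproduct of `𝒱L`, that is, the action for
which the elements of `L` act as derivations. -/
def Tens.act : Env k A L →ₐ[k] Module.End k (Tens k A L M N) :=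
  Env.lift (Tens.actA k A L M N) (Tens.actL k A L M N) Tens.actL_lie Tens.actA_mul_actL
    Tens.actL_mul_actA

instance : Module (Env k A L) (Tens k A L M N) :=
  Module.compHom _ (Tens.act k A L M N).toRingHom

theorem Tens.env_smul_def (D : Env k A L) (x : Tens k A L M N) :
    D • x = Tens.act k A L M N D x := rfl

instance : IsScalarTower k (Env k A L) (Tens k A L M N) where
  smul_assoc c D x := by
    rw [Tens.env_smul_def, Tens.env_smul_def, map_smul]; rfl

@[simp]
theorem Tens.iA_smul_tmul (a : A) (m : M) (n : N) :
    Env.iA k A L a • Tens.tmul k A L m n = Tens.tmul k A L (Env.iA k A L a • m) n := by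
  rw [Tens.env_smul_def, Tens.act, Env.lift_iA]; rfl

@[simp]
theorem Tens.iL_smul_tmul (X : L) (m : M) (n : N) :
    Env.iL k A L X • Tens.tmul k A L m n
      = Tens.tmul k A L (Env.iL k A L X • m) n + Tens.tmul k A L m (Env.iL k A L X • n) := by
  rw [Tens.env_smul_def, Tens.act, Env.lift_iL]; rfl

theorem Tens.induction {P : Tens k A L M N → Prop} (h : ∀ m n, P (Tens.tmul k A L m n))
    (hadd : ∀ x y, P x → P y → P (x + y)) (x : Tens k A L M N) : P x := by
  obtain ⟨y, rfl⟩ := (tensRel k A L M N).mkQ_surjective x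
  induction y with
  | zero => simpa [Tens.tmul] using h 0 0
  | tmul m n => exact h m n
  | add x y hx hy => rw [map_add]; exact hadd _ _ hx hy

variable (M) in
/-- The map `id ⊗ f` for an `A`-linear map `f`. -/
def Tens.mapRight (f : HomA k A L N Q) : Tens k A L M N →ₗ[k] Tens k A L M Q :=
  Tens.lift ((Tens.mk₂ k A L M Q).compl₂ f.1) (fun _ m n => by
    simp [HomA.map_iA, Tens.smul_tmul])

@[simp]
theorem Tens.mapRight_tmul (f : HomA k A L N Q) (m : M) (n : N) :
    Tens.mapRight M f (Tens.tmul k A L m n) = Tens.tmul k A L m (f.1 n) := rfl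

theorem Tens.mapRight_iA (f : HomA k A L N Q) (a : A) (x : Tens k A L M N) :
    Tens.mapRight M f (Env.iA k A L a • x) = Env.iA k A L a • Tens.mapRight M f x := by
  induction x using Tens.induction with
  | h m n => simp
  | hadd x y hx hy => simp [hx, hy]

variable (k A L M N Q)

/-- The relations defining `𝒱L ⊗_A M`. -/
def indRel : Submodule (Env k A L) (Env k A L ⊗[k] M) :=
  Submodule.span (Env k A L) {x | ∃ (D : Env k A L) (a : A) (m : M),
    x = (D * Env.iA k A L a) ⊗ₜ[k] m - D ⊗ₜ[k] (Env.iA k A L a • m)}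

/-- The tensor product `𝒱L ⊗_A M` in which `𝒱L` is a right `A`-module by right multiplication; it
is a left `𝒱L`-module by left multiplication on the first factor. -/
def Ind : Type u := (Env k A L ⊗[k] M) ⧸ indRel k A L M

instance : AddCommGroup (Ind k A L M) :=
  inferInstanceAs (AddCommGroup ((Env k A L ⊗[k] M) ⧸ indRel k A L M))

instance : Module (Env k A L) (Ind k A L M) :=
  inferInstanceAs (Module (Env k A L) ((Env k A L ⊗[k] M) ⧸ indRel k A L M))

instance : Module k (Ind k A L M) := Module.compHom _ (algebraMap k (Env k A L))

theorem Ind.ksmul_def (c : k) (x : Ind k A L M) : c • x = algebraMap k (Env k A L) c • x := rfl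

instance : IsScalarTower k (Env k A L) (Ind k A L M) where
  smul_assoc c D x := by rw [Ind.ksmul_def, Algebra.smul_def, mul_smul]

variable {M N Q}

/-- The class of `D ⊗ m` in `𝒱L ⊗_A M`. -/
def Ind.tmul (D : Env k A L) (m : M) : Ind k A L M :=
  (indRel k A L M).mkQ (D ⊗ₜ[k] m)

variable {k A L}

theorem Ind.mul_iA_tmul (D : Env k A L) (a : A) (m : M) :
    Ind.tmul k A L (D * Env.iA k A L a) m = Ind.tmul k A L D (Env.iA k A L a • m) :=
  (Submodule.Quotient.eq _).2 (Submodule.subset_span ⟨D, a, m, rfl⟩)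

@[simp]
theorem Ind.smul_tmul (D E : Env k A L) (m : M) :
    D • Ind.tmul k A L E m = Ind.tmul k A L (D * E) m :=
  ((indRel k A L M).mkQ.map_smul D (E ⊗ₜ[k] m)).symm

theorem Ind.tmul_add (D : Env k A L) (m m' : M) :
    Ind.tmul k A L D (m + m') = Ind.tmul k A L D m + Ind.tmul k A L D m' := by
  rw [Ind.tmul, TensorProduct.tmul_add, map_add]; rfl

theorem Ind.add_tmul (D E : Env k A L) (m : M) :
    Ind.tmul k A L (D + E) m = Ind.tmul k A L D m + Ind.tmul k A L E m := by
  rw [Ind.tmul, TensorProduct.add_tmul, map_add]; rfl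

theorem Ind.ksmul_tmul (c : k) (D : Env k A L) (m : M) :
    Ind.tmul k A L (c • D) m = c • Ind.tmul k A L D m := by
  rw [Ind.ksmul_def, Ind.smul_tmul, Algebra.smul_def]

theorem Ind.tmul_ksmul (c : k) (D : Env k A L) (m : M) :
    Ind.tmul k A L D (c • m) = c • Ind.tmul k A L D m := by
  rw [← Ind.ksmul_tmul, Ind.tmul, Ind.tmul, TensorProduct.smul_tmul]

@[elab_as_elim]
theorem Ind.induction {P : Ind k A L M → Prop} (h : ∀ D m, P (Ind.tmul k A L D m))
    (hadd : ∀ x y, P x → P y → P (x + y)) (x : Ind k A L M) : P x := by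
  obtain ⟨y, rfl⟩ := (indRel k A L M).mkQ_surjective x
  induction y with
  | zero => simpa [Ind.tmul] using h 0 0
  | tmul D m => exact h D m
  | add x y hx hy => rw [map_add]; exact hadd _ _ hx hy

theorem Ind.hom_ext {R : Type*} [AddCommGroup R] {f g : Ind k A L M →+ R}
    (h : ∀ D m, f (Ind.tmul k A L D m) = g (Ind.tmul k A L D m)) : f = g := by
  ext x
  induction x using Ind.induction with
  | h D m => exact h D m
  | hadd x y hx hy => rw [map_add, map_add, hx, hy]

/-- The `𝒱L`-linear map `𝒱L ⊗_A M → N`, `D ⊗ m ↦ D f(m)`, for an `A`-linear map `f : M → N`. -/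
def Ind.lift (f : HomA k A L M N) : Ind k A L M →ₗ[Env k A L] N :=
  (indRel k A L M).liftQ
    (TensorProduct.AlgebraTensorModule.lift
      { toFun := fun D => op k A L N D ∘ₗ f.1
        map_add' := fun D E => by ext m; simp [add_smul]
        map_smul' := fun D E => by ext m; simp [mul_smul] })
    (by
      rw [indRel, Submodule.span_le]
      rintro x ⟨D, a, m, rfl⟩
      simp [HomA.map_iA, mul_smul])

@[simp]
theorem Ind.lift_tmul (f : HomA k A L M N) (D : Env k A L) (m : M) :
    Ind.lift f (Ind.tmul k A L D m) = D • f.1 m := rfl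

/-- A `𝒱L`-linear map is `A`-linear. -/
def HomA.ofLinear (f : M →ₗ[Env k A L] N) : HomA k A L M N :=
  ⟨f.restrictScalars k, fun a m => f.map_smul _ m⟩

@[simp]
theorem HomA.ofLinear_apply (f : M →ₗ[Env k A L] N) (m : M) : (HomA.ofLinear f).1 m = f m := rfl

variable (k A L M) in
/-- The `A`-linear map `M → 𝒱L ⊗_A M`, `m ↦ 1 ⊗ m`. -/
def Ind.unit : HomA k A L M (Ind k A L M) :=
  ⟨{ toFun := fun m => Ind.tmul k A L 1 m
     map_add' := fun m m' => Ind.tmul_add 1 m m'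
     map_smul' := fun c m => Ind.tmul_ksmul c 1 m },
    fun a m => by
      change Ind.tmul k A L 1 _ = _ • Ind.tmul k A L 1 m
      rw [Ind.smul_tmul, ← Ind.mul_iA_tmul, one_mul, mul_one]⟩

@[simp]
theorem Ind.unit_apply (m : M) : (Ind.unit k A L M).1 m = Ind.tmul k A L 1 m := rfl

/-- Composition of `A`-linear maps. -/
def HomA.comp (g : HomA k A L N Q) (f : HomA k A L M N) : HomA k A L M Q :=
  ⟨g.1 ∘ₗ f.1, fun _ m => by simp [HomA.map_iA]⟩

@[simp]
theorem HomA.comp_apply (g : HomA k A L N Q) (f : HomA k A L M N) (m : M) :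
    (HomA.comp g f).1 m = g.1 (f.1 m) := rfl

/-- The `𝒱L`-linear map `id ⊗ f : 𝒱L ⊗_A M → 𝒱L ⊗_A N` for an `A`-linear map `f`. -/
def Ind.map (f : HomA k A L M N) : Ind k A L M →ₗ[Env k A L] Ind k A L N :=
  Ind.lift (HomA.comp (Ind.unit k A L N) f)

@[simp]
theorem Ind.map_tmul (f : HomA k A L M N) (D : Env k A L) (m : M) :
    Ind.map f (Ind.tmul k A L D m) = Ind.tmul k A L D (f.1 m) := by
  simp [Ind.map]

variable (k A L M) in
/-- The `𝒱L`-linear map `𝒱L ⊗_A M → M`, `D ⊗ m ↦ Dm`. -/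
def Ind.counit : Ind k A L M →ₗ[Env k A L] M := Ind.lift (HomA.ofLinear LinearMap.id)

@[simp]
theorem Ind.counit_tmul (D : Env k A L) (m : M) : Ind.counit k A L M (Ind.tmul k A L D m) = D • m := by
  simp [Ind.counit]

end Modules

section Cocyclic

section Generic

variable {k A L : Type u} [CommRing k] [CommRing A] [Algebra k A] [LieRing L] [LieAlgebra k L]
  [Module A L] [LieRingModule L A] [LieRinehartRing A L] [LieRinehartAlgebra k A L]
  {M N Q : Type u}
  [AddCommGroup M] [Module k M] [Module (Env k A L) M] [IsScalarTower k (Env k A L) M]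
  [AddCommGroup N] [Module k N] [Module (Env k A L) N] [IsScalarTower k (Env k A L) N]
  [AddCommGroup Q] [Module k Q] [Module (Env k A L) Q] [IsScalarTower k (Env k A L) Q]

variable (M) in
/-- The map `id ⊗ f : M ⊗_A N → M ⊗_A Q` is again `A`-linear. -/
def Tens.map (f : HomA k A L N Q) : HomA k A L (Tens k A L M N) (Tens k A L M Q) :=
  ⟨Tens.mapRight M f, Tens.mapRight_iA f⟩

variable (Q) in
/-- Precomposition with an `A`-linear map. -/
def HomA.precomp (f : HomA k A L M N) : HomA k A L N Q →ₗ[k] HomA k A L M Q where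
  toFun φ := HomA.comp φ f
  map_add' _ _ := rfl
  map_smul' _ _ := rfl

@[simp]
theorem HomA.precomp_apply (f : HomA k A L M N) (φ : HomA k A L N Q) (m : M) :
    (HomA.precomp Q f φ).1 m = φ.1 (f.1 m) := rfl

/-- The `k`-linear map `Hom_A(M, N) → Hom_A(𝒱L ⊗_A M, N)`, `φ ↦ (D ⊗ m ↦ D φ(m))`. -/
def Ind.liftHom : HomA k A L M N →ₗ[k] HomA k A L (Ind k A L M) N where
  toFun φ := HomA.ofLinear (Ind.lift φ)
  map_add' φ ψ := HomA.hom_ext fun x => by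
    induction x using Ind.induction with
    | h D m => simp
    | hadd x y hx hy => rw [map_add, map_add, hx, hy]
  map_smul' c φ := HomA.hom_ext fun x => by
    induction x using Ind.induction with
    | h D m => simp [env_smul_smul]
    | hadd x y hx hy => rw [map_add, map_add, hx, hy]

theorem Ind.liftHom_tmul (φ : HomA k A L M N) (D : Env k A L) (m : M) :
    (Ind.liftHom φ).1 (Ind.tmul k A L D m) = D • φ.1 m := rfl

theorem HomA.act_add (D E : Env k A L) (φ : HomA k A L M N) (m : M) :
    (HomA.act k A L M N (D + E) φ).1 m
      = (HomA.act k A L M N D φ).1 m + (HomA.act k A L M N E φ).1 m := by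
  rw [map_add]; rfl

theorem HomA.act_smul (c : k) (D : Env k A L) (φ : HomA k A L M N) (m : M) :
    (HomA.act k A L M N (c • D) φ).1 m = c • (HomA.act k A L M N D φ).1 m := by
  rw [map_smul]; rfl

theorem HomA.act_iA_mul (a : A) (D : Env k A L) (φ : HomA k A L M N) (m : M) :
    (HomA.act k A L M N (Env.iA k A L a * D) φ).1 m
      = Env.iA k A L a • (HomA.act k A L M N D φ).1 m := by
  rw [map_mul, HomA.act_iA]; rfl

/-- The bilinear map `(E, m) ↦ (∇_E φ)(1 ⊗ m)`, where `∇` is the Grothendieck connection. -/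
def HomA.evalBilin (φ : HomA k A L (Ind k A L M) N) : Env k A L →ₗ[k] M →ₗ[k] N :=
  LinearMap.mk₂ k (fun E m => (HomA.act k A L (Ind k A L M) N E φ).1 (Ind.tmul k A L 1 m))
    (fun E E' m => HomA.act_add E E' φ _)
    (fun c E m => HomA.act_smul c E φ _)
    (fun E m m' => by rw [Ind.tmul_add]; exact map_add _ _ _)
    (fun c E m => by rw [Ind.tmul_ksmul]; exact map_smul _ _ _)

theorem HomA.evalBilin_apply (φ : HomA k A L (Ind k A L M) N) (E : Env k A L) (m : M) :
    HomA.evalBilin φ E m = (HomA.act k A L (Ind k A L M) N E φ).1 (Ind.tmul k A L 1 m) := rfl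

theorem HomA.evalBilin_iA (φ : HomA k A L (Ind k A L M) N) (a : A) (E : Env k A L) (m : M) :
    HomA.evalBilin φ (Env.iA k A L a • E) m = Env.iA k A L a • HomA.evalBilin φ E m := by
  rw [smul_eq_mul, HomA.evalBilin_apply, HomA.act_iA_mul, HomA.evalBilin_apply]

theorem HomA.evalBilin_balanced (φ : HomA k A L (Ind k A L M) N) (a : A) (E : Env k A L) (m : M) :
    HomA.evalBilin φ (Env.iA k A L a • E) m = HomA.evalBilin φ E (Env.iA k A L a • m) := by
  rw [HomA.evalBilin_iA, HomA.evalBilin_apply, HomA.evalBilin_apply, ← HomA.map_iA,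
    ← Ind.mul_iA_tmul, one_mul, Ind.smul_tmul, mul_one]

/-- For `φ : 𝒱L ⊗_A M → N`, the map `𝒱L ⊗_A M → N`, `E ⊗ m ↦ (∇_E φ)(1 ⊗ m)`, where `∇` is the
Grothendieck connection. Here both factors of the source `𝒱L ⊗_A M` are left `A`-modules. -/
def HomA.evalConn (φ : HomA k A L (Ind k A L M) N) :
    HomA k A L (Tens k A L (Env k A L) M) N :=
  ⟨Tens.lift (HomA.evalBilin φ) (HomA.evalBilin_balanced φ), fun a x => by
    induction x using Tens.induction with
    | h E m => rw [Tens.iA_smul_tmul, Tens.lift_tmul, Tens.lift_tmul, HomA.evalBilin_iA]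
    | hadd x y hx hy => rw [smul_add, map_add, map_add, smul_add, hx, hy]⟩

@[simp]
theorem HomA.evalConn_tmul (φ : HomA k A L (Ind k A L M) N) (E : Env k A L) (m : M) :
    (HomA.evalConn φ).1 (Tens.tmul k A L E m)
      = (HomA.act k A L (Ind k A L M) N E φ).1 (Ind.tmul k A L 1 m) := rfl

variable (k A L M N) in
/-- `HomA.evalConn` as a `k`-linear map. -/
def HomA.evalConnHom : HomA k A L (Ind k A L M) N →ₗ[k] HomA k A L (Tens k A L (Env k A L) M) N where
  toFun := HomA.evalConn
  map_add' φ ψ := Subtype.ext (Tens.hom_ext fun E m => by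
    exact congrArg (fun f : HomA k A L (Ind k A L M) N => f.1 (Ind.tmul k A L 1 m))
      (map_add (HomA.act k A L (Ind k A L M) N E) φ ψ))
  map_smul' c φ := Subtype.ext (Tens.hom_ext fun E m => by
    exact congrArg (fun f : HomA k A L (Ind k A L M) N => f.1 (Ind.tmul k A L 1 m))
      (map_smul (HomA.act k A L (Ind k A L M) N E) c φ))

end Generic

variable (k A L : Type u) [CommRing k] [CommRing A] [Algebra k A] [LieRing L] [LieAlgebra k L]
  [Module A L] [LieRingModule L A] [LieRinehartRing A L] [LieRinehartAlgebra k A L]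

/-- The left `𝒱L`-module `T n = 𝒱L ⊗_A ⋯ ⊗_A 𝒱L` (`n` factors, where the tensor products relate
right multiplication by `A` on one factor to left multiplication on the next one); it is written
as `𝒱L ⊗_A (⋯ ⊗_A (𝒱L ⊗_A A))`, so that `T 0 = A`. -/
def T : ℕ → ModuleCat.{u} (Env k A L)
  | 0 => ModuleCat.of (Env k A L) A
  | n + 1 => ModuleCat.of (Env k A L) (Ind k A L (T n))

/-- The jet space `J^∞L = Hom_A(𝒱L, A)` (left `A`-linear maps). -/
def Jet : Type u := HomA k A L (Env k A L) A

instance : AddCommGroup (Jet k A L) := inferInstanceAs (AddCommGroup (HomA k A L (Env k A L) A))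

instance : Module k (Jet k A L) := inferInstanceAs (Module k (HomA k A L (Env k A L) A))

/-- The space `C^n` of `n`-cochains, `C^n = Hom_A(𝒱L ⊗_A ⋯ ⊗_A 𝒱L, A)`: the `n`-fold completed tensor
power over `A` of `J^∞L`, where a tensor `h^1 ⊗ ⋯ ⊗ h^n` is identified with the function
`D_1 ⊗ ⋯ ⊗ D_n ↦ h^1(D_1 h^2(D_2 ⋯ h^n(D_n) ⋯ ))`. -/
def C (n : ℕ) : Type u := HomA k A L (T k A L n) A

instance (n : ℕ) : AddCommGroup (C k A L n) :=
  inferInstanceAs (AddCommGroup (HomA k A L (T k A L n) A))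

instance (n : ℕ) : Module k (C k A L n) :=
  inferInstanceAs (Module k (HomA k A L (T k A L n) A))

/-- The map `T (n + 1) → T n` which, for `i < n`, multiplies the factors number `i + 1` and `i + 2`,
and, for `i = n`, applies the counit of `𝒱L` to the last factor. -/
def face : ∀ n : ℕ, Fin (n + 1) → (T k A L (n + 1) →ₗ[Env k A L] T k A L n)
  | 0 => fun _ => Ind.counit k A L (T k A L 0)
  | n + 1 => Fin.cases (Ind.counit k A L (T k A L (n + 1)))
      (fun i => Ind.map (HomA.ofLinear (face n i)))

/-- The coface operators. In terms of tensors,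
`δ_0 (h^1 ⊗ ⋯ ⊗ h^n) = 1 ⊗ h^1 ⊗ ⋯ ⊗ h^n`; `δ_i` for `1 ≤ i ≤ n` is the coproduct of `J^∞L` (dual
to the product of `𝒱L`) in the `i`-th factor; `δ_{n+1} (h^1 ⊗ ⋯ ⊗ h^n) = h^1 ⊗ ⋯ ⊗ h^n ⊗ 1`.
In degree `0` they are the target map `δ_0 = t` and the source map `δ_1 = s`. -/
def coface (n : ℕ) : Fin (n + 2) → (C k A L n →ₗ[k] C k A L (n + 1)) :=
  Fin.cases Ind.liftHom (fun i => HomA.precomp A (HomA.ofLinear (face k A L n i)))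

/-- The map `T n → T (n + 1)` which inserts a factor `1` in the place number `i + 1`. -/
def degen : ∀ n : ℕ, Fin (n + 1) → HomA k A L (T k A L n) (T k A L (n + 1))
  | 0 => fun _ => Ind.unit k A L (T k A L 0)
  | n + 1 => Fin.cases (Ind.unit k A L (T k A L (n + 1)))
      (fun i => HomA.ofLinear (Ind.map (degen n i)))

/-- The codegeneracy operators: `σ_i` is the counit `h ↦ h(1)` of `J^∞L` in the factor number
`i + 1`. -/
def codegen (n : ℕ) (i : Fin (n + 1)) : C k A L (n + 1) →ₗ[k] C k A L n :=
  HomA.precomp A (degen k A L n i)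

/-- The diagonal coaction `w ↦ w_(-1) ⊗ w_(0)` of `𝒱L` on `T n`, that is,
`D_1 ⊗ ⋯ ⊗ D_n ↦ (D_1)_(1) ⋯ (D_n)_(1) ⊗ ((D_1)_(2) ⊗ ⋯ ⊗ (D_n)_(2))`. -/
def coact : ∀ n : ℕ, HomA k A L (T k A L n) (Tens k A L (Env k A L) (T k A L n))
  | 0 =>
    ⟨{ toFun := fun a => Env.iA k A L a • Tens.tmul k A L (N := T k A L 0) 1 (1 : A)
       map_add' := fun a b => by
        rw [← add_smul]; congr 1; exact (Env.iA k A L).map_add a b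
       map_smul' := fun c a => by
        rw [RingHom.id_apply, ← smul_assoc]
        congr 1
        exact (congrArg (Env.iA k A L) (algebraMap_smul (Env k A L) c (id a : A))).trans
          (map_smul (Env.iA k A L) c (id a : A)) },
      fun a b => by
        rw [LinearMap.coe_mk, AddHom.coe_mk, ← mul_smul]
        congr 1
        exact (congrArg (Env.iA k A L) (iA_smul k A L a (id b : A))).trans
          (map_mul (Env.iA k A L) a (id b : A))⟩
  | n + 1 => HomA.ofLinear (Ind.lift (HomA.comp (Tens.map _ (Ind.unit k A L (T k A L n)))
      (coact n)))

/-- The cyclic operator `τ_n (h^1 ⊗ ⋯ ⊗ h^n) = S(h^1) · (h^2 ⊗ ⋯ ⊗ h^n ⊗ 1)`, where the dot is the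
diagonal multiplication and `S` is the antipode, `(S h)(D) = (∇_D h)(1)`. -/
def cyc : ∀ n : ℕ, C k A L n →ₗ[k] C k A L n
  | 0 => LinearMap.id
  | n + 1 => HomA.precomp A (HomA.comp
        (Tens.map (Env k A L) (HomA.ofLinear (face k A L n (Fin.last n)))) (coact k A L (n + 1)))
      ∘ₗ HomA.evalConnHom k A L (T k A L n) A

end Cocyclic

section Pairing

variable {k A L : Type u} [CommRing k] [CommRing A] [Algebra k A] [LieRing L] [LieAlgebra k L]
  [Module A L] [LieRingModule L A] [LieRinehartRing A L] [LieRinehartAlgebra k A L]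
  {M : Type u} [AddCommGroup M] [Module k M] [Module (Env k A L) M] [IsScalarTower k (Env k A L) M]

variable (k A L) in
/-- The map `i_A : A → 𝒱L`, as an `A`-linear map. -/
def iAHom : HomA k A L A (Env k A L) :=
  ⟨(Env.iA k A L).toLinearMap, fun a b => by simp⟩

@[simp]
theorem iAHom_apply (a : A) : (iAHom k A L).1 a = Env.iA k A L a := rfl

/-- For `φ ∈ J^∞L` and `ψ ∈ Hom_A(M, A)`, the map `φ ⊗ ψ : D ⊗ m ↦ φ(D ψ(m))`. -/
def pair₂ (φ : HomA k A L (Env k A L) A) (ψ : HomA k A L M A) : HomA k A L (Ind k A L M) A :=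
  HomA.comp φ (HomA.ofLinear (Ind.lift (HomA.comp (iAHom k A L) ψ)))

@[simp]
theorem pair₂_tmul (φ : HomA k A L (Env k A L) A) (ψ : HomA k A L M A) (D : Env k A L) (m : M) :
    (pair₂ φ ψ).1 (Ind.tmul k A L D m) = φ.1 (D * Env.iA k A L (ψ.1 m)) := rfl

theorem HomA.ind_ext {N : Type u} [AddCommGroup N] [Module k N] [Module (Env k A L) N]
    [IsScalarTower k (Env k A L) N] {f g : HomA k A L (Ind k A L M) N}
    (h : ∀ D m, f.1 (Ind.tmul k A L D m) = g.1 (Ind.tmul k A L D m)) : f = g :=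
  HomA.hom_ext fun x => by
    induction x using Ind.induction with
    | h D m => exact h D m
    | hadd x y hx hy => rw [map_add, map_add, hx, hy]

variable (k A L) in
/-- The canonical map `J^∞L ⊗_k C^n → C^(n+1)`, which sends `φ ⊗ ψ` to `D ⊗ w ↦ φ(D ψ(w))`. -/
def pair (n : ℕ) : Jet k A L ⊗[k] C k A L n →ₗ[k] C k A L (n + 1) :=
  TensorProduct.lift (LinearMap.mk₂ k
    (fun (φ : Jet k A L) (ψ : C k A L n) => (pair₂ φ ψ : C k A L (n + 1)))
    (fun φ φ' ψ => HomA.ind_ext fun D m => rfl)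
    (fun c φ ψ => HomA.ind_ext fun D m => rfl)
    (fun φ ψ ψ' => HomA.ind_ext fun D m => by
      change φ.1 (D * Env.iA k A L (ψ.1 m + ψ'.1 m)) = φ.1 _ + φ.1 _
      rw [map_add, mul_add, map_add]; rfl)
    (fun c φ ψ => HomA.ind_ext fun D m => by
      change φ.1 (D * Env.iA k A L (c • ψ.1 m)) = c • φ.1 _
      rw [map_smul, mul_smul_comm, map_smul]; rfl))

@[simp]
theorem pair_tmul (n : ℕ) (φ : Jet k A L) (ψ : C k A L n) :
    pair k A L n (φ ⊗ₜ ψ) = pair₂ φ ψ := rfl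

theorem Jet.map_iA_mul (h : HomA k A L (Env k A L) A) (a : A) (D : Env k A L) :
    h.1 (Env.iA k A L a * D) = a * h.1 D := by
  rw [← smul_eq_mul, HomA.map_iA, iA_smul]

/-- The function `D ⊗ m ↦ h(D) ψ(m)`. -/
def tensFun (h : HomA k A L (Env k A L) A) (ψ : HomA k A L M A) : HomA k A L (Tens k A L (Env k A L) M) A :=
  ⟨Tens.lift ((LinearMap.mul k A).compl₁₂ h.1 ψ.1)
      (fun a D w => by simp [Jet.map_iA_mul, HomA.map_iA, mul_left_comm, mul_assoc]),
    fun a x => by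
      induction x using Tens.induction with
      | h D w => simp [Jet.map_iA_mul, mul_assoc]
      | hadd x y hx hy => rw [smul_add, map_add, map_add, smul_add, hx, hy]⟩

@[simp]
theorem tensFun_tmul (h : HomA k A L (Env k A L) A) (ψ : HomA k A L M A)
    (D : Env k A L) (m : M) :
    (tensFun h ψ).1 (Tens.tmul k A L D m) = h.1 D * ψ.1 m := rfl

/-- The diagonal action of the algebra `J^∞L` on the functions on `T n`, given by
`(h · ψ)(w) = h(w_(-1)) ψ(w_(0))`. -/
def jetSmul {n : ℕ} (h : Jet k A L) (ψ : C k A L n) : C k A L n :=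
  HomA.comp (tensFun h ψ) (coact k A L n)

/-- The antipode of `J^∞L`, `(S h)(D) = (∇_D h)(1)` where `∇` is the Grothendieck connection. -/
def antipode (h : Jet k A L) : Jet k A L :=
  (⟨{ toFun := fun D => (HomA.act k A L (Env k A L) A D h).1 1
      map_add' := fun D E => HomA.act_add (M := Env k A L) (N := A) D E h 1
      map_smul' := fun c D => HomA.act_smul (M := Env k A L) (N := A) c D h 1 },
    fun a D => HomA.act_iA_mul (M := Env k A L) (N := A) a D h 1⟩ : HomA k A L (Env k A L) A)

theorem antipode_apply (h : Jet k A L) (D : Env k A L) :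
    (antipode h).1 D = (HomA.act k A L (Env k A L) A D h).1 1 := rfl

theorem act_pair₂ (E : Env k A L) (φ : HomA k A L (Env k A L) A)
    (ψ : HomA k A L M A) :
    HomA.act k A L (Ind k A L M) A E (pair₂ φ ψ)
      = pair₂ (HomA.act k A L (Env k A L) A E φ) ψ := by
  induction E using Env.induction generalizing φ with
  | hA a => rw [HomA.act_iA, HomA.act_iA]; exact HomA.ind_ext fun D m => rfl
  | hL X =>
    rw [HomA.act_iL, HomA.act_iL]
    refine HomA.ind_ext fun D m => ?_
    rw [HomA.actL_apply, Ind.smul_tmul, pair₂_tmul, pair₂_tmul, pair₂_tmul, HomA.actL_apply,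
      smul_eq_mul, mul_assoc]
  | hadd D E hD hE =>
    rw [map_add, map_add, LinearMap.add_apply, hD, hE]
    exact HomA.ind_ext fun D m => rfl
  | hmul D E hD hE =>
    rw [map_mul, map_mul, Module.End.mul_apply, hE, hD]; rfl

theorem evalConn_pair₂ {N : Type u} [AddCommGroup N] [Module k N] [Module (Env k A L) N]
    [IsScalarTower k (Env k A L) N] (h : HomA k A L (Env k A L) A) (ψ : HomA k A L M A)
    (f : HomA k A L N M) :
    HomA.comp (HomA.evalConn (pair₂ h ψ)) (Tens.map (Env k A L) f)
      = tensFun (antipode h) (HomA.precomp A f ψ) := by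
  refine Subtype.ext (Tens.hom_ext fun D w => ?_)
  change (HomA.act k A L (Ind k A L M) A D (pair₂ h ψ)).1 (Ind.tmul k A L 1 (f.1 w)) =
    (HomA.act k A L (Env k A L) A D h).1 1 * ψ.1 (f.1 w)
  rw [act_pair₂, pair₂_tmul, one_mul, mul_comm, ← Jet.map_iA_mul, mul_one]

/-- The cyclic operator on tensors: `τ (h ⊗ ψ) = S(h) · (ψ ⊗ 1)`. -/
theorem cyc_pair (n : ℕ) (h : Jet k A L) (ψ : C k A L n) :
    cyc k A L (n + 1) (pair k A L n (h ⊗ₜ ψ))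
      = jetSmul (antipode h) (coface k A L n (Fin.last (n + 1)) ψ) :=
  congrArg (fun f => HomA.comp f (coact k A L (n + 1)))
    (evalConn_pair₂ h ψ (HomA.ofLinear (face k A L n (Fin.last n))))

end Pairing

section Cohomology

variable (k A L : Type u) [CommRing k] [CommRing A] [Algebra k A] [LieRing L] [LieAlgebra k L]
  [Module A L] [LieRingModule L A] [LieRinehartRing A L] [LieRinehartAlgebra k A L]

/-- The Hochschild differential `b = ∑ (-1)^i δ_i`. -/
def hochB (n : ℕ) : C k A L n →ₗ[k] C k A L (n + 1) :=
  ∑ i : Fin (n + 2), (-1 : k) ^ (i : ℕ) • coface k A L n i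

/-- The signed cyclic operator `λ = (-1)^n τ_n`. -/
def cycSgn (n : ℕ) : Module.End k (C k A L n) := (-1 : k) ^ n • cyc k A L n

/-- Connes' coboundary `B = N σ_{-1} (1 - λ)`, where `σ_{-1} = σ_n τ_{n+1}` and
`N = ∑_{j ≤ n} λ^j`. -/
def connesB (n : ℕ) : C k A L (n + 1) →ₗ[k] C k A L n :=
  (∑ j ∈ Finset.range (n + 1), cycSgn k A L n ^ j) ∘ₗ codegen k A L n (Fin.last n) ∘ₗ
    cyc k A L (n + 1) ∘ₗ (LinearMap.id - cycSgn k A L (n + 1))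

/-- Hochschild cocycles. -/
def hochZ (n : ℕ) : Submodule k (C k A L n) := LinearMap.ker (hochB k A L n)

/-- Hochschild coboundaries. -/
def hochBdry : ∀ n : ℕ, Submodule k (C k A L n)
  | 0 => ⊥
  | n + 1 => LinearMap.range (hochB k A L n)

/-- The Hochschild cohomology `HH^n(J^∞L)`. -/
abbrev HH (n : ℕ) : Type u := hochZ k A L n ⧸ (hochBdry k A L n).submoduleOf (hochZ k A L n)

/-- The differential `b + B` of the mixed complex `(C, b, B)`, on the product of all `C m`. -/
def mixedD : (∀ m, C k A L m) →ₗ[k] (∀ m, C k A L m) :=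
  LinearMap.pi fun
    | 0 => connesB k A L 0 ∘ₗ LinearMap.proj 1
    | m + 1 => hochB k A L m ∘ₗ LinearMap.proj m + connesB k A L (m + 1) ∘ₗ LinearMap.proj (m + 2)

/-- The part of degree `n` of the cyclic complex, `Tot^n = C^n ⊕ C^(n-2) ⊕ C^(n-4) ⊕ ⋯`. -/
def Tot (n : ℕ) : Submodule k (∀ m, C k A L m) where
  carrier := {f | ∀ m, ¬ (m ≤ n ∧ Even (m + n)) → f m = 0}
  add_mem' hf hg m hm := by rw [Pi.add_apply, hf m hm, hg m hm, add_zero]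
  zero_mem' m _ := rfl
  smul_mem' c f hf m hm := by rw [Pi.smul_apply, hf m hm, smul_zero]

/-- Cyclic cocycles: the kernel of `b + B : Tot^n → Tot^(n+1)`. -/
def cycZ (n : ℕ) : Submodule k (∀ m, C k A L m) := Tot k A L n ⊓ LinearMap.ker (mixedD k A L)

/-- Cyclic coboundaries: the image of `b + B : Tot^(n-1) → Tot^n`. -/
def cycBdry : ∀ _ : ℕ, Submodule k (∀ m, C k A L m)
  | 0 => ⊥
  | n + 1 => (Tot k A L n).map (mixedD k A L)

/-- The cyclic cohomology `HC^n(J^∞L)`. -/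
abbrev HC (n : ℕ) : Type u := cycZ k A L n ⧸ (cycBdry k A L n).submoduleOf (cycZ k A L n)

theorem apply_mem_hochZ (n : ℕ) (f : ∀ m, C k A L m) (hf : f ∈ cycZ k A L n) :
    f n ∈ hochZ k A L n := by
  have h1 := congrFun (LinearMap.mem_ker.1 hf.2) (n + 1)
  have h2 : f (n + 2) = 0 := hf.1 _ (by omega)
  change hochB k A L n (f n) + connesB k A L (n + 1) (f (n + 2)) = 0 at h1
  rwa [h2, map_zero, add_zero] at h1

theorem Tot_le (n : ℕ) : Tot k A L n ≤ Tot k A L (n + 2) := fun f hf m hm =>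
  hf m fun h => hm ⟨by omega, by rw [← add_assoc]; exact h.2.add even_two⟩

/-- The canonical map `I : HC^n → HH^n`, `(f_n, f_(n-2), …) ↦ f_n`. -/
def mapI (n : ℕ) : HC k A L n →ₗ[k] HH k A L n :=
  Submodule.mapQ _ _
    ((LinearMap.proj n ∘ₗ (cycZ k A L n).subtype).codRestrict (hochZ k A L n)
      (fun f => apply_mem_hochZ k A L n f.1 f.2)) (by
    rintro ⟨f, hf⟩ hf'
    change f n ∈ hochBdry k A L n
    change f ∈ cycBdry k A L n at hf'
    cases n with
    | zero =>
      obtain rfl : f = 0 := hf'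
      exact Submodule.zero_mem _
    | succ n =>
      obtain ⟨g, hg, rfl⟩ := hf'
      have h2 : g (n + 2) = 0 := hg _ (by omega)
      change hochB k A L n (g n) + connesB k A L (n + 1) (g (n + 2)) ∈ _
      rw [h2, map_zero, add_zero]
      exact ⟨g n, rfl⟩)

/-- The periodicity operator `S : HC^n → HC^(n+2)`, induced by the inclusion of `Tot^n` in
`Tot^(n+2)`. -/
def mapS (n : ℕ) : HC k A L n →ₗ[k] HC k A L (n + 2) :=
  Submodule.mapQ _ _ (Submodule.inclusion (inf_le_inf_right _ (Tot_le k A L n))) (by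
    rintro ⟨f, hf⟩ hf'
    change f ∈ cycBdry k A L (n + 2)
    change f ∈ cycBdry k A L n at hf'
    cases n with
    | zero =>
      obtain rfl : f = 0 := hf'
      exact Submodule.zero_mem _
    | succ n =>
      obtain ⟨g, hg, rfl⟩ := hf'
      exact ⟨g, Tot_le k A L n hg, rfl⟩)

end Cohomology

section BarStep

variable {k A L : Type u} [CommRing k] [CommRing A] [Algebra k A] [LieRing L] [LieAlgebra k L]
  [Module A L] [LieRingModule L A] [LieRinehartRing A L] [LieRinehartAlgebra k A L]
  {M : Type u} [AddCommGroup M] [Module k M] [Module (Env k A L) M] [IsScalarTower k (Env k A L) M]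

/-- The map `D ⊗ w ↦ D w - D ⊗ f(w)`. -/
def Ind.barStep (f : Ind k A L M →ₗ[Env k A L] M) :
    Ind k A L (Ind k A L M) →ₗ[Env k A L] Ind k A L M :=
  Ind.counit k A L (Ind k A L M) - Ind.map (HomA.ofLinear f)

theorem Ind.barStep_tmul (f : Ind k A L M →ₗ[Env k A L] M) (D : Env k A L) (w : Ind k A L M) :
    Ind.barStep f (Ind.tmul k A L D w) = D • w - Ind.tmul k A L D (f w) := by
  simp [Ind.barStep]

variable (M) in
theorem Ind.counit_comp_barStep :
    Ind.counit k A L M ∘ₗ Ind.barStep (Ind.counit k A L M) = 0 := by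
  refine LinearMap.ext fun x => ?_
  induction x using Ind.induction with
  | h D w => simp [Ind.barStep_tmul]
  | hadd x y hx hy => rw [map_add, map_add, hx, hy]

theorem Ind.barStep_comp_barStep (f : Ind k A L M →ₗ[Env k A L] M)
    (hf : f ∘ₗ Ind.barStep f = 0) : Ind.barStep f ∘ₗ Ind.barStep (Ind.barStep f) = 0 := by
  refine LinearMap.ext fun x => ?_
  induction x using Ind.induction with
  | h D w =>
    have h : f (Ind.barStep f w) = 0 := LinearMap.congr_fun hf w
    have h0 : Ind.tmul k A L D (0 : M) = 0 := by
      have := Ind.tmul_ksmul (k := k) (A := A) (L := L) 0 D (0 : M)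
      rwa [zero_smul, zero_smul] at this
    rw [LinearMap.comp_apply, Ind.barStep_tmul, map_sub, map_smul, Ind.barStep_tmul, h, h0,
      sub_zero, sub_self, LinearMap.zero_apply]
  | hadd x y hx hy => rw [map_add, map_add, hx, hy]

theorem Ind.barStep_eq_sum {n : ℕ} (g : Fin n → (Ind k A L M →ₗ[Env k A L] M))
    (f : Ind k A L M →ₗ[Env k A L] M) (hf : f = ∑ i : Fin n, (-1 : ℤ) ^ (i : ℕ) • g i) :
    Ind.barStep f = ∑ i : Fin (n + 1), (-1 : ℤ) ^ (i : ℕ) •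
      (Fin.cases (motive := fun _ => Ind k A L (Ind k A L M) →ₗ[Env k A L] Ind k A L M)
        (Ind.counit k A L (Ind k A L M)) (fun i => Ind.map (HomA.ofLinear (g i))) i) := by
  have key : Ind.map (HomA.ofLinear f)
      = ∑ i : Fin n, (-1 : ℤ) ^ (i : ℕ) • Ind.map (HomA.ofLinear (g i)) := by
    refine LinearMap.ext fun x => ?_
    induction x using Ind.induction with
    | h D w =>
      let t : M →+ Ind k A L M := AddMonoidHom.mk' (Ind.tmul k A L D) (Ind.tmul_add D)
      have h : t (f w) = ∑ i : Fin n, (-1 : ℤ) ^ (i : ℕ) • t (g i w) := by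
        rw [hf, LinearMap.sum_apply, map_sum]
        exact Finset.sum_congr rfl fun i _ => map_zsmul t _ _
      rw [LinearMap.sum_apply, Ind.map_tmul]
      refine h.trans (Finset.sum_congr rfl fun i _ => ?_)
      rw [LinearMap.smul_apply, Ind.map_tmul]
      rfl
    | hadd x y hx hy => rw [map_add, map_add, hx, hy]
  rw [Ind.barStep, key, Fin.sum_univ_succ, Fin.val_zero, pow_zero, one_smul, sub_eq_add_neg,
    ← Finset.sum_neg_distrib]
  refine congrArg _ (Finset.sum_congr rfl fun i _ => ?_)
  rw [Fin.val_succ, pow_succ, mul_neg_one, neg_smul]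
  rfl

end BarStep

section Comparison

variable (k A L : Type u) [CommRing k] [CommRing A] [Algebra k A] [LieRing L] [LieAlgebra k L]
  [Module A L] [LieRingModule L A] [LieRinehartRing A L] [LieRinehartAlgebra k A L]

/-- The bar differential `T (n + 1) → T n`, that is the alternating sum `∑ (-1)^i face_i`, written
as `D ⊗ w ↦ D w - D ⊗ ∂w`. -/
def barD : ∀ n : ℕ, T k A L (n + 1) →ₗ[Env k A L] T k A L n
  | 0 => Ind.counit k A L (T k A L 0)
  | n + 1 => Ind.barStep (M := T k A L n) (barD n)

theorem barD_comp : ∀ n : ℕ, barD k A L n ∘ₗ barD k A L (n + 1) = 0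
  | 0 => Ind.counit_comp_barStep (T k A L 0)
  | n + 1 => Ind.barStep_comp_barStep (barD k A L n) (barD_comp n)

theorem barD_eq_sum : ∀ n : ℕ,
    barD k A L n = ∑ i : Fin (n + 1), (-1 : ℤ) ^ (i : ℕ) • face k A L n i
  | 0 => by
    rw [Fin.sum_univ_one, Fin.val_zero, pow_zero, one_smul]; rfl
  | n + 1 => Ind.barStep_eq_sum (face k A L n) (barD k A L n) (barD_eq_sum n)

/-- The bar complex `⋯ → 𝒱L ⊗_A 𝒱L ⊗_A 𝒱L → 𝒱L ⊗_A 𝒱L → 𝒱L` of left `𝒱L`-modules. -/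
def barComplex : ChainComplex (ModuleCat.{u} (Env k A L)) ℕ :=
  ChainComplex.of (fun n => T k A L (n + 1)) (fun n => ModuleCat.ofHom (barD k A L (n + 1)))
    (fun n => ModuleCat.hom_ext (barD_comp k A L (n + 1)))

/-- `A` as a left `𝒱L`-module. -/
abbrev baseMod : ModuleCat.{u} (Env k A L) := ModuleCat.of (Env k A L) A

/-- The augmentation of the bar complex, `D ⊗ a ↦ D(a)`. -/
def barAug : barComplex k A L ⟶ (ChainComplex.single₀ (ModuleCat.{u} (Env k A L))).obj (baseMod k A L) :=
  (ChainComplex.toSingle₀Equiv _ _).symm ⟨ModuleCat.ofHom (barD k A L 0), by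
    have h : (barComplex k A L).d 1 0 = ModuleCat.ofHom (barD k A L 1) :=
      ChainComplex.of_d (fun n => T k A L (n + 1)) (fun n => ModuleCat.ofHom (barD k A L (n + 1))) 0
    rw [h]
    exact ModuleCat.hom_ext (barD_comp k A L 0)⟩

/-- The bar complex as a projective resolution of `A`, if it is one. -/
def barRes (hP : ∀ n, Projective ((barComplex k A L).X n)) (hQ : QuasiIso (barAug k A L)) :
    ProjectiveResolution (baseMod k A L) where
  complex := barComplex k A L
  projective := hP
  π := barAug k A L
  quasiIso := hQ

variable {k A L} in
/-- The `𝒱L`-linear map `𝒱L ⊗_A T n → A`, `D ⊗ w ↦ D(φ(w))` defined by a cochain `φ`, as a cochain on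
the bar complex. -/
def barCochain {n : ℕ} (φ : C k A L n) : (barComplex k A L).X n ⟶ baseMod k A L :=
  ModuleCat.ofHom (Ind.lift φ)

/-- The Lie-Rinehart cohomology `H^n(L, A) = Ext^n_{𝒱L}(A, A)`. -/
abbrev LRCohomology (n : ℕ) : Type u := Abelian.Ext (baseMod k A L) (baseMod k A L) n

/-- The canonical filtration of `𝒱L`: `envFil p` is spanned by the products
`a X_1 ⋯ X_q` with `q ≤ p`. -/
def envFil : ℕ → Submodule k (Env k A L)
  | 0 => LinearMap.range (Env.iA k A L).toLinearMap
  | p + 1 => envFil p ⊔ envFil p * LinearMap.range (Env.iL k A L)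

/-- The induced filtration of `T n`. -/
def filT : ∀ n : ℕ, ℕ → Submodule k (T k A L n)
  | 0, _ => ⊤
  | n + 1, p => Submodule.span k {x | ∃ (i j : ℕ) (D : Env k A L) (w : T k A L n),
      i + j ≤ p ∧ D ∈ envFil k A L i ∧ w ∈ filT n j ∧ x = Ind.tmul k A L D w}

/-- The decreasing filtration of `J^∞L`: the functions which vanish on differential operators of
order `< p`. Thus `J^∞L` modulo the `(p+1)`-st step is the space of `p`-jets. -/
def jetFil (p : ℕ) : Submodule k (Jet k A L) where
  carrier := {φ | ∀ q < p, ∀ D ∈ envFil k A L q, φ.1 D = 0}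
  add_mem' {φ ψ} hφ hψ q hq D hD := by
    change φ.1 D + ψ.1 D = 0
    rw [hφ q hq D hD, hψ q hq D hD, add_zero]
  zero_mem' _ _ _ _ := rfl
  smul_mem' c φ hφ q hq D hD := by
    change c • φ.1 D = 0
    rw [hφ q hq D hD, smul_zero]

/-- The decreasing filtration of `C^n` which is dual to the filtration of `T n`. -/
def cochFil (n p : ℕ) : Submodule k (C k A L n) where
  carrier := {φ | ∀ q < p, ∀ w ∈ filT k A L n q, φ.1 w = 0}
  add_mem' {φ ψ} hφ hψ q hq w hw := by
    change φ.1 w + ψ.1 w = 0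
    rw [hφ q hq w hw, hψ q hq w hw, add_zero]
  zero_mem' _ _ _ _ := rfl
  smul_mem' c φ hφ q hq w hw := by
    change c • φ.1 w = 0
    rw [hφ q hq w hw, smul_zero]

variable {k A L} in
/-- The multiplication by `t(a)` on `J^∞L`, `(t(a)φ)(D) = φ(Da)`. -/
def targetMul (a : A) (φ : Jet k A L) : Jet k A L :=
  (⟨φ.1 ∘ₗ LinearMap.mulRight k (Env.iA k A L a), fun b D => by
    change φ.1 (Env.iA k A L b * D * Env.iA k A L a) = _
    rw [mul_assoc]; exact φ.2 b _⟩ : HomA k A L (Env k A L) A)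

variable {k A L} in
/-- The multiplication by `s(a)` on the first factor of `C^n`, `(s(a)ψ)(w) = aψ(w)`. -/
def sourceMul {n : ℕ} (a : A) (ψ : C k A L n) : C k A L n := HomA.actA k A L (T k A L n) A a ψ

/-- The submodule of `J^∞L ⊗_k C^n` which is divided out in order to obtain the quotient number `p`
of the completion of `J^∞L ⊗_A C^n`, that is, `J^∞L ⊗_A C^n` modulo the step number `p` of the
tensor product filtration. -/
def tensorFil (n p : ℕ) : Submodule k (Jet k A L ⊗[k] C k A L n) :=
  Submodule.span k
    ({x | ∃ (a : A) (φ : Jet k A L) (ψ : C k A L n),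
        x = targetMul a φ ⊗ₜ[k] ψ - φ ⊗ₜ[k] sourceMul a ψ} ∪
      {x | ∃ (i j : ℕ) (φ : Jet k A L) (ψ : C k A L n), i + j = p ∧ φ ∈ jetFil k A L i ∧
        ψ ∈ cochFil k A L n j ∧ x = φ ⊗ₜ[k] ψ})

/-- The completed tensor product `J^∞L ⊗̂_A C^n`, the limit over `p` of the quotients of
`J^∞L ⊗_A C^n` by the tensor product filtration, as the space of compatible families. -/
def completedTensor (n : ℕ) :
    Submodule k (∀ p, (Jet k A L ⊗[k] C k A L n) ⧸ tensorFil k A L n p) where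
  carrier := {x | ∀ p q, p ≤ q → ∃ y : Jet k A L ⊗[k] C k A L n,
    x p = (tensorFil k A L n p).mkQ y ∧ x q = (tensorFil k A L n q).mkQ y}
  add_mem' {x x'} hx hx' p q hpq := by
    obtain ⟨y, h1, h2⟩ := hx p q hpq
    obtain ⟨y', h1', h2'⟩ := hx' p q hpq
    exact ⟨y + y', by rw [Pi.add_apply, h1, h1', map_add], by rw [Pi.add_apply, h2, h2', map_add]⟩
  zero_mem' p q _ := ⟨0, by simp, by simp⟩
  smul_mem' c x hx p q hpq := by
    obtain ⟨y, h1, h2⟩ := hx p q hpq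
    exact ⟨c • y, by rw [Pi.smul_apply, h1, map_smul], by rw [Pi.smul_apply, h2, map_smul]⟩

end Comparison

end

end LieRinehart

/-! The Hochschild part is the bar resolution; the cyclic part rests on coordinates in which the
cyclic operator is a rotation, and on an antisymmetrization that kills Connes' operator B.

Dual bases. The algebra 𝒱L has a dual basis over A, indexed by words in generators of L, with
finitely many words in each filtration degree and with coordinates that vanish on lower degrees
(`nonempty_adaptedBasis_env`). When L is free this is the Poincaré–Birkhoff–Witt theorem: one builds
an action of L on polynomials by recursion on the degree and checks that it is flat
(`PBW.curv_eq_zero`). When L is only projective, L ⊕ A^(J) with A^(J) an abelian ideal is free for a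
suitable J. It contains L and projects onto L, so 𝒱L is a filtered A-linear retract of polynomials.
Products of dual bases serve the modules T n. They identify C^(n+1) with a completed tensor product
(`exists_completedTensor_equiv`) and make the bar modules projective (`projective_barComplex_X`).
The bar complex is contracted by w ↦ 1 ⊗ w, and b is the transpose of its differential, so HH is Ext
(`hochEquivLR`).

Homogeneous coordinates. The module 𝒱L ⊗_A M induced from M is isomorphic to 𝒱L ⊗_A M with the
diagonal action of L. By iteration T n becomes the n-fold tensor power of 𝒱L over A for left
multiplication, with pure tensors `hgen`. An n-cochain is then an equivariant A-multilinear function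
of n + 1 arguments. The i-th coface omits the argument D_i and multiplies by D_i(1)
(`homog_coface`), and τ rotates the arguments (`homog_cyc`), as for homogeneous cochains of a group.
The cyclic identities follow at once, and the usual computation with λ, the norm and the extra
codegeneracy gives a mixed complex.

Antisymmetrization. Over ℚ, averaging over permutations with signs is a 𝒱L-linear endomorphism of
the augmented bar complex which is the identity in bar degree 0, hence homotopic to the identity
(`antisymC_sub_mem`). The rotation of n + 1 letters has sign (-1)^n, so antisymmetric cochains are
fixed by λ, and B, which begins with 1 - λ, kills them (`connesB_antisymC`). Thus every Hochschild
class is represented by a cochain that is a cyclic cocycle by itself. This splits I and makes S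
injective (`mapS_injective`); the sequences 0 → HC^n → HC^(n+2) → HH^(n+2) → 0 are split exact, and
induction by steps of two adds up the summands (`hcPi`). -/

namespace LieRinehart

noncomputable section

/-! ### Poincaré–Birkhoff–Witt for Lie–Rinehart algebras that are free as modules. -/

theorem exists_minimal_cons {ι : Type*} [LinearOrder ι] (M : Multiset ι) (hM : M ≠ 0) :
    ∃ (j : ι) (N : Multiset ι), M = j ::ₘ N ∧ ∀ x ∈ N, j ≤ x := by
  induction M using Multiset.induction_on with
  | empty => exact absurd rfl hM
  | cons i M ih =>
    by_cases h : M = 0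
    · exact ⟨i, M, rfl, by simp [h]⟩
    · obtain ⟨j, N, rfl, hN⟩ := ih h
      rcases le_total i j with hij | hij
      · refine ⟨i, j ::ₘ N, rfl, fun x hx => ?_⟩
        rcases Multiset.mem_cons.1 hx with rfl | hx
        · exact hij
        · exact hij.trans (hN x hx)
      · refine ⟨j, i ::ₘ N, Multiset.cons_swap _ _ _, fun x hx => ?_⟩
        rcases Multiset.mem_cons.1 hx with rfl | hx
        · exact hij
        · exact hN x hx

/-- The recursion in `PBW.stage` picks a splitting of a multiset by choice; uniqueness makes the
result independent of that choice. -/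
theorem minimal_cons_unique {ι : Type*} [LinearOrder ι] {j j' : ι} {N N' : Multiset ι}
    (h : j ::ₘ N = j' ::ₘ N') (hN : ∀ x ∈ N, j ≤ x) (hN' : ∀ x ∈ N', j' ≤ x) :
    j = j' ∧ N = N' := by
  have h1 : j ∈ j' ::ₘ N' := h ▸ Multiset.mem_cons_self _ _
  have h2 : j' ∈ j ::ₘ N := h ▸ Multiset.mem_cons_self _ _
  have hj : j = j' := by
    rcases Multiset.mem_cons.1 h1 with h1 | h1
    · exact h1
    rcases Multiset.mem_cons.1 h2 with h2 | h2
    · exact h2.symm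
    exact le_antisymm (hN _ h2) (hN' _ h1)
  subst hj
  exact ⟨rfl, (Multiset.cons_inj_right _).1 h⟩

namespace PBW

variable (k : Type*) {A 𝔤 ι : Type*} [CommRing k] [CommRing A] [Algebra k A] [LieRing 𝔤]
  [LieAlgebra k 𝔤] [Module A 𝔤] [LieRingModule 𝔤 A] [LieRinehartRing A 𝔤]
  [LieRinehartAlgebra k A 𝔤] [LinearOrder ι] (b : Module.Basis ι A 𝔤)

/-- The operator on polynomials which is determined by the anchor on coefficients and by `g` on
monomials. -/
def opr (g : Multiset ι → 𝔤 →ₗ[A] (Multiset ι →₀ A)) (X : 𝔤) :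
    Module.End k (Multiset ι →₀ A) :=
  Finsupp.mapRange.linearMap
      ({ toFun := fun a => ⁅X, a⁆
         map_add' := fun a b => lie_add X a b
         map_smul' := fun c a => lie_smul c X a } : A →ₗ[k] A) +
    (Finsupp.linearCombination A (fun M => g M X)).restrictScalars k

section opr

variable {k} (g : Multiset ι → 𝔤 →ₗ[A] (Multiset ι →₀ A))

theorem opr_single (X : 𝔤) (M : Multiset ι) (a : A) :
    opr k g X (Finsupp.single M a) = Finsupp.single M ⁅X, a⁆ + a • g M X := by
  simp [opr]

theorem lie_one (X : 𝔤) : ⁅X, (1 : A)⁆ = 0 := by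
  have h := LieRinehartRing.leibniz_mul_right' (A := A) X 1 1
  simpa using h

theorem opr_single_one (X : 𝔤) (M : Multiset ι) :
    opr k g X (Finsupp.single M 1) = g M X := by
  rw [opr_single, lie_one]; simp

/-- The Leibniz rule needs nothing from `g`: the anchor acts on coefficients by derivations, and `g`
enters only through coefficients. -/
theorem opr_smul (X : 𝔤) (a : A) (s : Multiset ι →₀ A) :
    opr k g X (a • s) = ⁅X, a⁆ • s + a • opr k g X s := by
  induction s using Finsupp.induction_linear with
  | zero => simp
  | add s t hs ht => rw [smul_add, map_add, map_add, hs, ht]; simp only [smul_add]; abel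
  | single M c =>
    rw [Finsupp.smul_single, opr_single, opr_single, smul_eq_mul,
      LieRinehartRing.leibniz_mul_right', Finsupp.smul_single, smul_add, Finsupp.smul_single,
      smul_smul, Finsupp.single_add]
    simp only [smul_eq_mul]
    abel

theorem opr_add_left (X Y : 𝔤) (s : Multiset ι →₀ A) :
    opr k g (X + Y) s = opr k g X s + opr k g Y s := by
  induction s using Finsupp.induction_linear with
  | zero => simp
  | add s t hs ht => rw [map_add, map_add, map_add, hs, ht]; abel
  | single M c =>
    rw [opr_single, opr_single, opr_single, add_lie, map_add, Finsupp.single_add, smul_add]; abel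

theorem opr_smul_left (a : A) (X : 𝔤) (s : Multiset ι →₀ A) :
    opr k g (a • X) s = a • opr k g X s := by
  induction s using Finsupp.induction_linear with
  | zero => simp
  | add s t hs ht => rw [map_add, map_add, hs, ht, smul_add]
  | single M c =>
    rw [opr_single, opr_single, LieRinehartRing.lie_smul_eq_mul', map_smul, smul_add,
      Finsupp.smul_single, smul_comm c a]; rfl

/-- The polynomials of degree at most `p`. -/
abbrev Deg (A ι : Type*) [CommRing A] (p : ℕ) : Submodule A (Multiset ι →₀ A) :=
  Finsupp.supported A A {M | Multiset.card M ≤ p}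

theorem single_mem_Deg {p : ℕ} {M : Multiset ι} (h : Multiset.card M ≤ p) (a : A) :
    Finsupp.single M a ∈ Deg A ι p :=
  Finsupp.single_mem_supported A a h

theorem Deg_mono {p q : ℕ} (h : p ≤ q) : Deg A ι p ≤ Deg A ι q :=
  Finsupp.supported_mono fun _ hM => le_trans hM h

theorem Deg_induction {p : ℕ} {P : (Multiset ι →₀ A) → Prop} (h0 : P 0)
    (hadd : ∀ s t, P s → P t → P (s + t))
    (h : ∀ M a, Multiset.card M ≤ p → P (Finsupp.single M a)) {s : Multiset ι →₀ A}
    (hs : s ∈ Deg A ι p) : P s := by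
  rw [← Finsupp.sum_single s]
  refine Finset.sum_induction _ P hadd h0 fun M hM => h M _ ?_
  exact (Finsupp.mem_supported A s).1 hs hM

theorem opr_congr {g g' : Multiset ι → 𝔤 →ₗ[A] (Multiset ι →₀ A)} {p : ℕ}
    (h : ∀ M, Multiset.card M ≤ p → g M = g' M) (X : 𝔤) {s : Multiset ι →₀ A}
    (hs : s ∈ Deg A ι p) : opr k g X s = opr k g' X s := by
  refine Deg_induction (P := fun s => opr k g X s = opr k g' X s) (by simp)
    (fun s t hs ht => ?_) (fun M a hM => ?_) hs
  · rw [map_add, map_add, hs, ht]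
  · rw [opr_single, opr_single, h M hM]

theorem opr_mem_Deg {p : ℕ} (h : ∀ M, Multiset.card M ≤ p → ∀ i, g M (b i) ∈ Deg A ι (p + 1))
    (X : 𝔤) {s : Multiset ι →₀ A} (hs : s ∈ Deg A ι p) : opr k g X s ∈ Deg A ι (p + 1) := by
  refine Deg_induction (P := fun s => opr k g X s ∈ Deg A ι (p + 1)) (by simp)
    (fun s t hs ht => ?_) (fun M a hM => ?_) hs
  · rw [map_add]; exact add_mem hs ht
  · rw [opr_single]
    refine add_mem (single_mem_Deg (by omega) _) (Submodule.smul_mem _ _ ?_)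
    rw [← b.linearCombination_repr X, Finsupp.linearCombination_apply, Finsupp.sum, map_sum]
    exact Submodule.sum_mem _ fun i _ => by
      rw [map_smul]; exact Submodule.smul_mem _ _ (h M hM i)

end opr

open Classical in
/-- The approximations to the action of `𝔤` on monomials; stage `p` is correct in degrees `≤ p`. -/
def stage : ℕ → Multiset ι → 𝔤 →ₗ[A] (Multiset ι →₀ A)
  | 0, M => b.constr A fun i => Finsupp.single (i ::ₘ M) 1
  | p + 1, M => if Multiset.card M ≤ p then stage p M else b.constr A fun i =>
      -- The value is forced by flatness. For M = j::N with j minimal and j < i, put w = b_i N -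
      -- (i::N). Then b_i b_j N = b_j b_i N + [b_i, b_j] N = (i::j::N) + b_j w + [b_i, b_j] N. Both
      -- N and w have degree at most p, where the previous stage is already correct.
      if h : ∃ x : ι × Multiset ι, M = x.1 ::ₘ x.2 ∧ (∀ y ∈ x.2, x.1 ≤ y) ∧ x.1 < i then
        Finsupp.single (i ::ₘ M) 1 +
          opr k (stage p) (b h.choose.1) (opr k (stage p) (b i) (Finsupp.single h.choose.2 1)
            - Finsupp.single (i ::ₘ h.choose.2) 1) +
          opr k (stage p) ⁅b i, b h.choose.1⁆ (Finsupp.single h.choose.2 1)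
      else Finsupp.single (i ::ₘ M) 1

/-- The action of `𝔤` on polynomials. -/
def act (X : 𝔤) : Module.End k (Multiset ι →₀ A) :=
  opr k (fun M => stage k b (Multiset.card M) M) X

theorem stage_eq {p : ℕ} {M : Multiset ι} (h : Multiset.card M ≤ p) :
    stage k b p M = stage k b (Multiset.card M) M := by
  induction p with
  | zero => rw [Nat.le_zero.1 h]
  | succ p ih =>
    rcases h.lt_or_eq with h' | h'
    · rw [stage, if_pos (Nat.lt_succ_iff.1 h'), ih (Nat.lt_succ_iff.1 h')]
    · rw [h']

theorem opr_stage {p : ℕ} (X : 𝔤) {s : Multiset ι →₀ A} (hs : s ∈ Deg A ι p) :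
    opr k (stage k b p) X s = act k b X s :=
  opr_congr (fun _ hM => stage_eq k b hM) X hs

theorem act_single_of_le (i : ι) (M : Multiset ι) (h : ∀ x ∈ M, i ≤ x) :
    act k b (b i) (Finsupp.single M 1) = Finsupp.single (i ::ₘ M) 1 := by
  rw [act, opr_single_one]
  rcases hp : Multiset.card M with _ | p
  · simp [stage]
  · rw [stage, if_neg (by omega), Module.Basis.constr_basis, dif_neg]
    rintro ⟨⟨j, N⟩, hM, -, hji⟩
    exact absurd (h j (hM ▸ Multiset.mem_cons_self _ _)) (not_le.2 hji)

/-- The hypothesis `hdeg` lets the stage used in the recursion be replaced by the final action on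
the correction term; `act_single_sub_mem` supplies it. -/
theorem act_single_of_lt (i j : ι) (N : Multiset ι) (hj : ∀ x ∈ N, j ≤ x) (hji : j < i)
    (hdeg : act k b (b i) (Finsupp.single N 1) - Finsupp.single (i ::ₘ N) 1
      ∈ Deg A ι (Multiset.card N)) :
    act k b (b i) (Finsupp.single (j ::ₘ N) 1) = Finsupp.single (i ::ₘ j ::ₘ N) 1 +
      act k b (b j) (act k b (b i) (Finsupp.single N 1) - Finsupp.single (i ::ₘ N) 1) +
      act k b ⁅b i, b j⁆ (Finsupp.single N 1) := by
  have hN : Finsupp.single N (1 : A) ∈ Deg A ι (Multiset.card N) := single_mem_Deg le_rfl _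
  rw [act, opr_single_one, Multiset.card_cons, stage, if_neg (by simp),
    Module.Basis.constr_basis]
  have h : ∃ x : ι × Multiset ι, j ::ₘ N = x.1 ::ₘ x.2 ∧ (∀ y ∈ x.2, x.1 ≤ y) ∧ x.1 < i :=
    ⟨(j, N), rfl, hj, hji⟩
  rw [dif_pos h]
  obtain ⟨h1, h2⟩ := minimal_cons_unique h.choose_spec.1 hj h.choose_spec.2.1
  rw [← h1, ← h2, opr_stage k b (b i) hN, opr_stage k b _ hdeg, opr_stage k b _ hN]
  rfl

theorem act_smul (X : 𝔤) (a : A) (s : Multiset ι →₀ A) :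
    act k b X (a • s) = ⁅X, a⁆ • s + a • act k b X s := opr_smul _ X a s

theorem act_add_left (X Y : 𝔤) (s : Multiset ι →₀ A) :
    act k b (X + Y) s = act k b X s + act k b Y s := opr_add_left _ X Y s

theorem act_smul_left (a : A) (X : 𝔤) (s : Multiset ι →₀ A) :
    act k b (a • X) s = a • act k b X s := opr_smul_left _ a X s

/-- To leading order a basis vector acts by multiplication. The strong induction plays two roles: it
validates the recursion formula for a smaller multiset, and it bounds the degree of the two
correction terms in that formula. -/
theorem act_single_sub_mem (p : ℕ) : ∀ (M : Multiset ι), Multiset.card M = p → ∀ i,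
    act k b (b i) (Finsupp.single M 1) - Finsupp.single (i ::ₘ M) 1 ∈ Deg A ι p := by
  induction p using Nat.strong_induction_on with
  | _ p ih =>
  intro M hM i
  by_cases h : ∀ x ∈ M, i ≤ x
  · rw [act_single_of_le k b i M h, sub_self]; exact zero_mem _
  push Not at h
  obtain ⟨x, hx, hxi⟩ := h
  obtain ⟨j, N, rfl, hN⟩ := exists_minimal_cons M (by rintro rfl; simp at hx)
  have hji : j < i := by
    rcases Multiset.mem_cons.1 hx with rfl | hx
    · exact hxi
    · exact (hN x hx).trans_lt hxi
  rw [Multiset.card_cons] at hM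
  have hN1 := ih (Multiset.card N) (by omega) N rfl
  have key : ∀ X, ∀ s ∈ Deg A ι (Multiset.card N), act k b X s ∈ Deg A ι p := by
    intro X s hs
    rw [← hM]
    refine opr_mem_Deg b _ (fun M' hM' i' => ?_) X hs
    have h1 := ih (Multiset.card M') (by omega) M' rfl i'
    rw [act, opr_single_one] at h1
    have h2 := add_mem (Deg_mono (le_trans hM' (Nat.le_succ _)) h1) (single_mem_Deg (A := A)
      (M := i' ::ₘ M') (p := Multiset.card N + 1) (by simpa using hM') 1)
    rwa [sub_add_cancel] at h2
  have habel : ∀ s t u : Multiset ι →₀ A, s + t + u - s = t + u := fun s t u => by abel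
  rw [act_single_of_lt k b i j N hN hji (hN1 i), habel]
  exact add_mem (key _ _ (hN1 i)) (key _ _ (single_mem_Deg le_rfl _))

/-- The curvature of the action of `𝔤` on polynomials. -/
def curv (X Y : 𝔤) (s : Multiset ι →₀ A) : Multiset ι →₀ A :=
  act k b X (act k b Y s) - act k b Y (act k b X s) - act k b ⁅X, Y⁆ s

theorem act_zero_left (s : Multiset ι →₀ A) : act k b 0 s = 0 := by
  have h := act_add_left k b 0 0 s
  simpa using h

theorem act_neg_left (X : 𝔤) (s : Multiset ι →₀ A) : act k b (-X) s = -act k b X s := by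
  have h := act_add_left k b (-X) X s
  rw [neg_add_cancel, act_zero_left] at h
  exact eq_neg_of_add_eq_zero_left h.symm

theorem curv_skew (X Y : 𝔤) (s : Multiset ι →₀ A) : curv k b X Y s = -curv k b Y X s := by
  rw [curv, curv, ← lie_skew X Y, act_neg_left]; abel

theorem curv_add_right (X Y Z : 𝔤) (s : Multiset ι →₀ A) :
    curv k b X (Y + Z) s = curv k b X Y s + curv k b X Z s := by
  simp only [curv, act_add_left, map_add, lie_add]; abel

theorem curv_smul_right (a : A) (X Y : 𝔤) (s : Multiset ι →₀ A) :
    curv k b X (a • Y) s = a • curv k b X Y s := by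
  simp only [curv, act_smul_left, act_smul, LieRinehartRing.leibniz_smul_right', act_add_left,
    smul_sub]
  abel

theorem curv_add (X Y : 𝔤) (s t : Multiset ι →₀ A) :
    curv k b X Y (s + t) = curv k b X Y s + curv k b X Y t := by
  simp only [curv, map_add]; abel

/-- Curvature is tensorial: the terms that differentiate `a` cancel because the anchor respects
brackets. Flatness may therefore be tested on basis vectors and monomials. -/
theorem curv_smul (X Y : 𝔤) (a : A) (s : Multiset ι →₀ A) :
    curv k b X Y (a • s) = a • curv k b X Y s := by
  simp only [curv, act_smul, map_add, lie_lie, sub_smul, smul_sub]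
  abel

theorem curv_eq_zero_of_basis (s : Multiset ι →₀ A) (h : ∀ i j, curv k b (b i) (b j) s = 0)
    (X Y : 𝔤) : curv k b X Y s = 0 := by
  have h1 : ∀ X, (∀ j, curv k b X (b j) s = 0) → curv k b X Y s = 0 := fun X hX => by
    let f : 𝔤 →ₗ[A] (Multiset ι →₀ A) :=
      { toFun := fun Y => curv k b X Y s
        map_add' := fun Y Z => curv_add_right k b X Y Z s
        map_smul' := fun a Y => curv_smul_right k b a X Y s }
    have hf : f = 0 := b.ext hX
    exact LinearMap.congr_fun hf Y
  refine h1 X fun j => ?_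
  rw [curv_skew, neg_eq_zero]
  let f : 𝔤 →ₗ[A] (Multiset ι →₀ A) :=
    { toFun := fun X => curv k b (b j) X s
      map_add' := fun Y Z => curv_add_right k b _ Y Z s
      map_smul' := fun a Y => curv_smul_right k b a _ Y s }
  have hf : f = 0 := b.ext fun i => h j i
  exact LinearMap.congr_fun hf X

theorem curv_eq_zero_of_deg {p : ℕ} (h : ∀ M, Multiset.card M ≤ p →
      ∀ i j, curv k b (b i) (b j) (Finsupp.single M 1) = 0)
    {s : Multiset ι →₀ A} (hs : s ∈ Deg A ι p) (X Y : 𝔤) : curv k b X Y s = 0 := by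
  refine Deg_induction (P := fun s => curv k b X Y s = 0) (by simp [curv])
    (fun s t hs ht => ?_) (fun M a hM => ?_) hs
  · rw [curv_add, hs, ht, add_zero]
  · rw [← mul_one a, ← smul_eq_mul, ← Finsupp.smul_single, curv_smul,
      curv_eq_zero_of_basis k b _ (h M hM), smul_zero]

/-- The recursion for the action on `j ::ₘ M` was designed to make this vanish. -/
theorem curv_single_of_le {i j : ι} (hji : j < i) {M : Multiset ι} (hM : ∀ x ∈ M, j ≤ x) :
    curv k b (b i) (b j) (Finsupp.single M 1) = 0 := by
  rw [curv, act_single_of_le k b j M hM,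
    act_single_of_lt k b i j M hM hji (act_single_sub_mem k b _ M rfl i), map_sub,
    act_single_of_le k b j (i ::ₘ M), Multiset.cons_swap j i]
  · abel
  · intro x hx
    rcases Multiset.mem_cons.1 hx with rfl | hx
    · exact hji.le
    · exact hM x hx

theorem act_act_of_curv {X Y : 𝔤} {s : Multiset ι →₀ A} (h : curv k b X Y s = 0) :
    act k b X (act k b Y s) = act k b Y (act k b X s) + act k b ⁅X, Y⁆ s := by
  rw [curv, sub_sub, sub_eq_zero] at h; exact h

/-- Diamond-lemma argument. If the least index l of the monomial lies below j, write the monomial as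
b_l z. All commutations with b_l are flat by induction or by the previous case, and what remains is
the Jacobi identity for b_i, b_j, b_l. -/
theorem curv_single_of_lt (p : ℕ) : ∀ M : Multiset ι, Multiset.card M = p → ∀ i j, j < i →
    curv k b (b i) (b j) (Finsupp.single M 1) = 0 := by
  induction p using Nat.strong_induction_on with
  | _ p ih =>
  intro M hM i j hji
  by_cases h : ∀ x ∈ M, j ≤ x
  · exact curv_single_of_le k b hji h
  push Not at h
  obtain ⟨x, hx, hxj⟩ := h
  obtain ⟨l, P, rfl, hP⟩ := exists_minimal_cons M (by rintro rfl; simp at hx)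
  have hlj : l < j := by
    rcases Multiset.mem_cons.1 hx with rfl | hx
    · exact hxj
    · exact (hP x hx).trans_lt hxj
  have flat : ∀ s ∈ Deg A ι (Multiset.card P), ∀ X Y, curv k b X Y s = 0 := by
    intro s hs X Y
    refine curv_eq_zero_of_deg k b (fun M' hM' i j => ?_) hs X Y
    rw [Multiset.card_cons] at hM
    rcases lt_trichotomy j i with hij | rfl | hij
    · exact ih _ (by omega) M' rfl i j hij
    · rw [curv, lie_self, sub_self, act_zero_left, sub_zero]
    · rw [curv_skew, ih _ (by omega) M' rfl j i hij, neg_zero]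
  -- The vector b_j z has the same degree as the given monomial, out of reach of the induction. Its
  -- leading term j::P is covered by `curv_single_of_le`, since l is minimal there, and the rest has
  -- lower degree.
  have flat' : ∀ i j, l < i → l < j →
      curv k b (b i) (b l) (act k b (b j) (Finsupp.single P 1)) = 0 := by
    intro i j hi hj
    rw [← sub_add_cancel (act k b (b j) (Finsupp.single P 1)) (Finsupp.single (j ::ₘ P) 1),
      curv_add, flat _ (act_single_sub_mem k b _ P rfl j), zero_add]
    refine curv_single_of_le k b hi fun y hy => ?_
    rcases Multiset.mem_cons.1 hy with rfl | hy
    · exact hj.le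
    · exact hP y hy
  have hz : Finsupp.single (l ::ₘ P) (1 : A) = act k b (b l) (Finsupp.single P 1) :=
    (act_single_of_le k b l P hP).symm
  have hPd := flat _ (single_mem_Deg (A := A) (le_refl (Multiset.card P)) 1)
  generalize Finsupp.single P (1 : A) = z at *
  -- These identities move b_l to the left in both triple products; the double brackets left over
  -- cancel by `jac`.
  have e1 := act_act_of_curv k b (hPd (b j) (b l))
  have e2 := act_act_of_curv k b (hPd (b i) (b l))
  have e3 := act_act_of_curv k b (flat' i j (hlj.trans hji) hlj)
  have e4 := act_act_of_curv k b (flat' j i hlj (hlj.trans hji))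
  have e5 := congrArg (act k b (b l)) (act_act_of_curv k b (hPd (b i) (b j)))
  have e6 := act_act_of_curv k b (hPd ⁅b i, b j⁆ (b l))
  have e7 := act_act_of_curv k b (hPd ⁅b i, b l⁆ (b j))
  have e8 := act_act_of_curv k b (hPd (b i) ⁅b j, b l⁆)
  have jac : ⁅⁅b i, b j⁆, b l⁆ = ⁅⁅b i, b l⁆, b j⁆ + ⁅b i, ⁅b j, b l⁆⁆ := by
    rw [leibniz_lie (b i) (b j) (b l), ← lie_skew ⁅b i, b l⁆ (b j)]; abel
  rw [jac, act_add_left] at e6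
  rw [map_add] at e5
  rw [curv, hz, e1, e2, map_add, map_add, e3, e4, e6, e5, e7, e8]
  abel

theorem curv_eq_zero (X Y : 𝔤) (s : Multiset ι →₀ A) : curv k b X Y s = 0 := by
  refine curv_eq_zero_of_deg k b (p := s.support.sup Multiset.card) (fun M _ i j => ?_) ?_ X Y
  · rcases lt_trichotomy j i with hij | rfl | hij
    · exact curv_single_of_lt k b _ M rfl i j hij
    · rw [curv, lie_self, sub_self, act_zero_left, sub_zero]
    · rw [curv_skew, curv_single_of_lt k b _ M rfl j i hij, neg_zero]
  · exact (Finsupp.mem_supported A s).2 fun M hM => Finset.le_sup (f := Multiset.card) hM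

theorem act_mem_Deg {p : ℕ} (X : 𝔤) {s : Multiset ι →₀ A} (hs : s ∈ Deg A ι p) :
    act k b X s ∈ Deg A ι (p + 1) := by
  refine opr_mem_Deg b _ (fun M hM i => ?_) X hs
  have h1 := act_single_sub_mem k b _ M rfl i
  rw [act, opr_single_one] at h1
  have h2 := add_mem (Deg_mono (le_trans hM (Nat.le_succ _)) h1) (single_mem_Deg (A := A)
    (M := i ::ₘ M) (p := p + 1) (by simpa using hM) 1)
  rwa [sub_add_cancel] at h2

/-! ### Ordered products in a ring that satisfies the enveloping relations. -/

section monomial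

variable {W : Type*} [Ring W] [Algebra k W] (α : A →ₐ[k] W) (β : 𝔤 →ₗ[k] W)

/-- The ordered product of a multiset of basis vectors. -/
def mon (M : Multiset ι) : W := ((M.sort (· ≤ ·)).map fun i => β (b i)).prod

variable {k} in
theorem mon_cons {i : ι} {M : Multiset ι} (h : ∀ x ∈ M, i ≤ x) :
    mon k b β (i ::ₘ M) = β (b i) * mon k b β M := by
  rw [mon, Multiset.sort_cons _ _ _ h, List.map_cons, List.prod_cons, mon]

/-- The linear map which sends a monomial to the ordered product. -/
def ordered : (Multiset ι →₀ A) →ₗ[k] W :=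
  Finsupp.lsum k fun M => LinearMap.mulRight k (mon k b β M) ∘ₗ α.toLinearMap

theorem ordered_single (M : Multiset ι) (a : A) :
    ordered k b α β (Finsupp.single M a) = α a * mon k b β M := by
  simp [ordered]

theorem ordered_smul (a : A) (s : Multiset ι →₀ A) :
    ordered k b α β (a • s) = α a * ordered k b α β s := by
  induction s using Finsupp.induction_linear with
  | zero => simp
  | add s t hs ht => rw [smul_add, map_add, map_add, hs, ht, mul_add]
  | single M c => rw [Finsupp.smul_single, ordered_single, ordered_single, smul_eq_mul, map_mul,
      mul_assoc]

variable {α β} (h₀ : ∀ X Y, β ⁅X, Y⁆ = β X * β Y - β Y * β X)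
  (h₁ : ∀ a X, α a * β X = β (a • X)) (h₂ : ∀ a X, β X * α a - α a * β X = α ⁅X, a⁆)

include h₁ h₂ in
-- Coefficients of X are pulled out by `h₁`; coefficients of the polynomial are commuted past X by
-- `h₂`, matching the Leibniz rule of the action. So basis vectors and monomials suffice.
theorem ordered_act_of_basis {s : Multiset ι →₀ A}
    (hs : ∀ M ∈ s.support, ∀ i, ordered k b α β (act k b (b i) (Finsupp.single M 1))
      = β (b i) * ordered k b α β (Finsupp.single M 1)) (X : 𝔤) :
    ordered k b α β (act k b X s) = β X * ordered k b α β s := by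
  have hM : ∀ M ∈ s.support, ∀ X, ordered k b α β (act k b X (Finsupp.single M 1))
      = β X * ordered k b α β (Finsupp.single M 1) := by
    intro M hM X
    rw [← b.linearCombination_repr X, Finsupp.linearCombination_apply, Finsupp.sum]
    refine Finset.sum_induction _
      (fun X => ordered k b α β (act k b X (Finsupp.single M 1))
        = β X * ordered k b α β (Finsupp.single M 1)) (fun X Y hX hY => ?_) ?_ fun i _ => ?_
    · rw [act_add_left, map_add, hX, hY, map_add, add_mul]
    · rw [act_zero_left, map_zero, map_zero, zero_mul]
    · rw [act_smul_left, ordered_smul, hs M hM i, ← mul_assoc, h₁]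
  conv_lhs => rw [← Finsupp.sum_single s, Finsupp.sum]
  conv_rhs => rw [← Finsupp.sum_single s, Finsupp.sum]
  rw [map_sum, map_sum, map_sum, Finset.mul_sum]
  refine Finset.sum_congr rfl fun M hM' => ?_
  have h : Finsupp.single M (s M) = s M • Finsupp.single M (1 : A) := by
    rw [Finsupp.smul_single, smul_eq_mul, mul_one]
  rw [h, act_smul, map_add, ordered_smul, ordered_smul, ordered_smul, hM M hM', ← h₂]
  noncomm_ring

include h₀ h₁ h₂ in
-- This repeats the recursion that defines the action: by `h₀` the target ring satisfies the same
-- reordering rule, and both sides are determined by it.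
theorem ordered_act_basis (p : ℕ) : ∀ M : Multiset ι, Multiset.card M = p → ∀ i,
    ordered k b α β (act k b (b i) (Finsupp.single M 1))
      = β (b i) * ordered k b α β (Finsupp.single M 1) := by
  induction p using Nat.strong_induction_on with
  | _ p ih =>
  intro M hM i
  by_cases h : ∀ x ∈ M, i ≤ x
  · rw [act_single_of_le k b i M h, ordered_single, ordered_single, mon_cons b β h, map_one,
      one_mul, one_mul]
  push Not at h
  obtain ⟨x, hx, hxi⟩ := h
  obtain ⟨j, N, rfl, hN⟩ := exists_minimal_cons M (by rintro rfl; simp at hx)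
  have hji : j < i := by
    rcases Multiset.mem_cons.1 hx with rfl | hx
    · exact hxi
    · exact (hN x hx).trans_lt hxi
  rw [Multiset.card_cons] at hM
  have key : ∀ s ∈ Deg A ι (Multiset.card N), ∀ X,
      ordered k b α β (act k b X s) = β X * ordered k b α β s := fun s hs X =>
    ordered_act_of_basis k b h₁ h₂ (fun M' hM' i' => ih _ (by
      have : Multiset.card M' ≤ Multiset.card N := (Finsupp.mem_supported A s).1 hs hM'
      omega) M' rfl i') X
  have hNd : Finsupp.single N (1 : A) ∈ Deg A ι (Multiset.card N) := single_mem_Deg le_rfl _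
  have hj : ∀ x ∈ i ::ₘ N, j ≤ x := fun x hx => by
    rcases Multiset.mem_cons.1 hx with rfl | hx
    · exact hji.le
    · exact hN x hx
  have hmon : ordered k b α β (Finsupp.single (i ::ₘ j ::ₘ N) 1)
      = β (b j) * ordered k b α β (Finsupp.single (i ::ₘ N) 1) := by
    rw [Multiset.cons_swap, ordered_single, ordered_single, mon_cons b β hj, map_one, one_mul,
      one_mul]
  have hw := act_single_sub_mem k b _ N rfl i
  rw [act_single_of_lt k b i j N hN hji hw, map_add, map_add, hmon, key _ hw, map_sub,
    key _ hNd, key _ hNd, h₀, ordered_single k b α β (j ::ₘ N), mon_cons b β hN, map_one, one_mul,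
    ordered_single k b α β N, map_one, one_mul]
  noncomm_ring

include h₀ h₁ h₂ in
theorem ordered_act (X : 𝔤) (s : Multiset ι →₀ A) :
    ordered k b α β (act k b X s) = β X * ordered k b α β s :=
  ordered_act_of_basis k b h₁ h₂ (fun M _ i => ordered_act_basis k b h₀ h₁ h₂ _ M rfl i) X

end monomial

end PBW
end
end LieRinehart

/-! ### From projective to free modules: a swindle and a semidirect product. -/

namespace LieRinehart

noncomputable section

/-- If `G` is an extension of `L`, then `L ⊕ G^(ℕ)` is isomorphic to `G^(ℕ)`. -/
def swindle {A L G : Type*} [CommRing A] [AddCommGroup L] [Module A L] [AddCommGroup G]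
    [Module A G] (f : G →ₗ[A] L) (g : L →ₗ[A] G) (hfg : f ∘ₗ g = LinearMap.id) :
    (ℕ →₀ G) ≃ₗ[A] L × (ℕ →₀ G) :=
  have h : ∀ x, f (g x) = x := fun x => LinearMap.congr_fun hfg x
  have h0 : ∀ w : ℕ →₀ G, Finsupp.mapDomain Nat.succ w 0 = 0 := fun w =>
    Finsupp.mapDomain_of_notMem_range _ _ (by simp)
  LinearEquiv.ofLinearMap
    -- Split G into the image of `g` and the kernel of `f`. Kernel parts stay in place, L-parts move
    -- down one place, and the L-part at place 0 is the one that splits off.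
    (LinearMap.prod (f ∘ₗ Finsupp.lapply 0)
      (Finsupp.mapRange.linearMap (LinearMap.id - g ∘ₗ f) +
        Finsupp.lcomapDomain Nat.succ Nat.succ_injective ∘ₗ Finsupp.mapRange.linearMap (g ∘ₗ f)))
    (LinearMap.coprod (Finsupp.lsingle 0 ∘ₗ g)
      (Finsupp.mapRange.linearMap (LinearMap.id - g ∘ₗ f) +
        Finsupp.lmapDomain _ _ Nat.succ ∘ₗ Finsupp.mapRange.linearMap (g ∘ₗ f)))
    (by
      refine LinearMap.ext fun ⟨x, v⟩ => Prod.ext ?_ (Finsupp.ext fun n => ?_)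
      · simp [h, h0]
      · cases n with
        | zero => simp [h, h0, Finsupp.mapDomain_apply Nat.succ_injective]
        | succ n => simp [h, Finsupp.mapDomain_apply Nat.succ_injective])
    (by
      refine LinearMap.ext fun v => Finsupp.ext fun n => ?_
      cases n with
      | zero =>
        simp [h, h0]
      | succ n => simp [h, Finsupp.mapDomain_apply Nat.succ_injective])

/-- A complement of L in A^n is absorbed by countably many copies of A^n, so L becomes free after
adding a free module of countable rank. -/
theorem free_prod_finsupp {A L : Type*} [CommRing A] [AddCommGroup L] [Module A L]
    [Module.Finite A L] [Module.Projective A L] :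
    ∃ n : ℕ, Module.Free A (L × ((ℕ × Fin n) →₀ A)) := by
  obtain ⟨n, f, g, -, -, hfg⟩ := Module.Finite.exists_comp_eq_id_of_projective A L
  refine ⟨n, Module.Free.of_equiv ((swindle f g hfg).trans (LinearEquiv.prodCongr
    (LinearEquiv.refl A L) ?_))⟩
  exact (Finsupp.mapRange.linearEquiv (Finsupp.linearEquivFunOnFinite A A (Fin n)).symm).trans
    (Finsupp.curryLinearEquiv A).symm

/-- The semidirect product of the Lie-Rinehart algebra `L` with the abelian Lie algebra
`A^(J)`, on which `L` acts componentwise through the anchor. -/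
def Semi (A L J : Type*) [Zero A] : Type _ := L × (J →₀ A)

namespace Semi

variable (k A L J : Type*) [CommRing k] [CommRing A] [Algebra k A] [LieRing L] [LieAlgebra k L]
  [Module A L] [LieRingModule L A] [LieRinehartRing A L] [LieRinehartAlgebra k A L]

instance : AddCommGroup (Semi A L J) := inferInstanceAs (AddCommGroup (L × (J →₀ A)))

instance : Module A (Semi A L J) := inferInstanceAs (Module A (L × (J →₀ A)))

instance : Module k (Semi A L J) := inferInstanceAs (Module k (L × (J →₀ A)))

/-- The inclusion of `L`. -/
def inl (X : L) : Semi A L J := (X, (0 : J →₀ A))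

variable {A L J} in
@[simp] theorem fst_inl (X : L) : (inl A L J X).1 = X := rfl

variable {A L J} in
@[simp] theorem snd_inl (X : L) (j : J) : (inl A L J X).2 j = 0 := rfl

variable {A L J} in
/-- The action of `L` on `A^(J)`. -/
def coefAct (X : L) (v : J →₀ A) : J →₀ A := v.mapRange (fun a => ⁅X, a⁆) (lie_zero X)

variable {A L J} in
@[simp]
theorem coefAct_apply (X : L) (v : J →₀ A) (j : J) : coefAct X v j = ⁅X, v j⁆ := rfl

variable {A L J} in
@[ext]
theorem ext {x y : Semi A L J} (h₁ : x.1 = y.1) (h₂ : ∀ j, x.2 j = y.2 j) : x = y :=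
  Prod.ext h₁ (Finsupp.ext h₂)

instance : Bracket (Semi A L J) (Semi A L J) :=
  ⟨fun x y => (⁅x.1, y.1⁆, coefAct x.1 y.2 - coefAct y.1 x.2)⟩

@[simp] theorem fst_lie (x y : Semi A L J) : ⁅x, y⁆.1 = ⁅x.1, y.1⁆ := rfl
@[simp] theorem snd_lie (x y : Semi A L J) (j : J) :
    ⁅x, y⁆.2 j = ⁅x.1, y.2 j⁆ - ⁅y.1, x.2 j⁆ := rfl
@[simp] theorem fst_add (x y : Semi A L J) : (x + y).1 = x.1 + y.1 := rfl
@[simp] theorem snd_add (x y : Semi A L J) (j : J) : (x + y).2 j = x.2 j + y.2 j := rfl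
@[simp] theorem fst_smul (a : A) (x : Semi A L J) : (a • x).1 = a • x.1 := rfl
@[simp] theorem snd_smul (a : A) (x : Semi A L J) (j : J) : (a • x).2 j = a * x.2 j := rfl
@[simp] theorem fst_ksmul (a : k) (x : Semi A L J) : (a • x).1 = a • x.1 := rfl
@[simp] theorem snd_ksmul (a : k) (x : Semi A L J) (j : J) : (a • x).2 j = a • x.2 j := rfl

instance : LieRing (Semi A L J) where
  add_lie x y z := by
    ext
    · simp
    · simp only [snd_lie, snd_add, fst_add, add_lie, lie_add]; abel
  lie_add x y z := by
    ext
    · simp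
    · simp only [snd_lie, snd_add, fst_add, add_lie, lie_add]; abel
  lie_self x := by
    ext
    · exact lie_self x.1
    · simp only [snd_lie, sub_self]; rfl
  leibniz_lie x y z := by
    ext
    · simp
    · simp only [snd_lie, snd_add, fst_lie, lie_sub, lie_lie]; abel

instance : LieAlgebra k (Semi A L J) where
  lie_smul c x y := by
    ext
    · simp
    · simp only [snd_lie, snd_ksmul, fst_ksmul, smul_lie, smul_sub]
      rw [lie_smul c x.1 (y.2 _)]

/-- The summand A^(J) acts on A by zero, so that the inclusion of L and the projection to L both
preserve the anchor. -/
instance : LieRingModule (Semi A L J) A where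
  bracket x a := ⁅x.1, a⁆
  add_lie x y a := add_lie x.1 y.1 a
  lie_add x a b := lie_add x.1 a b
  leibniz_lie x y a := leibniz_lie x.1 y.1 a

@[simp] theorem lie_coef (x : Semi A L J) (a : A) : ⁅x, a⁆ = ⁅x.1, a⁆ := rfl

instance : LieRinehartRing A (Semi A L J) where
  lie_smul_eq_mul' a b x := LieRinehartRing.lie_smul_eq_mul' a b x.1
  leibniz_mul_right' x a b := LieRinehartRing.leibniz_mul_right' x.1 a b
  leibniz_smul_right' x y a := by
    ext
    · simp
    · simp only [snd_lie, snd_add, snd_smul, fst_smul, lie_coef, LieRinehartRing.leibniz_mul_right,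
        LieRinehartRing.lie_smul_eq_mul, smul_eq_mul]
      ring

instance : LieRinehartAlgebra k A (Semi A L J) where
  smul_assoc c a x := by
    ext
    · simp
    · simp
  smul_lie c x a := smul_lie c x.1 a
  lie_smul c x a := lie_smul c x.1 a

end Semi

/-! ### The filtration of 𝒱L and an adapted dual basis. -/

section Filtration

variable (k A L : Type u) [CommRing k] [CommRing A] [Algebra k A] [LieRing L] [LieAlgebra k L]
  [Module A L] [LieRingModule L A] [LieRinehartRing A L] [LieRinehartAlgebra k A L]

theorem envFil_mono : Monotone (envFil k A L) :=
  monotone_nat_of_le_succ fun _ => le_sup_left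

variable {k A L} in
theorem iA_mem_envFil (a : A) (p : ℕ) : Env.iA k A L a ∈ envFil k A L p :=
  envFil_mono k A L (Nat.zero_le p) ⟨a, rfl⟩

variable {k A L} in
theorem mul_iL_mem_envFil {p : ℕ} {D : Env k A L} (hD : D ∈ envFil k A L p) (X : L) :
    D * Env.iL k A L X ∈ envFil k A L (p + 1) :=
  Submodule.mem_sup_right (Submodule.mul_mem_mul hD ⟨X, rfl⟩)

variable {k A L} in
theorem envFil_succ_induction {p : ℕ} {P : Env k A L → Prop}
    (h : ∀ D ∈ envFil k A L p, P D) (hmul : ∀ D ∈ envFil k A L p, ∀ X, P (D * Env.iL k A L X))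
    (hadd : ∀ D E, P D → P E → P (D + E)) {D : Env k A L} (hD : D ∈ envFil k A L (p + 1)) :
    P D := by
  obtain ⟨E, hE, F, hF, rfl⟩ := Submodule.mem_sup.1 hD
  refine hadd _ _ (h E hE) ?_
  refine Submodule.mul_induction_on hF (fun D hD X hX => ?_) hadd
  obtain ⟨X, rfl⟩ := hX
  exact hmul D hD X

variable {k A L} in
-- The filtration is built by right multiplication with L. Moving `a` to the left past X costs only
-- X(a), which does not raise the order.
theorem mul_iA_mem_envFil {p : ℕ} {D : Env k A L} (hD : D ∈ envFil k A L p) (a : A) :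
    D * Env.iA k A L a ∈ envFil k A L p := by
  induction p generalizing D a with
  | zero =>
    obtain ⟨b, rfl⟩ := hD
    exact ⟨b * a, map_mul (Env.iA k A L) _ _⟩
  | succ p ih =>
    refine envFil_succ_induction (P := fun D => D * Env.iA k A L a ∈ envFil k A L (p + 1))
      (fun D hD => envFil_mono k A L (Nat.le_succ p) (ih hD a)) (fun D hD X => ?_)
      (fun D E hD hE => ?_) hD
    · rw [mul_assoc, ← sub_add_cancel (Env.iL k A L X * Env.iA k A L a)
        (Env.iA k A L a * Env.iL k A L X), Env.iL_mul_iA, mul_add, ← mul_assoc]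
      exact add_mem (envFil_mono k A L (Nat.le_succ p) (ih hD _)) (mul_iL_mem_envFil (ih hD a) X)
    · rw [add_mul]; exact add_mem hD hE

variable {k A L} in
theorem mul_mem_envFil {p q : ℕ} {D E : Env k A L} (hD : D ∈ envFil k A L p)
    (hE : E ∈ envFil k A L q) : D * E ∈ envFil k A L (p + q) := by
  induction q generalizing E with
  | zero =>
    obtain ⟨b, rfl⟩ := hE
    exact mul_iA_mem_envFil hD b
  | succ q ih =>
    refine envFil_succ_induction (P := fun E => D * E ∈ envFil k A L (p + (q + 1)))
      (fun E hE => envFil_mono k A L (by omega) (ih hE)) (fun E hE X => ?_)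
      (fun E F hE hF => ?_) hE
    · rw [← mul_assoc]; exact mul_iL_mem_envFil (ih hE) X
    · rw [mul_add]; exact add_mem hE hF

variable {k A L} in
theorem exists_mem_envFil (D : Env k A L) : ∃ p, D ∈ envFil k A L p := by
  induction D using Env.induction with
  | hA a => exact ⟨0, iA_mem_envFil a 0⟩
  | hL X =>
    refine ⟨1, ?_⟩
    rw [← one_mul (Env.iL k A L X), ← map_one (Env.iA k A L)]
    exact mul_iL_mem_envFil (iA_mem_envFil 1 0) X
  | hadd D E hD hE =>
    obtain ⟨p, hp⟩ := hD
    obtain ⟨q, hq⟩ := hE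
    exact ⟨max p q, add_mem (envFil_mono k A L (le_max_left p q) hp)
      (envFil_mono k A L (le_max_right p q) hq)⟩
  | hmul D E hD hE =>
    obtain ⟨p, hp⟩ := hD
    obtain ⟨q, hq⟩ := hE
    exact ⟨p + q, mul_mem_envFil hp hq⟩

variable {k A L} in
theorem list_prod_iL_mem_envFil {ι : Type*} (x : ι → L) (l : List ι) :
    (l.map fun i => Env.iL k A L (x i)).prod ∈ envFil k A L l.length := by
  induction l with
  | nil => rw [List.map_nil, List.prod_nil, ← map_one (Env.iA k A L)]; exact iA_mem_envFil 1 _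
  | cons i l ih =>
    rw [List.map_cons, List.prod_cons, List.length_cons, add_comm]
    refine mul_mem_envFil ?_ ih
    rw [← one_mul (Env.iL k A L (x i)), ← map_one (Env.iA k A L)]
    exact mul_iL_mem_envFil (iA_mem_envFil 1 0) _

/-- A dual basis of the `A`-module `M` which is adapted to a filtration: there are finitely many
vectors in each degree. -/
structure AdaptedBasis (M : Type u) [AddCommGroup M] [Module k M] [Module (Env k A L) M]
    [IsScalarTower k (Env k A L) M] (fil : ℕ → Submodule k M) where
  /-- The index set. -/
  ι : Type
  /-- The degree. -/
  deg : ι → ℕ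
  finite : ∀ p, {i | deg i ≤ p}.Finite
  /-- The vectors. -/
  vec : ι → M
  /-- The coordinates. -/
  coord : ι → HomA k A L M A
  vec_mem : ∀ i, vec i ∈ fil (deg i)
  coord_eq_zero : ∀ i q m, q < deg i → m ∈ fil q → (coord i).1 m = 0
  sum_eq : ∀ p m, m ∈ fil p →
    ∑ i ∈ (finite p).toFinset, Env.iA k A L ((coord i).1 m) • vec i = m

section Words

variable {k A L} {n : ℕ} (x : Fin n → L)

/-- The linear combination of words in the `x i`. -/
def words : (List (Fin n) →₀ A) →ₗ[k] Env k A L :=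
  Finsupp.lsum k fun l =>
    LinearMap.mulRight k (l.map fun i => Env.iL k A L (x i)).prod ∘ₗ (Env.iA k A L).toLinearMap

theorem words_single (l : List (Fin n)) (a : A) : words (k := k) x (Finsupp.single l a)
    = Env.iA k A L a * (l.map fun i => Env.iL k A L (x i)).prod := by
  simp [words]

theorem words_eq_sum (c : List (Fin n) →₀ A) {s : Finset (List (Fin n))} (hs : c.support ⊆ s) :
    words (k := k) x c
      = ∑ l ∈ s, Env.iA k A L (c l) * (l.map fun i => Env.iL k A L (x i)).prod := by
  conv_lhs => rw [← Finsupp.sum_single c]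
  rw [Finsupp.sum, map_sum]
  simp only [words_single]
  refine Finset.sum_subset hs fun l _ hl => ?_
  rw [Finsupp.notMem_support_iff.1 hl, map_zero, zero_mul]

theorem words_mul_iL (c : List (Fin n) →₀ A) (i : Fin n) :
    words (k := k) x c * Env.iL k A L (x i) = words x (c.mapDomain (· ++ [i])) := by
  induction c using Finsupp.induction_linear with
  | zero => simp
  | add c d hc hd => rw [map_add, add_mul, hc, hd, Finsupp.mapDomain_add, map_add]
  | single l a => simp [words_single, Finsupp.mapDomain_single, mul_assoc]

/-- Words in finitely many generators are used because there are finitely many of each length,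
whereas the free module that contains L may have an infinite basis. The words are redundant, which a
dual basis tolerates. -/
theorem exists_words (hx : Submodule.span A (Set.range x) = ⊤) (p : ℕ) :
    ∀ D ∈ envFil k A L p, ∃ c ∈ Finsupp.supported A A {l : List (Fin n) | l.length ≤ p},
      words x c = D := by
  induction p with
  | zero =>
    rintro _ ⟨a, rfl⟩
    exact ⟨Finsupp.single [] a, Finsupp.single_mem_supported A a (by simp), by
      simp [words_single]⟩
  | succ p ih =>
    intro D hD
    have hadd : ∀ D E : Env k A L,
        (∃ c ∈ Finsupp.supported A A {l : List (Fin n) | l.length ≤ p + 1}, words x c = D) →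
        (∃ c ∈ Finsupp.supported A A {l : List (Fin n) | l.length ≤ p + 1}, words x c = E) →
        ∃ c ∈ Finsupp.supported A A {l : List (Fin n) | l.length ≤ p + 1},
          words x c = D + E := by
      rintro _ _ ⟨c, hc, rfl⟩ ⟨d, hd, rfl⟩
      exact ⟨c + d, add_mem hc hd, map_add _ _ _⟩
    refine envFil_succ_induction (fun D hD => ?_) (fun D hD Y => ?_) hadd hD
    · obtain ⟨c, hc, rfl⟩ := ih D hD
      exact ⟨c, Finsupp.supported_mono (fun l hl => Nat.le_succ_of_le hl) hc, rfl⟩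
    · have hY : Y ∈ Submodule.span A (Set.range x) := hx ▸ Submodule.mem_top
      induction hY using Submodule.span_induction generalizing D with
      | zero => exact ⟨0, zero_mem _, by simp⟩
      | mem Y hY =>
        obtain ⟨i, rfl⟩ := hY
        obtain ⟨c, hc, rfl⟩ := ih D hD
        refine ⟨c.mapDomain (· ++ [i]), ?_, (words_mul_iL x c i).symm⟩
        refine (Finsupp.mem_supported A _).2 fun l hl => ?_
        obtain ⟨l', hl', rfl⟩ := Finset.mem_image.1 (Finsupp.mapDomain_support hl)
        simpa using (Finsupp.mem_supported A _).1 hc hl'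
      | add Y Z _ _ hY hZ =>
        rw [map_add, mul_add]; exact hadd _ _ (hY D hD) (hZ D hD)
      | smul a Y _ hY =>
        -- The coefficient of the last vector is absorbed on the right of `D`, without leaving
        -- filtration degree `p`.
        rw [← Env.iA_mul_iL, ← mul_assoc]
        exact hY _ (mul_iA_mem_envFil hD a)

end Words

section DualBasis

variable {k A L} {J ι : Type*} [LinearOrder ι] (b : Module.Basis ι A (Semi A L J))

/-- The representation of `𝒱L` on polynomials. -/
def polyRep : Env k A L →ₐ[k] Module.End k (Multiset ι →₀ A) :=
  Env.lift (Algebra.lsmul k k (Multiset ι →₀ A))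
    { toFun := fun X => PBW.act k b (Semi.inl A L J X)
      map_add' := fun X Y => LinearMap.ext fun s => by
        rw [LinearMap.add_apply, ← PBW.act_add_left]
        congr 2
        exact Semi.ext rfl fun j => by simp
      map_smul' := fun c X => LinearMap.ext fun s => by
        rw [RingHom.id_apply, LinearMap.smul_apply, ← algebraMap_smul A c (PBW.act k b _ s),
          ← PBW.act_smul_left]
        congr 2
        exact Semi.ext (algebraMap_smul A c X).symm fun j => by simp }
    (fun X Y => LinearMap.ext fun s => by
      have h := PBW.act_act_of_curv k b
        (PBW.curv_eq_zero k b (Semi.inl A L J X) (Semi.inl A L J Y) s)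
      have h' : ⁅(Semi.inl A L J X), (Semi.inl A L J Y)⁆ = Semi.inl A L J ⁅X, Y⁆ :=
        Semi.ext rfl fun j => by simp
      rw [h'] at h
      exact (sub_eq_of_eq_add' h).symm)
    (fun a X => LinearMap.ext fun s => by
      refine (PBW.act_smul_left k b a _ s).symm.trans ?_
      change PBW.act k b _ s = PBW.act k b _ s
      congr 2
      exact Semi.ext rfl fun j => by simp)
    (fun a X => LinearMap.ext fun s => by
      refine (congrArg (· - _) (PBW.act_smul k b (Semi.inl A L J X) a s)).trans ?_
      exact add_sub_cancel_right _ _)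

theorem polyRep_iA (a : A) (s : Multiset ι →₀ A) : polyRep b (Env.iA k A L a) s = a • s := by
  rw [polyRep, Env.lift_iA]; rfl

theorem polyRep_iL (X : L) (s : Multiset ι →₀ A) :
    polyRep b (Env.iL k A L X) s = PBW.act k b (Semi.inl A L J X) s := by
  rw [polyRep, Env.lift_iL]; rfl

/-- The ordered products in `𝒱L`. -/
def polyMap : (Multiset ι →₀ A) →ₗ[k] Env k A L :=
  PBW.ordered k b (Env.iA k A L)
    (Env.iL k A L ∘ₗ { toFun := fun X : Semi A L J => X.1
                       map_add' := fun _ _ => rfl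
                       map_smul' := fun _ _ => rfl })

/-- L acts on polynomials through its inclusion in the semidirect product, while ordered products
are formed through the projection to L; the composite L → L is the identity, so `PBW.ordered_act`
applies. Evaluated at the polynomial 1 it gives back D: this is the retraction of polynomials onto
𝒱L. -/
theorem polyMap_polyRep (D : Env k A L) (s : Multiset ι →₀ A) :
    polyMap b (polyRep b D s) = D * polyMap b s := by
  induction D using Env.induction generalizing s with
  | hA a => rw [polyRep_iA]; exact PBW.ordered_smul k b _ _ a s
  | hL X =>
    rw [polyRep_iL]
    exact PBW.ordered_act k b (fun X Y => Env.iL_lie k A L X.1 Y.1)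
      (fun a X => Env.iA_mul_iL k A L a X.1) (fun a X => Env.iL_mul_iA k A L a X.1) _ s
  | hadd D E hD hE => rw [map_add, LinearMap.add_apply, map_add, hD, hE, add_mul]
  | hmul D E hD hE => rw [map_mul, Module.End.mul_apply, hD, hE, mul_assoc]

theorem polyMap_one : polyMap (k := k) b (Finsupp.single 0 1) = 1 := by
  rw [polyMap, PBW.ordered_single, map_one, one_mul]
  simp [PBW.mon]

theorem polyRep_mem_Deg {p q : ℕ} {D : Env k A L} (hD : D ∈ envFil k A L p)
    {s : Multiset ι →₀ A} (hs : s ∈ PBW.Deg A ι q) :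
    polyRep b D s ∈ PBW.Deg A ι (p + q) := by
  induction p generalizing D s q with
  | zero =>
    obtain ⟨a, rfl⟩ := hD
    rw [zero_add]
    change polyRep b (Env.iA k A L a) s ∈ _
    rw [polyRep_iA]
    exact Submodule.smul_mem _ _ hs
  | succ p ih =>
    refine envFil_succ_induction (P := fun D => polyRep b D s ∈ PBW.Deg A ι (p + 1 + q))
      (fun D hD => PBW.Deg_mono (by omega) (ih hD hs)) (fun D hD X => ?_)
      (fun D E hD hE => ?_) hD
    · rw [map_mul, Module.End.mul_apply, polyRep_iL, add_assoc, add_comm 1 q]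
      exact ih hD (PBW.act_mem_Deg k b _ hs)
    · rw [map_add]; exact add_mem hD hE

theorem polyMap_mem (M : Multiset ι) :
    polyMap b (Finsupp.single M 1) ∈ envFil k A L (Multiset.card M) := by
  rw [polyMap, PBW.ordered_single, map_one, one_mul, PBW.mon, ← Multiset.length_sort (r := (· ≤ ·))]
  exact list_prod_iL_mem_envFil (fun i => (b i).1) _

end DualBasis

/-- The chain is D ↦ D·1 in polynomials, then a choice of words for each monomial, then evaluation
of words in 𝒱L. The composite is the identity and no map raises the degree, so the coefficients of
the words are the coordinates. -/
theorem nonempty_adaptedBasis_env [Module.Finite A L] [Module.Projective A L] :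
    Nonempty (AdaptedBasis k A L (Env k A L) (envFil k A L)) := by
  obtain ⟨r, hr⟩ := free_prod_finsupp (A := A) (L := L)
  have hr' : Module.Free A (Semi A L (ℕ × Fin r)) := hr
  let ι := Module.Free.ChooseBasisIndex A (Semi A L (ℕ × Fin r))
  let b : Module.Basis ι A (Semi A L (ℕ × Fin r)) := Module.Free.chooseBasis A _
  classical
  let : LinearOrder ι := linearOrderOfSTO WellOrderingRel
  obtain ⟨n, x, hx⟩ := Module.Finite.exists_fin (R := A) (M := L)
  -- Every ordered monomial lies in the filtration step given by its degree, hence is a combination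
  -- of words no longer than that degree.
  choose c hc hc' using fun M : Multiset ι => exists_words x hx _ _ (polyMap_mem (k := k) b M)
  let F : (Multiset ι →₀ A) →ₗ[A] (List (Fin n) →₀ A) := Finsupp.linearCombination A c
  have hF : ∀ s, words (k := k) x (F s) = polyMap b s := by
    intro s
    induction s using Finsupp.induction_linear with
    | zero => simp
    | add s t hs ht => rw [map_add, map_add, map_add, hs, ht]
    | single M a =>
      have h1 : ∀ d : List (Fin n) →₀ A, words x (a • d) = Env.iA k A L a * words x d := by
        intro d
        induction d using Finsupp.induction_linear with
        | zero => simp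
        | add s t hs ht => rw [smul_add, map_add, map_add, hs, ht, mul_add]
        | single l e => rw [Finsupp.smul_single, words_single, words_single, smul_eq_mul, map_mul,
            mul_assoc]
      have h2 : Finsupp.single M a = a • Finsupp.single M (1 : A) := by simp
      rw [h2, polyMap, PBW.ordered_smul, ← polyMap, ← hc', ← h1]
      simp [F]
  have hF' : ∀ p, ∀ s ∈ PBW.Deg A ι p,
      F s ∈ Finsupp.supported A A {l : List (Fin n) | l.length ≤ p} := by
    intro p s hs
    refine PBW.Deg_induction
      (P := fun s => F s ∈ Finsupp.supported A A {l : List (Fin n) | l.length ≤ p})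
      (by simp) (fun s t hs ht => ?_) (fun M a hM => ?_) hs
    · rw [map_add]; exact add_mem hs ht
    · rw [Finsupp.linearCombination_single]
      exact Submodule.smul_mem _ _
        (Finsupp.supported_mono (fun (l : List (Fin n)) hl => le_trans hl hM) (hc M))
  have hdeg : ∀ p, ∀ D ∈ envFil k A L p, F (polyRep b D (Finsupp.single 0 1))
      ∈ Finsupp.supported A A {l : List (Fin n) | l.length ≤ p} := fun p D hD =>
    hF' p _ (polyRep_mem_Deg b (q := 0) hD (PBW.single_mem_Deg (by simp) 1))
  refine ⟨{
    ι := List (Fin n)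
    deg := List.length
    finite := fun p => List.finite_length_le (Fin n) p
    vec := fun l => (l.map fun i => Env.iL k A L (x i)).prod
    coord := fun l => ⟨
      -- A word longer than the order of `D` cannot occur in this expression, whence
      -- `coord_eq_zero`.
      { toFun := fun D => F (polyRep b D (Finsupp.single 0 1)) l
        map_add' := fun D E => by rw [map_add, LinearMap.add_apply, map_add]; rfl
        map_smul' := fun c D => by
          rw [map_smul, LinearMap.smul_apply, LinearMap.map_smul_of_tower]; rfl }, fun a D => by
        simp only [LinearMap.coe_mk, AddHom.coe_mk, smul_eq_mul, map_mul, Module.End.mul_apply]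
        rw [polyRep_iA, map_smul, iA_smul]; rfl⟩
    vec_mem := fun l => list_prod_iL_mem_envFil x l
    coord_eq_zero := fun l q D hq hD => by
      by_contra h
      have := (Finsupp.mem_supported A _).1 (hdeg q D hD) (Finsupp.mem_support_iff.2 h)
      exact absurd this (not_le.2 hq)
    sum_eq := fun p D hD => by
      have h := words_eq_sum (k := k) x (F (polyRep b D (Finsupp.single 0 1)))
        (s := (List.finite_length_le (Fin n) p).toFinset)
        (fun l hl => (Set.Finite.mem_toFinset _).2 ((Finsupp.mem_supported A _).1 (hdeg p D hD) hl))
      rw [hF, polyMap_polyRep, polyMap_one, mul_one] at h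
      exact h.symm }⟩

end Filtration

end
end LieRinehart

namespace LieRinehart

noncomputable section

/-! ### Dual bases of T n and the completed tensor product. -/

section Completion

variable {k A L : Type u} [CommRing k] [CommRing A] [Algebra k A] [LieRing L] [LieAlgebra k L]
  [Module A L] [LieRingModule L A] [LieRinehartRing A L] [LieRinehartAlgebra k A L]

section AdaptedBasis

variable {M : Type u} [AddCommGroup M] [Module k M] [Module (Env k A L) M]
    [IsScalarTower k (Env k A L) M] {fil : ℕ → Submodule k M} (B : AdaptedBasis k A L M fil)

theorem AdaptedBasis.sum_eq' {p : ℕ} {m : M} (hm : m ∈ fil p) {s : Finset B.ι}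
    (hs : ∀ i, B.deg i ≤ p → i ∈ s) :
    ∑ i ∈ s, Env.iA k A L ((B.coord i).1 m) • B.vec i = m := by
  refine Eq.trans ?_ (B.sum_eq p m hm)
  refine (Finset.sum_subset (fun i hi => hs i ((B.finite p).mem_toFinset.1 hi))
    fun i _ hi => ?_).symm
  rw [B.coord_eq_zero i p m (not_le.1 fun h => hi ((B.finite p).mem_toFinset.2 h)) hm, map_zero,
    zero_smul]

end AdaptedBasis

theorem Ind.sum_tmul {M : Type u} [AddCommGroup M] [Module k M] [Module (Env k A L) M]
    [IsScalarTower k (Env k A L) M] {ι : Type*} (s : Finset ι) (D : ι → Env k A L) (m : M) :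
    Ind.tmul k A L (∑ i ∈ s, D i) m = ∑ i ∈ s, Ind.tmul k A L (D i) m :=
  map_sum (AddMonoidHom.mk' (fun D => Ind.tmul k A L D m) fun D E => Ind.add_tmul D E m) D s

theorem Ind.tmul_sum {M : Type u} [AddCommGroup M] [Module k M] [Module (Env k A L) M]
    [IsScalarTower k (Env k A L) M] {ι : Type*} (s : Finset ι) (D : Env k A L) (m : ι → M) :
    Ind.tmul k A L D (∑ i ∈ s, m i) = ∑ i ∈ s, Ind.tmul k A L D (m i) :=
  map_sum (AddMonoidHom.mk' (fun m : M => Ind.tmul k A L D m) fun m m' => Ind.tmul_add D m m') m s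

theorem C.map_iA {n : ℕ} (φ : C k A L n) (a : A) (w : T k A L n) :
    φ.1 (Env.iA k A L a • w) = a * φ.1 w :=
  (φ.2 a w).trans (iA_smul k A L _ _)

theorem C.sum_apply {n : ℕ} {ι : Type*} (s : Finset ι) (φ : ι → C k A L n) (w : T k A L n) :
    (∑ i ∈ s, φ i).1 w = ∑ i ∈ s, (φ i).1 w :=
  map_sum (AddMonoidHom.mk' (fun φ : C k A L n => φ.1 w) fun _ _ => rfl) φ s

/-- An adapted dual basis of `T 0 = A`. -/
def adaptedBasisZero : AdaptedBasis k A L (T k A L 0) (filT k A L 0) where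
  ι := Unit
  deg _ := 0
  finite _ := Set.toFinite _
  vec _ := (1 : A)
  coord _ := HomA.ofLinear (M := T k A L 0) (N := A) (LinearMap.id : A →ₗ[Env k A L] A)
  vec_mem _ := Submodule.mem_top
  coord_eq_zero _ q _ h := absurd h (Nat.not_lt_zero q)
  sum_eq p m _ := by
    have h : (Set.toFinite {_i : Unit | 0 ≤ p}).toFinset = {()} := by
      ext i; simp
    rw [h, Finset.sum_singleton]
    exact (iA_smul k A L m 1).trans (mul_one (id m : A))

section Ind

variable {M : Type u} [AddCommGroup M] [Module k M] [Module (Env k A L) M]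
    [IsScalarTower k (Env k A L) M]

/-- The filtration of `𝒱L ⊗_A M` defined by a filtration of `M`. -/
def indFil (fil : ℕ → Submodule k M) (p : ℕ) : Submodule k (Ind k A L M) :=
  Submodule.span k {x | ∃ (i j : ℕ) (D : Env k A L) (w : M),
      i + j ≤ p ∧ D ∈ envFil k A L i ∧ w ∈ fil j ∧ x = Ind.tmul k A L D w}

variable {fil : ℕ → Submodule k M} (B : AdaptedBasis k A L (Env k A L) (envFil k A L))
  (B' : AdaptedBasis k A L M fil)

/-- On D ⊗ w either w has too small a degree for the inner coordinate, or D has too small an order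
for the outer one; right multiplication by A does not change the order. -/
theorem pair₂_coord_eq_zero (i : B.ι) (j : B'.ι) {q : ℕ} (hq : q < B.deg i + B'.deg j)
    {m : Ind k A L M} (hm : m ∈ indFil fil q) : (pair₂ (B.coord i) (B'.coord j)).1 m = 0 := by
  refine Submodule.span_induction (p := fun m _ =>
    (pair₂ (B.coord i) (B'.coord j)).1 m = 0) ?_ (map_zero _)
    (fun x y _ _ hx hy => by rw [map_add, hx, hy, add_zero])
    (fun c x _ hx => by rw [map_smul, hx, smul_zero]) hm
  rintro _ ⟨a, b, D, w, hab, hD, hw, rfl⟩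
  rw [pair₂_tmul]
  by_cases h : b < B'.deg j
  · rw [B'.coord_eq_zero _ _ _ h hw, map_zero, mul_zero, map_zero]
  · exact B.coord_eq_zero _ a _ (by omega) (mul_iA_mem_envFil hD _)

/-- Expand w, carry its coefficients across the tensor sign to the right of D, and expand the
resulting operators in the dual basis of 𝒱L. The indices in `s` outside the product of the two
finite ranges contribute zero. -/
theorem sum_pair₂_coord_tmul {p a b : ℕ} (hab : a + b ≤ p) {s : Finset (B.ι × B'.ι)}
    (hs : ∀ i, B.deg i.1 + B'.deg i.2 ≤ p → i ∈ s) {D : Env k A L} (hD : D ∈ envFil k A L a)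
    {w : M} (hw : w ∈ fil b) :
    ∑ i ∈ s, Env.iA k A L ((pair₂ (B.coord i.1) (B'.coord i.2)).1 (Ind.tmul k A L D w)) •
        Ind.tmul k A L (B.vec i.1) (B'.vec i.2) = Ind.tmul k A L D w := by
  refine Eq.trans ?_ (congrArg (Ind.tmul k A L D) (B'.sum_eq b w hw))
  simp only [Ind.tmul_sum, ← Ind.mul_iA_tmul, pair₂_tmul]
  have h1 : ∀ j, Ind.tmul k A L (D * Env.iA k A L ((B'.coord j).1 w)) (B'.vec j)
      = ∑ i ∈ (B.finite a).toFinset,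
        Env.iA k A L ((B.coord i).1 (D * Env.iA k A L ((B'.coord j).1 w))) •
          Ind.tmul k A L (B.vec i) (B'.vec j) := fun j => by
    conv_lhs => rw [← B.sum_eq a _ (mul_iA_mem_envFil hD ((B'.coord j).1 w))]
    rw [Ind.sum_tmul]
    simp only [Ind.smul_tmul, smul_eq_mul]
  rw [Finset.sum_congr rfl fun j _ => h1 j, ← Finset.sum_product_right']
  refine (Finset.sum_subset (fun i hi => ?_) fun i _ hi => ?_).symm
  · rw [Finset.mem_product, Set.Finite.mem_toFinset, Set.Finite.mem_toFinset] at hi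
    exact hs i ((Nat.add_le_add hi.1 hi.2).trans hab)
  · rw [Finset.mem_product, Set.Finite.mem_toFinset, Set.Finite.mem_toFinset, not_and_or] at hi
    rcases hi with hi | hi
    · rw [B.coord_eq_zero _ a _ (not_le.1 hi) (mul_iA_mem_envFil hD _), map_zero, zero_smul]
    · rw [B'.coord_eq_zero _ b _ (not_le.1 hi) hw, map_zero, mul_zero, map_zero, map_zero,
        zero_smul]

theorem sum_pair₂_coord {p : ℕ} {s : Finset (B.ι × B'.ι)}
    (hs : ∀ i, B.deg i.1 + B'.deg i.2 ≤ p → i ∈ s) {m : Ind k A L M} (hm : m ∈ indFil fil p) :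
    ∑ i ∈ s, Env.iA k A L ((pair₂ (B.coord i.1) (B'.coord i.2)).1 m) •
        Ind.tmul k A L (B.vec i.1) (B'.vec i.2) = m := by
  refine Submodule.span_induction (p := fun m _ =>
    ∑ i ∈ s, Env.iA k A L ((pair₂ (B.coord i.1) (B'.coord i.2)).1 m) •
      Ind.tmul k A L (B.vec i.1) (B'.vec i.2) = m) ?_ ?_ (fun x y _ _ hx hy => ?_)
    (fun c x _ hx => ?_) hm
  · rintro _ ⟨a, b, D, w, hab, hD, hw, rfl⟩
    exact sum_pair₂_coord_tmul B B' hab hs hD hw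
  · simp only [map_zero, zero_smul, Finset.sum_const_zero]
  · simp only [map_add, add_smul, Finset.sum_add_distrib, hx, hy]
  · simp only [map_smul, smul_assoc, ← Finset.smul_sum, hx]

/-- The adapted dual basis of `𝒱L ⊗_A M` defined by such bases of `𝒱L` and `M`. -/
def adaptedBasisInd : AdaptedBasis k A L (Ind k A L M) (indFil fil) where
  ι := B.ι × B'.ι
  deg i := B.deg i.1 + B'.deg i.2
  finite p := ((B.finite p).prod (B'.finite p)).subset fun _ (hi : _ ≤ p) =>
    ⟨(Nat.le_add_right _ _).trans hi, (Nat.le_add_left _ _).trans hi⟩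
  vec i := Ind.tmul k A L (B.vec i.1) (B'.vec i.2)
  coord i := pair₂ (B.coord i.1) (B'.coord i.2)
  vec_mem i := Submodule.subset_span ⟨_, _, _, _, le_rfl, B.vec_mem i.1, B'.vec_mem i.2, rfl⟩
  coord_eq_zero i _ _ hq hm := pair₂_coord_eq_zero B B' i.1 i.2 hq hm
  sum_eq _ _ hm := sum_pair₂_coord B B' (fun _ hi => (Set.Finite.mem_toFinset _).2 hi) hm

end Ind

/-- An adapted dual basis of `T n`. -/
def adaptedBasisT (B : AdaptedBasis k A L (Env k A L) (envFil k A L)) :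
    ∀ n, AdaptedBasis k A L (T k A L n) (filT k A L n)
  | 0 => adaptedBasisZero
  | n + 1 => adaptedBasisInd B (adaptedBasisT B n)

theorem filT_mono (n : ℕ) : Monotone (filT k A L n) := by
  intro p q hpq
  cases n with
  | zero => exact le_rfl
  | succ n =>
    refine Submodule.span_mono ?_
    rintro x ⟨i, j, D, w, hij, h⟩
    exact ⟨i, j, D, w, hij.trans hpq, h⟩

theorem tmul_mem_filT {n i j p : ℕ} {D : Env k A L} {w : T k A L n} (hD : D ∈ envFil k A L i)
    (hw : w ∈ filT k A L n j) (hp : i + j ≤ p) :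
    (Ind.tmul k A L D w : T k A L (n + 1)) ∈ filT k A L (n + 1) p :=
  Submodule.subset_span ⟨i, j, D, w, hp, hD, hw, rfl⟩

theorem exists_mem_filT : ∀ (n : ℕ) (w : T k A L n), ∃ p, w ∈ filT k A L n p
  | 0, w => ⟨0, Submodule.mem_top⟩
  | n + 1, w => by
    induction w using Ind.induction with
    | h D m =>
      obtain ⟨i, hi⟩ := exists_mem_envFil D
      obtain ⟨j, hj⟩ := exists_mem_filT n m
      exact ⟨i + j, tmul_mem_filT hi hj le_rfl⟩
    | hadd x y hx hy =>
      obtain ⟨p, hp⟩ := hx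
      obtain ⟨q, hq⟩ := hy
      exact ⟨max p q, add_mem (filT_mono _ (le_max_left p q) hp)
        (filT_mono _ (le_max_right p q) hq)⟩

theorem cochFil_antitone (n : ℕ) {p q : ℕ} (h : p ≤ q) :
    cochFil k A L n q ≤ cochFil k A L n p :=
  fun _ hφ r hr => hφ r (hr.trans_le h)

theorem cochFil_succ_of_tmul {n p : ℕ} {φ : C k A L (n + 1)}
    (h : ∀ i j D w, i + j < p → D ∈ envFil k A L i → w ∈ filT k A L n j →
      φ.1 (Ind.tmul k A L D w) = 0) : φ ∈ cochFil k A L (n + 1) p := by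
  intro q hq m hm
  refine Submodule.span_induction (p := fun m _ => φ.1 m = 0) ?_ (map_zero _)
      (fun x y _ _ hx hy => by rw [map_add, hx, hy, add_zero])
      (fun c x _ hx => by rw [map_smul, hx, smul_zero]) hm
  rintro _ ⟨i, j, D, w, hij, hD, hw, rfl⟩
  exact h i j D w (hij.trans_lt hq) hD hw

/-- Cochains are determined by compatible approximations. -/
theorem exists_limit (n : ℕ) (φ : ℕ → C k A L n)
    (h : ∀ p q, p ≤ q → φ p - φ q ∈ cochFil k A L n p) :
    ∃ ψ : C k A L n, ∀ p, ψ - φ p ∈ cochFil k A L n p := by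
  have h' : ∀ d p q w, d < p → d < q → w ∈ filT k A L n d → (φ p).1 w = (φ q).1 w := by
    intro d p q w hp hq hw
    rcases le_total p q with hpq | hpq
    · exact sub_eq_zero.1 (h p q hpq d hp w hw)
    · exact (sub_eq_zero.1 (h q p hpq d hq w hw)).symm
  choose d hd using exists_mem_filT (k := k) (A := A) (L := L) n
  have hval : ∀ p q w, q < p → w ∈ filT k A L n q → (φ (d w + 1)).1 w = (φ p).1 w := by
    intro p q w hq hw
    rcases le_total q (d w) with hqd | hqd
    · exact h' q _ _ w (by omega) hq hw
    · exact h' (d w) _ _ w (by omega) (by omega) (hd w)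
  -- Here `d w` is a filtration degree of `w`. Stage `d w + 1` is needed since `cochFil p` controls
  -- degrees strictly below `p`.
  refine ⟨⟨{ toFun := fun w => (φ (d w + 1)).1 w
             map_add' := fun v w => ?_
             map_smul' := fun c w => ?_ }, fun a w => ?_⟩, fun p q hq w hw => ?_⟩
  · have hv := filT_mono n (le_max_left (d v) (d w)) (hd v)
    have hw := filT_mono n (le_max_right (d v) (d w)) (hd w)
    rw [hval _ _ _ (Nat.lt_succ_self _) hv, hval _ _ _ (Nat.lt_succ_self _) hw,
      hval _ _ _ (Nat.lt_succ_self _) (add_mem hv hw), map_add]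
  · rw [hval _ _ _ (Nat.lt_succ_self _) (Submodule.smul_mem _ c (hd w)), map_smul]; rfl
  · have h1 := filT_mono n (le_max_left (d w) (d (Env.iA k A L a • w))) (hd w)
    have h2 := filT_mono n (le_max_right (d w) (d (Env.iA k A L a • w))) (hd _)
    simp only [LinearMap.coe_mk, AddHom.coe_mk]
    rw [hval _ _ _ (Nat.lt_succ_self _) h1, hval _ _ _ (Nat.lt_succ_self _) h2, C.map_iA, iA_smul]
  · exact sub_eq_zero.2 (hval p q w hq hw)

/-- The jet `D ↦ φ(D ⊗ w)`. -/
def slice {n : ℕ} (w : T k A L n) : C k A L (n + 1) →ₗ[k] Jet k A L where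
  toFun φ := (⟨{ toFun := fun D => φ.1 (Ind.tmul k A L D w)
                 map_add' := fun D E => by rw [Ind.add_tmul]; exact map_add φ.1 _ _
                 map_smul' := fun c D => by rw [Ind.ksmul_tmul]; exact map_smul φ.1 c _ },
    fun a D => by
      change φ.1 (Ind.tmul k A L (Env.iA k A L a * D) w) = _
      rw [← Ind.smul_tmul]; exact φ.2 a _⟩ : HomA k A L (Env k A L) A)
  map_add' _ _ := rfl
  map_smul' _ _ := rfl

theorem slice_pair {n : ℕ} (w : T k A L n) (φ : Jet k A L) (ψ : C k A L n) :
    slice w (pair k A L n (φ ⊗ₜ ψ)) = targetMul (ψ.1 w) φ := rfl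

section Expand

variable {n : ℕ} (B' : AdaptedBasis k A L (T k A L n) (filT k A L n))

/-- The approximation of a cochain by a tensor. -/
def expand (p : ℕ) : C k A L (n + 1) →ₗ[k] Jet k A L ⊗[k] C k A L n :=
  ∑ i ∈ (B'.finite p).toFinset, (TensorProduct.mk k (Jet k A L) (C k A L n)).flip (B'.coord i) ∘ₗ
    slice (B'.vec i)

theorem expand_apply (p : ℕ) (φ : C k A L (n + 1)) : expand B' p φ
    = ∑ i ∈ (B'.finite p).toFinset,
      slice (B'.vec i) φ ⊗ₜ[k] (show C k A L n from B'.coord i) := by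
  rw [expand, LinearMap.sum_apply]; rfl

theorem coord_mem_cochFil (i : B'.ι) : (show C k A L n from B'.coord i) ∈ cochFil k A L n (B'.deg i) :=
  fun q hq m hm => B'.coord_eq_zero i q m hq hm

/-- The generators of `tensorFil` have i + j equal to p. Surplus order is given up in the jet if j ≤
p, and otherwise in the cochain. -/
theorem tmul_mem_tensorFil {i j p : ℕ} (hp : p ≤ i + j) {φ : Jet k A L} (hφ : φ ∈ jetFil k A L i)
    {ψ : C k A L n} (hψ : ψ ∈ cochFil k A L n j) : φ ⊗ₜ ψ ∈ tensorFil k A L n p := by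
  refine Submodule.subset_span (Or.inr ?_)
  by_cases h : j ≤ p
  · exact ⟨p - j, j, φ, ψ, by omega, fun q hq => hφ q (by omega), hψ, rfl⟩
  · exact ⟨0, p, φ, ψ, by omega, fun q hq => absurd hq (Nat.not_lt_zero q),
      cochFil_antitone n (by omega) hψ, rfl⟩

theorem mem_jetFil_zero (φ : Jet k A L) : φ ∈ jetFil k A L 0 :=
  fun q hq => absurd hq (Nat.not_lt_zero q)

/-- With `mem_tensorFil_of_pair` this shows that the tensor filtration is the preimage of the
filtration of cochains under the canonical map. -/
theorem pair_mem_cochFil {p : ℕ} {y : Jet k A L ⊗[k] C k A L n} (hy : y ∈ tensorFil k A L n p) :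
    pair k A L n y ∈ cochFil k A L (n + 1) p := by
  refine Submodule.span_induction (p := fun y _ => pair k A L n y ∈ cochFil k A L (n + 1) p) ?_ ?_
    (fun x y _ _ hx hy => ?_) (fun c x _ hx => ?_) hy
  · rintro _ (⟨a, φ, ψ, rfl⟩ | ⟨i, j, φ, ψ, rfl, hφ, hψ, rfl⟩)
    · refine cochFil_succ_of_tmul fun i j D w _ _ _ => ?_
      rw [map_sub]
      change φ.1 (D * Env.iA k A L (ψ.1 w) * Env.iA k A L a)
        - φ.1 (D * Env.iA k A L (Env.iA k A L a • ψ.1 w)) = 0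
      rw [iA_smul, mul_comm a, map_mul (Env.iA k A L), ← mul_assoc, sub_self]
    · refine cochFil_succ_of_tmul fun a b D w hab hD hw => ?_
      change φ.1 (D * Env.iA k A L (ψ.1 w)) = 0
      by_cases h : b < j
      · have : ψ.1 w = 0 := hψ b h w hw
        rw [this, map_zero, mul_zero, map_zero]
      · exact hφ a (by omega) _ (mul_iA_mem_envFil hD _)
  · rw [map_zero]; exact zero_mem _
  · rw [map_add]; exact add_mem hx hy
  · rw [map_smul]; exact Submodule.smul_mem _ c hx

/-- On D ⊗ w of total degree below p, the truncated dual basis already reproduces w, so the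
approximation is exact there. -/
theorem sub_pair_expand (p : ℕ) (φ : C k A L (n + 1)) :
    φ - pair k A L n (expand B' p φ) ∈ cochFil k A L (n + 1) p := by
  refine cochFil_succ_of_tmul fun i j D w hij hD hw => ?_
  have h : (pair k A L n (expand B' p φ)).1 (Ind.tmul k A L D w)
      = ∑ i ∈ (B'.finite p).toFinset, φ.1 (Ind.tmul k A L D
          (Env.iA k A L ((B'.coord i).1 w) • B'.vec i)) := by
    rw [expand_apply, map_sum]
    refine (C.sum_apply _ _ _).trans ?_
    refine Finset.sum_congr rfl fun i _ => ?_
    rw [← Ind.mul_iA_tmul]; rfl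
  change φ.1 _ - (pair k A L n (expand B' p φ)).1 (Ind.tmul k A L D w) = 0
  rw [h]
  have h2 := (Ind.tmul_sum (B'.finite p).toFinset D
    fun i => Env.iA k A L ((B'.coord i).1 w) • B'.vec i).symm
  rw [B'.sum_eq' hw fun i hi => (B'.finite p).mem_toFinset.2 (show B'.deg i ≤ p by omega)] at h2
  rw [sub_eq_zero]
  exact (congrArg φ.1 h2).symm.trans (map_sum φ.1 _ _)

/-- On φ ⊗ ψ, the cochain ψ agrees with the sum of the ψ(e_i) e^i up to order p, for e_i the dual
basis vectors and e^i their coordinates. The scalars ψ(e_i) are exchanged between the source of ψ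
and the target of φ modulo the balancing relations. -/
theorem sub_expand_pair (p : ℕ) (y : Jet k A L ⊗[k] C k A L n) :
    y - expand B' p (pair k A L n y) ∈ tensorFil k A L n p := by
  induction y with
  | zero => rw [map_zero, map_zero, sub_zero]; exact zero_mem _
  | add x y hx hy =>
    rw [map_add, map_add, add_sub_add_comm]; exact add_mem hx hy
  | tmul φ ψ =>
    let χ : C k A L n := ∑ i ∈ (B'.finite p).toFinset, sourceMul (ψ.1 (B'.vec i)) (B'.coord i)
    have h1 : ψ - χ ∈ cochFil k A L n p := by
      intro q hq w hw
      have h2 : χ.1 w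
          = ∑ i ∈ (B'.finite p).toFinset, ψ.1 (B'.vec i) * (B'.coord i).1 w := by
        refine (C.sum_apply _ _ _).trans ?_
        refine Finset.sum_congr rfl fun i _ => ?_
        exact iA_smul k A L _ _
      change ψ.1 w - χ.1 w = 0
      rw [h2, sub_eq_zero]
      conv_lhs => rw [← B'.sum_eq' hw (s := (B'.finite p).toFinset)
        fun i hi => (B'.finite p).mem_toFinset.2 (show B'.deg i ≤ p by omega)]
      rw [map_sum]
      refine Finset.sum_congr rfl fun i _ => ?_
      rw [C.map_iA, mul_comm]
    have h3 : φ ⊗ₜ[k] ψ - expand B' p (pair k A L n (φ ⊗ₜ ψ)) = φ ⊗ₜ[k] (ψ - χ) -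
        ∑ i ∈ (B'.finite p).toFinset, (targetMul (ψ.1 (B'.vec i)) φ ⊗ₜ[k]
          (show C k A L n from B'.coord i) - φ ⊗ₜ[k] sourceMul (ψ.1 (B'.vec i))
          (show C k A L n from B'.coord i)) := by
      rw [Finset.sum_sub_distrib, ← TensorProduct.tmul_sum, TensorProduct.tmul_sub, expand_apply]
      simp only [slice_pair]
      change _ = φ ⊗ₜ[k] ψ - φ ⊗ₜ[k] χ - (_ - φ ⊗ₜ[k] χ)
      abel
    rw [h3]
    refine sub_mem (tmul_mem_tensorFil (i := 0) (by omega) (mem_jetFil_zero φ) h1)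
      (Submodule.sum_mem _ fun i _ => ?_)
    exact Submodule.subset_span (Or.inl ⟨_, _, _, rfl⟩)

/-- A tensor is congruent to the expansion of its image. If the image vanishes to order p, the i-th
slice is a jet of order p - deg i, which the order deg i of the coordinate completes to p. -/
theorem mem_tensorFil_of_pair {p : ℕ} {y : Jet k A L ⊗[k] C k A L n}
    (hy : pair k A L n y ∈ cochFil k A L (n + 1) p)
    (B' : AdaptedBasis k A L (T k A L n) (filT k A L n)) : y ∈ tensorFil k A L n p := by
  have h := sub_expand_pair B' p y
  rw [← sub_add_cancel y (expand B' p (pair k A L n y))]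
  refine add_mem h ?_
  rw [expand_apply]
  refine Submodule.sum_mem _ fun i hi => ?_
  have hi' : B'.deg i ≤ p := (B'.finite p).mem_toFinset.1 hi
  refine tmul_mem_tensorFil (i := p - B'.deg i) (by omega) ?_ (coord_mem_cochFil B' i)
  intro q hq D hD
  exact hy (q + B'.deg i) (by omega) _ (tmul_mem_filT hD (B'.vec_mem i) le_rfl)

theorem expand_sub_mem {p q : ℕ} (hpq : p ≤ q) (φ : C k A L (n + 1)) :
    expand B' q φ - expand B' p φ ∈ tensorFil k A L n p := by
  refine mem_tensorFil_of_pair ?_ B'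
  rw [map_sub, ← sub_sub_sub_cancel_left _ _ φ]
  exact sub_mem (sub_pair_expand B' p φ) (cochFil_antitone _ hpq (sub_pair_expand B' q φ))

/-- The expansion of a cochain as an element of the completed tensor product. -/
def toCompleted : C k A L (n + 1) →ₗ[k] completedTensor k A L n :=
  (LinearMap.pi fun p => (tensorFil k A L n p).mkQ ∘ₗ expand B' p).codRestrict _
    fun φ p q hpq => ⟨expand B' q φ, by
      refine ((Submodule.Quotient.eq _).2 ?_).symm
      exact expand_sub_mem B' hpq φ, rfl⟩

theorem toCompleted_eq_mkQ {φ : C k A L (n + 1)} {p : ℕ} {y : Jet k A L ⊗[k] C k A L n}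
    (h : (toCompleted B' φ).1 p = (tensorFil k A L n p).mkQ y) :
    φ - pair k A L n y ∈ cochFil k A L (n + 1) p := by
  have h1 : expand B' p φ - y ∈ tensorFil k A L n p := (Submodule.Quotient.eq _).1 h
  have h2 := pair_mem_cochFil h1
  rw [map_sub] at h2
  have h3 := add_mem (sub_pair_expand B' p φ) h2
  rwa [sub_add_sub_cancel] at h3

/-- Injectivity holds because every element of T (n + 1) has finite filtration degree; surjectivity
because compatible approximations have a limit, by `exists_limit`. -/
theorem toCompleted_bijective : Function.Bijective (toCompleted B') := by
  constructor
  · rw [injective_iff_map_eq_zero]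
    intro φ hφ
    refine HomA.hom_ext fun w => ?_
    obtain ⟨p, hp⟩ := exists_mem_filT (n + 1) w
    have h := toCompleted_eq_mkQ B' (φ := φ) (p := p + 1) (y := 0) (by rw [hφ, map_zero]; rfl)
    rw [map_zero, sub_zero] at h
    exact h p (Nat.lt_succ_self p) w hp
  · intro x
    choose y hy using fun p => (tensorFil k A L n p).mkQ_surjective (x.1 p)
    obtain ⟨φ, hφ⟩ := exists_limit (n + 1) (fun p => pair k A L n (y p)) fun p q hpq => by
      obtain ⟨z, hz, hz'⟩ := x.2 p q hpq
      rw [← hy] at hz hz'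
      have h1 := pair_mem_cochFil ((Submodule.Quotient.eq _).1 hz)
      have h2 := cochFil_antitone (n + 1) hpq (pair_mem_cochFil ((Submodule.Quotient.eq _).1 hz'))
      have h3 := sub_mem h1 h2
      rwa [map_sub, map_sub, sub_sub_sub_cancel_right] at h3
    refine ⟨φ, Subtype.ext (funext fun p => ?_)⟩
    rw [← hy p]
    refine (Submodule.Quotient.eq _).2 (mem_tensorFil_of_pair ?_ B')
    rw [map_sub, ← sub_sub_sub_cancel_left _ _ φ]
    exact sub_mem (hφ p) (sub_pair_expand B' p φ)

end Expand

theorem exists_completedTensor_equiv [Module.Finite A L] [Module.Projective A L] (n : ℕ) :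
    ∃ e : completedTensor k A L n ≃ₗ[k] C k A L (n + 1),
      ∀ (x : completedTensor k A L n) (p : ℕ) (y : Jet k A L ⊗[k] C k A L n),
        x.1 p = (tensorFil k A L n p).mkQ y →
          e x - pair k A L n y ∈ cochFil k A L (n + 1) p := by
  obtain ⟨B⟩ := nonempty_adaptedBasis_env k A L
  let e := LinearEquiv.ofBijective _ (toCompleted_bijective (adaptedBasisT B n))
  refine ⟨e.symm, fun x p y h => toCompleted_eq_mkQ (adaptedBasisT B n) ?_⟩
  have h1 : toCompleted (adaptedBasisT B n) (e.symm x) = x := e.apply_symm_apply x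
  rw [h1, h]

end Completion

end
end LieRinehart

namespace LieRinehart

noncomputable section

/-! ### The bar complex is a projective resolution of A. -/

section Resolution

variable {k A L : Type u} [CommRing k] [CommRing A] [Algebra k A] [LieRing L] [LieAlgebra k L]
  [Module A L] [LieRingModule L A] [LieRinehartRing A L] [LieRinehartAlgebra k A L]

section Projective

variable {M : Type u} [AddCommGroup M] [Module k M] [Module (Env k A L) M]
    [IsScalarTower k (Env k A L) M] {fil : ℕ → Submodule k M} (B : AdaptedBasis k A L M fil)
    (hfil : ∀ m, ∃ p, m ∈ fil p)

/-- The coordinates of an element of `M`, as an `A`-linear map to a free `𝒱L`-module. -/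
def AdaptedBasis.coords : HomA k A L M (B.ι →₀ Env k A L) where
  val :=
    { toFun := fun m => Finsupp.ofSupportFinite (fun i => Env.iA k A L ((B.coord i).1 m)) (by
        obtain ⟨p, hp⟩ := hfil m
        refine (B.finite p).subset fun i hi => show B.deg i ≤ p from not_lt.1 fun h => hi ?_
        change Env.iA k A L ((B.coord i).1 m) = 0
        rw [B.coord_eq_zero i p m h hp, map_zero])
      map_add' := fun m m' => Finsupp.ext fun i => by
        change Env.iA k A L ((B.coord i).1 (m + m'))
          = Env.iA k A L ((B.coord i).1 m) + Env.iA k A L ((B.coord i).1 m')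
        rw [map_add, map_add]
      map_smul' := fun c m => Finsupp.ext fun i => by
        change Env.iA k A L ((B.coord i).1 (c • m)) = c • Env.iA k A L ((B.coord i).1 m)
        rw [map_smul, map_smul] }
  property a m := Finsupp.ext fun i => by
    change Env.iA k A L ((B.coord i).1 (Env.iA k A L a • m))
      = Env.iA k A L a * Env.iA k A L ((B.coord i).1 m)
    rw [HomA.map_iA, iA_smul, map_mul]

theorem AdaptedBasis.coords_apply (m : M) (i : B.ι) :
    (B.coords hfil).1 m i = Env.iA k A L ((B.coord i).1 m) := rfl

include B hfil in
-- The dual basis is induced up to 𝒱L: the elements 1 ⊗ e_i and the coordinates exhibit the induced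
-- module as a direct summand of a free one. Adaptedness guarantees that the coordinates of each
-- element have finite support.
theorem AdaptedBasis.projective_ind : Module.Projective (Env k A L) (Ind k A L M) := by
  refine Module.Projective.of_split (Ind.lift (B.coords hfil))
    (Finsupp.linearCombination (Env k A L) fun i => Ind.tmul k A L 1 (B.vec i)) ?_
  refine LinearMap.ext fun x => ?_
  induction x using Ind.induction with
  | h D m =>
    obtain ⟨p, hp⟩ := hfil m
    rw [LinearMap.comp_apply, Ind.lift_tmul, map_smul, LinearMap.id_apply,
      Finsupp.linearCombination_apply, Finsupp.sum_of_support_subset (s := (B.finite p).toFinset)]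
    · have h := congrArg (Ind.unit k A L M).1 (B.sum_eq p m hp)
      rw [map_sum] at h
      simp only [HomA.map_iA] at h
      refine (congrArg (D • ·) h).trans ?_
      rw [Ind.unit_apply, Ind.smul_tmul, mul_one]
    · intro i hi
      rw [Finsupp.mem_support_iff, coords_apply] at hi
      refine (Set.Finite.mem_toFinset _).2 (show B.deg i ≤ p from not_lt.1 fun h => hi ?_)
      rw [B.coord_eq_zero i p m h hp, map_zero]
    · exact fun i _ => zero_smul _ _
  | hadd x y hx hy => rw [map_add, map_add, hx, hy]

end Projective

theorem projective_barComplex_X [Module.Finite A L] [Module.Projective A L] (n : ℕ) :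
    Projective ((barComplex k A L).X n) := by
  obtain ⟨B⟩ := nonempty_adaptedBasis_env k A L
  have := (adaptedBasisT B n).projective_ind (exists_mem_filT n)
  exact (IsProjective.iff_projective (R := Env k A L) (P := Ind k A L (T k A L n))).1 this

theorem barComplex_d (n : ℕ) :
    (barComplex k A L).d (n + 1) n = ModuleCat.ofHom (barD k A L (n + 1)) :=
  ChainComplex.of_d (fun n => T k A L (n + 1)) (fun n => ModuleCat.ofHom (barD k A L (n + 1))) n

/-- The map `w ↦ 1 ⊗ w`. -/
def T.unit (n : ℕ) : HomA k A L (T k A L n) (T k A L (n + 1)) := Ind.unit k A L (T k A L n)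

theorem barD_zero_unit (w : T k A L 0) : barD k A L 0 ((T.unit 0).1 w) = w :=
  (Ind.counit_tmul (M := T k A L 0) 1 w).trans (one_smul _ _)

theorem barD_succ_unit (n : ℕ) (w : T k A L (n + 1)) :
    barD k A L (n + 1) ((T.unit (n + 1)).1 w) = w - (T.unit n).1 (barD k A L n w) :=
  (Ind.barStep_tmul (barD k A L n) 1 w).trans
    (congrArg (· - (T.unit n).1 (barD k A L n w)) (one_smul (Env k A L) w))

/-- The A-linear map w ↦ 1 ⊗ w is a contracting homotopy of the augmented bar complex. -/
theorem barD_exact (n : ℕ) (w : T k A L (n + 1)) (hw : barD k A L n w = 0) :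
    barD k A L (n + 1) ((T.unit (n + 1)).1 w) = w := by
  rw [barD_succ_unit, hw]
  exact (congrArg (w - ·) (map_zero (T.unit n).1)).trans (sub_zero w)

theorem barD_zero_surjective : Function.Surjective (barD k A L 0) := fun a =>
  ⟨(T.unit 0).1 a, barD_zero_unit a⟩

theorem quasiIso_barAug : QuasiIso (barAug k A L) := by
  refine ⟨fun n => ?_⟩
  cases n with
  | zero =>
    rw [ChainComplex.quasiIsoAt₀_iff, ShortComplex.quasiIso_iff_of_zeros']
    -- In degree 0 the claim is the exactness of T 2 → T 1 → T 0 → 0.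
    · let S := ShortComplex.mk (ModuleCat.ofHom (barD k A L 1)) (ModuleCat.ofHom (barD k A L 0))
        (ModuleCat.hom_ext (barD_comp k A L 0))
      have hS : S.Exact ∧ Epi S.g := by
        refine ⟨?_, (ModuleCat.epi_iff_surjective _).2 barD_zero_surjective⟩
        rw [ShortComplex.moduleCat_exact_iff]
        exact fun w hw => ⟨_, barD_exact 0 w hw⟩
      refine (ShortComplex.exact_and_epi_g_iff_of_iso ?_).2 hS
      refine ShortComplex.isoMk (Iso.refl _) (Iso.refl _) (Iso.refl _) ?_ ?_
      · exact (Category.id_comp _).trans ((Category.comp_id _).trans (barComplex_d 0)).symm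
      · exact (Category.id_comp _).trans (Category.comp_id _).symm
    all_goals rfl
  | succ n =>
    rw [quasiIsoAt_iff_exactAt']
    · rw [HomologicalComplex.exactAt_iff' _ (n + 2) (n + 1) n (by simp) (by simp)]
      rw [ShortComplex.moduleCat_exact_iff]
      intro (w : T k A L (n + 2)) hw
      refine ⟨(T.unit (n + 2)).1 w, ?_⟩
      have h1 : barD k A L (n + 1) w = 0 := by
        have := congrArg (fun f => f.hom w) (barComplex_d (k := k) (A := A) (L := L) n)
        exact this.symm.trans hw
      refine (congrArg (fun f => f.hom ((T.unit (n + 2)).1 w)) (barComplex_d (k := k) (A := A) (L := L) (n + 1))).trans ?_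
      exact barD_exact (n + 1) w h1
    · apply ChainComplex.exactAt_succ_single_obj


/-- The coface δ_0 gives the first term. The other cofaces are transposes of the faces with their
index shifted by one, whence the minus sign. -/
theorem hochB_apply (n : ℕ) (φ : C k A L n) (w : T k A L (n + 1)) :
    (hochB k A L n φ).1 w = Ind.lift (M := T k A L n) φ w - φ.1 (barD k A L n w) := by
  have h1 : hochB k A L n φ = ∑ i : Fin (n + 2), (-1 : k) ^ (i : ℕ) • coface k A L n i φ := by
    simp [hochB]
  have h2 : φ.1 (barD k A L n w) = ∑ i : Fin (n + 1), (-1 : k) ^ (i : ℕ) • φ.1 (face k A L n i w) := by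
    rw [barD_eq_sum, LinearMap.sum_apply, map_sum]
    refine Finset.sum_congr rfl fun i _ => ?_
    rw [LinearMap.smul_apply, map_zsmul, ← Int.cast_smul_eq_zsmul k]
    simp
  rw [h1, h2]
  refine (C.sum_apply _ _ w).trans ?_
  rw [Fin.sum_univ_succ, sub_eq_add_neg, ← Finset.sum_neg_distrib]
  congr 1
  · rw [Fin.val_zero, pow_zero, one_smul]
    rfl
  · refine Finset.sum_congr rfl fun i _ => ?_
    rw [Fin.val_succ, pow_succ, mul_neg_one, ← neg_smul]
    rfl

/-- Together with the bijectivity of `barCochain`, this identifies (C, b) with the complex of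
𝒱L-linear maps from the bar complex to A. -/
theorem barComplex_d_comp_barCochain {n : ℕ} (φ : C k A L n) :
    (barComplex k A L).d (n + 1) n ≫ barCochain φ = barCochain (hochB k A L n φ) := by
  rw [barComplex_d]
  refine ModuleCat.hom_ext (LinearMap.ext fun (x : Ind k A L (T k A L (n + 1))) => ?_)
  induction x using Ind.induction with
  | h D w =>
    change Ind.lift (M := T k A L n) φ (Ind.barStep (M := T k A L n) (barD k A L n) (Ind.tmul k A L D w))
      = D • (hochB k A L n φ).1 w
    rw [hochB_apply, smul_sub]
    refine (congrArg (Ind.lift (M := T k A L n) φ) (Ind.barStep_tmul (barD k A L n) D w)).trans ?_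
    refine (map_sub _ _ _).trans (congrArg₂ (· - ·) (map_smul _ _ _) ?_)
    exact Ind.lift_tmul (M := T k A L n) φ D _
  | hadd x y hx hy => exact (map_add _ _ _).trans ((congrArg₂ (· + ·) hx hy).trans (map_add _ _ _).symm)

theorem barCochain_add {n : ℕ} (φ ψ : C k A L n) :
    barCochain (φ + ψ) = barCochain φ + barCochain ψ := by
  refine ModuleCat.hom_ext (LinearMap.ext fun x => ?_)
  exact congrArg (fun f : HomA k A L (Ind k A L (T k A L n)) A => f.1 x)
    (map_add (Ind.liftHom (k := k) (A := A) (L := L) (M := T k A L n) (N := A)) φ ψ)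

theorem barCochain_injective (n : ℕ) : Function.Injective (barCochain (k := k) (A := A) (L := L) (n := n)) := by
  intro φ ψ h
  refine HomA.hom_ext fun m => ?_
  have := congrArg (fun f => f.hom (Ind.tmul k A L 1 m)) h
  exact (one_smul (Env k A L) (φ.1 m)).symm.trans (this.trans (one_smul (Env k A L) (ψ.1 m)))

theorem barCochain_surjective (n : ℕ) : Function.Surjective (barCochain (k := k) (A := A) (L := L) (n := n)) := by
  intro f
  refine ⟨HomA.comp (HomA.ofLinear f.hom) (Ind.unit k A L (T k A L n)), ?_⟩
  refine ModuleCat.hom_ext (LinearMap.ext fun (x : Ind k A L (T k A L n)) => ?_)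
  induction x using Ind.induction with
  | h D w =>
    refine (f.hom.map_smul D (Ind.tmul k A L 1 w)).symm.trans ?_
    refine congrArg f.hom ((Ind.smul_tmul D 1 w).trans ?_)
    rw [mul_one]
  | hadd x y hx hy => exact (map_add _ _ _).trans ((congrArg₂ (· + ·) hx hy).trans (map_add _ _ _).symm)

theorem barCochain_zero (n : ℕ) : barCochain (0 : C k A L n) = 0 := by
  have h := barCochain_add (0 : C k A L n) 0
  rw [add_zero] at h
  exact left_eq_add.1 h

/-! ### Comparison of Hochschild cohomology with Ext. -/

section Ext

open CochainComplex.HomComplex in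
-- As a cochain complex the resolution is zero in degree 1, so in Ext^0 there are no coboundaries to
-- divide out.
theorem _root_.CategoryTheory.ProjectiveResolution.extMk_zero_degree_eq_zero {D : Type*} [Category D] [Abelian D]
    [HasExt D] {X Y : D} (R : ProjectiveResolution X) (f : R.complex.X 0 ⟶ Y)
    (hf : R.complex.d 1 0 ≫ f = 0) (h : R.extMk f 1 rfl hf = 0) : f = 0 := by
  rw [← R.extEquivCohomologyClass.apply_eq_iff_eq, ProjectiveResolution.extEquivCohomologyClass_extMk,
    ProjectiveResolution.extEquivCohomologyClass_zero, CohomologyClass.mk_eq_zero_iff,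
    Cocycle.toSingleMk_mem_coboundaries_iff _ _ _ _ _ 1 (by lia)] at h
  obtain ⟨g, hg⟩ := h
  have h0 : g = 0 := (CochainComplex.isZero_of_isStrictlyLE R.cochainComplex 0 1 (by lia)).eq_of_src _ _
  rw [h0, Limits.comp_zero] at hg
  have h1 := (cancel_epi (R.cochainComplexXIso (-(0 : ℕ)) 0 rfl).hom).1 (hg.symm.trans Limits.comp_zero.symm)
  exact h1

variable (hP : ∀ n : ℕ, Projective ((barComplex k A L).X n)) (hQ : QuasiIso (barAug k A L))

theorem barRes_d_comp_barCochain {n : ℕ} (φ : hochZ k A L n) :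
    (barRes k A L hP hQ).complex.d (n + 1) n ≫ barCochain φ.1 = 0 :=
  (barComplex_d_comp_barCochain φ.1).trans
    ((congrArg barCochain (LinearMap.mem_ker.1 φ.2)).trans (barCochain_zero _))

/-- The map from Hochschild cocycles to Lie-Rinehart cohomology. -/
def toLRCohomology (n : ℕ) : hochZ k A L n →ₗ[k] LRCohomology k A L n where
  toFun φ := (barRes k A L hP hQ).extMk (barCochain φ.1) (n + 1) rfl (barRes_d_comp_barCochain hP hQ φ)
  map_add' φ ψ := by
    refine Eq.trans ?_ (ProjectiveResolution.add_extMk _ _ _ _ _ _ _).symm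
    congr 1
    exact barCochain_add φ.1 ψ.1
  -- Scalars of k act on Ext by composition with the corresponding endomorphism of A, which turns
  -- the claim into an identity of cochains.
  map_smul' c φ := by
    refine Eq.trans ?_ (Abelian.Ext.smul_eq_comp_mk₀ _ _).symm
    refine Eq.trans ?_ (ProjectiveResolution.extMk_comp_mk₀ _ _ _ _ _ _).symm
    congr 1
    refine ModuleCat.hom_ext (LinearMap.ext fun x => ?_)
    refine (congrArg (fun f : HomA k A L (Ind k A L (T k A L n)) A => f.1 x)
      (map_smul (Ind.liftHom (k := k) (A := A) (L := L) (M := T k A L n) (N := A)) c φ.1)).trans ?_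
    exact (algebraMap_smul (Env k A L) c _).symm

theorem ker_toLRCohomology (n : ℕ) :
    LinearMap.ker (toLRCohomology hP hQ n) = (hochBdry k A L n).submoduleOf (hochZ k A L n) := by
  ext φ
  change toLRCohomology hP hQ n φ = 0 ↔ φ.1 ∈ hochBdry k A L n
  cases n with
  | zero =>
    constructor
    · intro h
      have := (barRes k A L hP hQ).extMk_zero_degree_eq_zero (barCochain φ.1)
        (barRes_d_comp_barCochain hP hQ φ) h
      exact barCochain_injective 0 (this.trans (barCochain_zero 0).symm)
    · intro h
      obtain rfl : φ = 0 := Subtype.ext h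
      exact map_zero _
  | succ n =>
    refine ((barRes k A L hP hQ).extMk_eq_zero_iff (barCochain φ.1) (n + 2) rfl
      (barRes_d_comp_barCochain hP hQ φ) n rfl).trans ⟨?_, ?_⟩
    · rintro ⟨g, hg⟩
      obtain ⟨ψ, rfl⟩ := barCochain_surjective n g
      exact ⟨ψ, barCochain_injective _ ((barComplex_d_comp_barCochain ψ).symm.trans hg)⟩
    · rintro ⟨ψ, hψ⟩
      exact ⟨barCochain ψ, (barComplex_d_comp_barCochain ψ).trans (congrArg barCochain hψ)⟩

theorem toLRCohomology_surjective (n : ℕ) : Function.Surjective (toLRCohomology hP hQ n) := by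
  intro x
  obtain ⟨f, hf, rfl⟩ := (barRes k A L hP hQ).extMk_surjective x (n + 1) rfl
  obtain ⟨φ, rfl⟩ := barCochain_surjective n f
  refine ⟨⟨φ, barCochain_injective _ ((barComplex_d_comp_barCochain φ).symm.trans (hf.trans (barCochain_zero _).symm))⟩, rfl⟩

/-- The Hochschild cohomology of the jet space is the Lie-Rinehart cohomology. -/
def hochEquivLR (n : ℕ) : HH k A L n ≃ₗ[k] LRCohomology k A L n :=
  (Submodule.quotEquivOfEq _ _ (ker_toLRCohomology hP hQ n).symm).trans
    ((toLRCohomology hP hQ n).quotKerEquivOfSurjective (toLRCohomology_surjective hP hQ n))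

theorem hochEquivLR_mk (n : ℕ) (φ : hochZ k A L n) :
    hochEquivLR hP hQ n (Submodule.Quotient.mk φ) = (barRes k A L hP hQ).extMk (barCochain φ.1)
      (n + 1) rfl (barRes_d_comp_barCochain hP hQ φ) := rfl

end Ext

end Resolution

end

end LieRinehart

namespace LieRinehart

noncomputable section

/-! ### Naturality of the Grothendieck connection and the tensor identity. -/

section ConnectionAction

variable {k A L : Type u} [CommRing k] [CommRing A] [Algebra k A] [LieRing L] [LieAlgebra k L]
  [Module A L] [LieRingModule L A] [LieRinehartRing A L] [LieRinehartAlgebra k A L]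
  {M N Q : Type u}
  [AddCommGroup M] [Module k M] [Module (Env k A L) M] [IsScalarTower k (Env k A L) M]
  [AddCommGroup N] [Module k N] [Module (Env k A L) N] [IsScalarTower k (Env k A L) N]
  [AddCommGroup Q] [Module k Q] [Module (Env k A L) Q] [IsScalarTower k (Env k A L) Q]

/-- An `A`-linear map which commutes with the action of `L` is `𝒱L`-linear. -/
def HomA.toLinear (f : HomA k A L M N) (hf : ∀ X m, f.1 (Env.iL k A L X • m)
    = Env.iL k A L X • f.1 m) : M →ₗ[Env k A L] N where
  toFun := f.1
  map_add' := map_add f.1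
  map_smul' D m := by
    rw [RingHom.id_apply]
    induction D using Env.induction generalizing m with
    | hA a => exact f.2 a m
    | hL X => exact hf X m
    | hadd D E hD hE => rw [add_smul, map_add, hD, hE, add_smul]
    | hmul D E hD hE => rw [mul_smul, hD, hE, mul_smul]

theorem HomA.act_mul_apply (D E : Env k A L) (f : HomA k A L M N) :
    HomA.act k A L M N (D * E) f = HomA.act k A L M N D (HomA.act k A L M N E f) := by
  rw [map_mul]; rfl

theorem HomA.act_iL_apply (X : L) (f : HomA k A L M N) (m : M) :
    (HomA.act k A L M N (Env.iL k A L X) f).1 m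
      = Env.iL k A L X • f.1 m - f.1 (Env.iL k A L X • m) := by
  rw [HomA.act_iL]; rfl

theorem HomA.act_iL_mul (X : L) (D : Env k A L) (f : HomA k A L M N) (m : M) :
    (HomA.act k A L M N (Env.iL k A L X * D) f).1 m
      = Env.iL k A L X • (HomA.act k A L M N D f).1 m
        - (HomA.act k A L M N D f).1 (Env.iL k A L X • m) := by
  rw [HomA.act_mul_apply, HomA.act_iL_apply]

theorem HomA.act_one (f : HomA k A L M N) : HomA.act k A L M N 1 f = f := by
  rw [map_one]; rfl

/-- Naturality of the connection in the target. Combined with `HomA.act_comp` it reduces later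
computations on the elements (∇_D unit)(m) to the values on 1 ⊗ m. -/
theorem HomA.comp_act (g : N →ₗ[Env k A L] Q) (D : Env k A L) (f : HomA k A L M N) :
    HomA.comp (HomA.ofLinear g) (HomA.act k A L M N D f)
      = HomA.act k A L M Q D (HomA.comp (HomA.ofLinear g) f) := by
  induction D using Env.induction generalizing f with
  | hA a => rw [HomA.act_iA, HomA.act_iA]; exact HomA.hom_ext fun m => g.map_smul _ _
  | hL X =>
    rw [HomA.act_iL, HomA.act_iL]
    exact HomA.hom_ext fun m => (map_sub g _ _).trans (congrArg (· - _) (g.map_smul _ _))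
  | hadd D E hD hE =>
    rw [map_add, map_add, LinearMap.add_apply, LinearMap.add_apply, ← hD, ← hE]
    exact HomA.hom_ext fun m => map_add g _ _
  | hmul D E hD hE => rw [HomA.act_mul_apply, HomA.act_mul_apply, hD, hE]

theorem HomA.act_comp (g : HomA k A L N Q) (D : Env k A L) (f : M →ₗ[Env k A L] N) :
    HomA.comp (HomA.act k A L N Q D g) (HomA.ofLinear f)
      = HomA.act k A L M Q D (HomA.comp g (HomA.ofLinear f)) := by
  induction D using Env.induction generalizing g with
  | hA a => rw [HomA.act_iA, HomA.act_iA]; rfl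
  | hL X =>
    rw [HomA.act_iL, HomA.act_iL]
    refine HomA.hom_ext fun m => ?_
    rw [HomA.comp_apply, HomA.actL_apply, HomA.actL_apply, HomA.comp_apply, HomA.comp_apply,
      HomA.ofLinear_apply, HomA.ofLinear_apply, f.map_smul]
  | hadd D E hD hE =>
    rw [map_add, map_add, LinearMap.add_apply, LinearMap.add_apply, ← hD, ← hE]
    rfl
  | hmul D E hD hE => rw [HomA.act_mul_apply, HomA.act_mul_apply, hD, hE]

/-- A multiplication by `a` is carried along because ∇_E id is a multiple of the identity, so that
the induction over products needs multiples as input. -/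
theorem HomA.act_id (D : Env k A L) (m : M) :
    (HomA.act k A L M M D (HomA.ofLinear LinearMap.id)).1 m
      = Env.iA k A L (D • (1 : A)) • m := by
  have h : ∀ (D : Env k A L) (a : A),
      HomA.act k A L M M D (HomA.actA k A L M M a (HomA.ofLinear LinearMap.id))
        = HomA.actA k A L M M (D • a) (HomA.ofLinear LinearMap.id) := by
    intro D
    induction D using Env.induction with
    | hA b =>
      intro a
      rw [HomA.act_iA, ← Module.End.mul_apply, ← map_mul, iA_smul]
    | hL X =>
      intro a
      rw [HomA.act_iL]
      refine HomA.hom_ext fun m => ?_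
      rw [HomA.actL_apply, HomA.actA_apply, HomA.actA_apply, HomA.actA_apply, iL_smul,
        HomA.ofLinear_apply, HomA.ofLinear_apply, LinearMap.id_apply, LinearMap.id_apply,
        iL_smul_iA_smul, add_sub_cancel_left]
    | hadd D E hD hE =>
      intro a
      rw [map_add, LinearMap.add_apply, hD, hE, add_smul, map_add, LinearMap.add_apply]
    | hmul D E hD hE =>
      intro a
      rw [HomA.act_mul_apply, hE, hD, mul_smul]
  have h1 := h D 1
  rw [map_one, Module.End.one_apply] at h1
  rw [h1]
  rfl

variable (M) in
/-- The map `m ↦ D ⊗ m`. -/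
def Tens.mkHom (D : Env k A L) : HomA k A L M (Tens k A L (Env k A L) M) :=
  ⟨Tens.mk₂ k A L (Env k A L) M D, fun a m => by
    rw [Tens.mk₂_apply, Tens.mk₂_apply, Tens.iA_smul_tmul, Tens.smul_tmul]⟩

@[simp]
theorem Tens.mkHom_apply (D : Env k A L) (m : M) :
    (Tens.mkHom M D).1 m = Tens.tmul k A L D m := rfl

/-- The connection subtracts the action on m from the diagonal action, leaving left multiplication
on the first factor. -/
theorem Tens.act_mkHom (D E : Env k A L) :
    HomA.act k A L M _ D (Tens.mkHom M E) = Tens.mkHom M (D * E) := by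
  induction D using Env.induction generalizing E with
  | hA a => rw [HomA.act_iA]; exact HomA.hom_ext fun m => Tens.iA_smul_tmul a E m
  | hL X =>
    rw [HomA.act_iL]
    refine HomA.hom_ext fun m => ?_
    rw [HomA.actL_apply, Tens.mkHom_apply, Tens.mkHom_apply, Tens.mkHom_apply,
      Tens.iL_smul_tmul, add_sub_cancel_right, smul_eq_mul]
  | hadd D D' hD hD' =>
    rw [map_add, LinearMap.add_apply, hD, hD', add_mul]
    exact HomA.hom_ext fun m => (Tens.add_tmul _ _ m).symm
  | hmul D D' hD hD' => rw [HomA.act_mul_apply, hD', hD, mul_assoc]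

theorem Tens.act_map (D : Env k A L) (f : HomA k A L N Q) (m : M) (n : N) :
    (HomA.act k A L _ _ D (Tens.map M f)).1 (Tens.tmul k A L m n)
      = Tens.tmul k A L m ((HomA.act k A L N Q D f).1 n) := by
  have h : HomA.act k A L _ _ D (Tens.map M f) = Tens.map M (HomA.act k A L N Q D f) := by
    induction D using Env.induction generalizing f with
    | hA a =>
      rw [HomA.act_iA, HomA.act_iA]
      refine Subtype.ext (Tens.hom_ext fun m n => ?_)
      change Env.iA k A L a • Tens.tmul k A L m (f.1 n) = Tens.tmul k A L m (Env.iA k A L a • f.1 n)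
      rw [Tens.iA_smul_tmul, Tens.smul_tmul]
    | hL X =>
      rw [HomA.act_iL, HomA.act_iL]
      refine Subtype.ext (Tens.hom_ext fun m n => ?_)
      change Env.iL k A L X • Tens.tmul k A L m (f.1 n)
          - (Tens.map M f).1 (Env.iL k A L X • Tens.tmul k A L m n)
        = Tens.tmul k A L m (Env.iL k A L X • f.1 n - f.1 (Env.iL k A L X • n))
      rw [Tens.iL_smul_tmul, Tens.iL_smul_tmul, map_add, Tens.tmul_sub]
      exact add_sub_add_left_eq_sub _ _ _
    | hadd D E hD hE =>
      rw [map_add, map_add, LinearMap.add_apply, LinearMap.add_apply, hD, hE]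
      exact Subtype.ext (Tens.hom_ext fun m n => (Tens.tmul_add _ _ _).symm)
    | hmul D E hD hE => rw [HomA.act_mul_apply, HomA.act_mul_apply, hE, hD]
  rw [h]; rfl

/-- The map `id ⊗ f` for a `𝒱L`-linear map `f`. -/
def Tens.mapLinear (f : N →ₗ[Env k A L] Q) : Tens k A L M N →ₗ[Env k A L] Tens k A L M Q :=
  HomA.toLinear (Tens.map M (HomA.ofLinear f)) fun X x => by
    induction x using Tens.induction with
    | h m n =>
      rw [Tens.iL_smul_tmul, map_add]
      refine Eq.trans ?_ (Tens.iL_smul_tmul X m (f n)).symm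
      exact congrArg (fun y => _ + Tens.tmul k A L m y) (f.map_smul _ n)
    | hadd x y hx hy => rw [smul_add, map_add, map_add, smul_add, hx, hy]

/-- The `𝒱L`-linear map `𝒱L ⊗_A M → 𝒱L ⊗_A M`, from the induced module to the tensor product with the
diagonal action, with `1 ⊗ m ↦ 1 ⊗ m`. -/
def Ind.toTens : Ind k A L M →ₗ[Env k A L] Tens k A L (Env k A L) M := Ind.lift (Tens.mkHom M 1)

/-- This names the element of the induced module that corresponds to D ⊗ m in the diagonal tensor
product. -/
theorem Ind.toTens_act_unit (D : Env k A L) (m : M) :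
    Ind.toTens ((HomA.act k A L M _ D (Ind.unit k A L M)).1 m) = Tens.tmul k A L D m := by
  have h := HomA.comp_act (Ind.toTens (k := k) (A := A) (L := L) (M := M)) D (Ind.unit k A L M)
  have h1 : HomA.comp (HomA.ofLinear (Ind.toTens (k := k) (A := A) (L := L) (M := M)))
      (Ind.unit k A L M) = Tens.mkHom M 1 := HomA.hom_ext fun m => one_smul (Env k A L) (Tens.tmul k A L (1 : Env k A L) m)
  rw [h1, Tens.act_mkHom, mul_one] at h
  exact congrArg (fun f => f.1 m) h

variable (k A L M) in
/-- The map `(D, m) ↦ (D * unit)(m)`. -/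
def Tens.toIndBilin : Env k A L →ₗ[k] M →ₗ[k] Ind k A L M :=
  LinearMap.mk₂ k (fun D m => (HomA.act k A L M (Ind k A L M) D (Ind.unit k A L M)).1 m)
    (fun D E m => HomA.act_add D E (Ind.unit k A L M) m)
    (fun c D m => HomA.act_smul c D (Ind.unit k A L M) m)
    (fun D m m' => map_add (HomA.act k A L M (Ind k A L M) D (Ind.unit k A L M)).1 m m')
    (fun c D m => map_smul (HomA.act k A L M (Ind k A L M) D (Ind.unit k A L M)).1 c m)

theorem Tens.toIndBilin_apply (D : Env k A L) (m : M) : Tens.toIndBilin k A L M D m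
    = (HomA.act k A L M (Ind k A L M) D (Ind.unit k A L M)).1 m := rfl

theorem Tens.toIndBilin_iA (a : A) (D : Env k A L) (m : M) :
    Tens.toIndBilin k A L M (Env.iA k A L a • D) m = Env.iA k A L a • Tens.toIndBilin k A L M D m := by
  rw [Tens.toIndBilin_apply, smul_eq_mul, HomA.act_iA_mul, Tens.toIndBilin_apply]

variable (k A L M) in
/-- The map `D ⊗ m ↦ (D * unit)(m)`, inverse to `Ind.toTens`. -/
def Tens.toIndHom : HomA k A L (Tens k A L (Env k A L) M) (Ind k A L M) :=
  ⟨Tens.lift (Tens.toIndBilin k A L M) fun a D m => by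
      rw [Tens.toIndBilin_iA, Tens.toIndBilin_apply, Tens.toIndBilin_apply, ← HomA.map_iA],
    fun a x => by
      induction x using Tens.induction with
      | h D m => rw [Tens.iA_smul_tmul, Tens.lift_tmul, Tens.lift_tmul, Tens.toIndBilin_iA]
      | hadd x y hx hy => rw [smul_add, map_add, map_add, smul_add, hx, hy]⟩

theorem Tens.toIndHom_tmul (D : Env k A L) (m : M) :
    (Tens.toIndHom k A L M).1 (Tens.tmul k A L D m)
      = (HomA.act k A L M (Ind k A L M) D (Ind.unit k A L M)).1 m := rfl

/-- `Tens.toIndHom` as a `𝒱L`-linear map. -/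
def Tens.toInd : Tens k A L (Env k A L) M →ₗ[Env k A L] Ind k A L M :=
  HomA.toLinear (Tens.toIndHom k A L M) fun X x => by
    induction x using Tens.induction with
    | h D m =>
      rw [Tens.iL_smul_tmul, map_add, Tens.toIndHom_tmul, Tens.toIndHom_tmul, Tens.toIndHom_tmul,
        smul_eq_mul, HomA.act_iL_mul, sub_add_cancel]
    | hadd x y hx hy => rw [smul_add, map_add, map_add, smul_add, hx, hy]

/-- The maps `Ind.toTens` and `Tens.toInd` compose to the identity on the induced module, so the
images of the tensors D ⊗ m generate it additively. -/
theorem Ind.induction_act {P : Ind k A L M → Prop}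
    (h : ∀ (D : Env k A L) (m : M), P ((HomA.act k A L M _ D (Ind.unit k A L M)).1 m))
    (hadd : ∀ x y, P x → P y → P (x + y)) (x : Ind k A L M) : P x := by
  have hs : ∀ x : Ind k A L M, Tens.toInd (Ind.toTens x) = x := by
    intro x
    induction x using Ind.induction with
    | h D m =>
      refine (map_smul Tens.toInd D (Tens.tmul k A L 1 m)).trans ?_
      change D • (HomA.act k A L M _ 1 (Ind.unit k A L M)).1 m = _
      rw [HomA.act_one, Ind.unit_apply, Ind.smul_tmul, mul_one]
    | hadd x y hx hy => rw [map_add, map_add, hx, hy]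
  rw [← hs x]
  induction Ind.toTens x using Tens.induction with
  | h D m => exact h D m
  | hadd x y hx hy => rw [map_add]; exact hadd _ _ hx hy

theorem Ind.counit_act_unit (D : Env k A L) (m : M) :
    Ind.counit k A L M ((HomA.act k A L M _ D (Ind.unit k A L M)).1 m)
      = Env.iA k A L (D • (1 : A)) • m := by
  have h := HomA.comp_act (Ind.counit k A L M) D (Ind.unit k A L M)
  have h1 : HomA.comp (HomA.ofLinear (Ind.counit k A L M)) (Ind.unit k A L M)
      = HomA.ofLinear LinearMap.id := HomA.hom_ext fun m => by simp
  rw [h1] at h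
  exact (congrArg (fun f => f.1 m) h).trans (HomA.act_id D m)

theorem Ind.map_act_unit (g : M →ₗ[Env k A L] N) (D : Env k A L) (m : M) :
    Ind.map (HomA.ofLinear g) ((HomA.act k A L M _ D (Ind.unit k A L M)).1 m)
      = (HomA.act k A L N _ D (Ind.unit k A L N)).1 (g m) := by
  have h := HomA.comp_act (Ind.map (HomA.ofLinear g)) D (Ind.unit k A L M)
  have h1 : HomA.comp (HomA.ofLinear (Ind.map (HomA.ofLinear g))) (Ind.unit k A L M)
      = HomA.comp (Ind.unit k A L N) (HomA.ofLinear g) := HomA.hom_ext fun m => by simp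
  rw [h1, ← HomA.act_comp] at h
  exact congrArg (fun f => f.1 m) h

theorem Ind.lift_act_unit (φ : HomA k A L M N) (D : Env k A L) (m : M) :
    Ind.lift φ ((HomA.act k A L M _ D (Ind.unit k A L M)).1 m) = (HomA.act k A L M N D φ).1 m := by
  have h := HomA.comp_act (Ind.lift φ) D (Ind.unit k A L M)
  have h1 : HomA.comp (HomA.ofLinear (Ind.lift φ)) (Ind.unit k A L M) = φ :=
    HomA.hom_ext fun m => one_smul (Env k A L) (φ.1 m)
  rw [h1] at h
  exact congrArg (fun f => f.1 m) h

end ConnectionAction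

end

end LieRinehart

namespace LieRinehart

noncomputable section

/-! ### T n as a tensor power with diagonal action. -/

section Homogeneous

variable {k A L : Type u} [CommRing k] [CommRing A] [Algebra k A] [LieRing L] [LieAlgebra k L]
  [Module A L] [LieRingModule L A] [LieRinehartRing A L] [LieRinehartAlgebra k A L]

theorem lie_one_eq_zero (X : L) : ⁅X, (1 : A)⁆ = 0 := by
  have h := LieRinehartRing.leibniz_mul_right' X (1 : A) (1 : A)
  simpa using h

section Mult

variable {M N : Type u}
  [AddCommGroup M] [Module k M] [Module (Env k A L) M] [IsScalarTower k (Env k A L) M]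
  [AddCommGroup N] [Module k N] [Module (Env k A L) N] [IsScalarTower k (Env k A L) N]

/-- Functions on `(𝒱L)^n` which are `A`-multilinear (for the left multiplication by `A`). -/
structure IsMult {n : ℕ} (f : (Fin n → Env k A L) → N) : Prop where
  map_add : ∀ v i x y, f (Function.update v i (x + y))
    = f (Function.update v i x) + f (Function.update v i y)
  map_iA : ∀ v i a x, f (Function.update v i (Env.iA k A L a * x))
    = Env.iA k A L a • f (Function.update v i x)

/-- Functions on `(𝒱L)^n` which are equivariant for the diagonal action of `L`. -/
def IsEquivar {n : ℕ} (f : (Fin n → Env k A L) → N) : Prop :=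
  ∀ X v, Env.iL k A L X • f v = ∑ i, f (Function.update v i (Env.iL k A L X * v i))

theorem IsMult.perm {n : ℕ} {f : (Fin n → Env k A L) → N} (hf : IsMult f)
    (σ : Equiv.Perm (Fin n)) : IsMult (fun v => f (v ∘ σ)) where
  map_add v i x y := by simp only [Function.update_comp_equiv, hf.map_add]
  map_iA v i a x := by simp only [Function.update_comp_equiv, hf.map_iA]

theorem IsEquivar.perm {n : ℕ} {f : (Fin n → Env k A L) → N} (hf : IsEquivar f)
    (σ : Equiv.Perm (Fin n)) : IsEquivar (fun v => f (v ∘ σ)) := fun X v => by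
  rw [hf, ← Equiv.sum_comp σ.symm]
  simp only [Function.update_comp_equiv, Function.comp_apply, Equiv.apply_symm_apply]

theorem IsMult.sum {n : ℕ} {ι : Type*} (s : Finset ι) {f : ι → (Fin n → Env k A L) → N}
    (hf : ∀ i, IsMult (f i)) : IsMult (fun v => ∑ i ∈ s, f i v) where
  map_add v i x y := by simp only [(hf _).map_add, Finset.sum_add_distrib]
  map_iA v i a x := by simp only [(hf _).map_iA, Finset.smul_sum]

theorem IsEquivar.sum {n : ℕ} {ι : Type*} (s : Finset ι) {f : ι → (Fin n → Env k A L) → N}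
    (hf : ∀ i, IsEquivar (f i)) : IsEquivar (fun v => ∑ i ∈ s, f i v) := fun X v => by
  simp only [Finset.smul_sum, (hf _) X v]
  exact Finset.sum_comm

theorem IsMult.ksmul {n : ℕ} {f : (Fin n → Env k A L) → N} (hf : IsMult f) (c : k) :
    IsMult (fun v => c • f v) where
  map_add v i x y := by simp only [hf.map_add, smul_add]
  map_iA v i a x := by simp only [hf.map_iA, env_smul_smul]

theorem IsEquivar.ksmul {n : ℕ} {f : (Fin n → Env k A L) → N} (hf : IsEquivar f) (c : k) :
    IsEquivar (fun v => c • f v) := fun X v => by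
  rw [env_smul_smul, hf, Finset.smul_sum]

theorem IsMult.map_ksmul {n : ℕ} {f : (Fin n → Env k A L) → N} (hf : IsMult f)
    (v : Fin n → Env k A L) (i : Fin n) (c : k) (x : Env k A L) :
    f (Function.update v i (c • x)) = c • f (Function.update v i x) := by
  have h : c • x = Env.iA k A L (algebraMap k A c) * x := by
    rw [AlgHom.commutes, Algebra.smul_def]
  rw [h, hf.map_iA, AlgHom.commutes, algebraMap_smul]

/-- The transpose of `M → N` for a function `(D_0, …, D_n) ↦ (D_0 * φ)(f(D_1, …, D_n))`. -/
theorem IsMult.act_cons {n : ℕ} {f : (Fin n → Env k A L) → M} (hf : IsMult f)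
    (φ : HomA k A L M N) :
    IsMult (fun v : Fin (n + 1) → Env k A L => (HomA.act k A L M N (v 0) φ).1 (f (Fin.tail v))) where
  map_add v i x y := by
    cases i using Fin.cases with
    | zero => simp only [Function.update_self, Fin.tail_update_zero, HomA.act_add]
    | succ i =>
      simp only [Fin.tail_update_succ, hf.map_add, _root_.map_add,
        Function.update_of_ne (Fin.succ_ne_zero i).symm]
  map_iA v i a x := by
    cases i using Fin.cases with
    | zero => simp only [Function.update_self, Fin.tail_update_zero, HomA.act_iA_mul]
    | succ i =>
      simp only [Fin.tail_update_succ, hf.map_iA, HomA.map_iA,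
        Function.update_of_ne (Fin.succ_ne_zero i).symm]

theorem IsEquivar.act_cons {n : ℕ} {f : (Fin n → Env k A L) → M} (hf : IsEquivar f)
    (φ : HomA k A L M N) :
    IsEquivar (fun v : Fin (n + 1) → Env k A L =>
      (HomA.act k A L M N (v 0) φ).1 (f (Fin.tail v))) := fun X v => by
  rw [Fin.sum_univ_succ]
  simp only [Function.update_self, Fin.tail_update_zero, HomA.act_iL_mul, Fin.tail_update_succ,
    Function.update_of_ne (Fin.succ_ne_zero _).symm]
  rw [← map_sum, hf]
  simp only [Fin.tail, sub_add_cancel]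

/-- Two equivariant functions agree if they agree on the tuples which begin with `1`. -/
theorem IsEquivar.ext {n : ℕ} {f g : (Fin (n + 1) → Env k A L) → N} (hf : IsEquivar f)
    (hf' : IsMult f) (hg : IsEquivar g) (hg' : IsMult g)
    (h : ∀ v : Fin n → Env k A L, f (Fin.cons 1 v) = g (Fin.cons 1 v)) : f = g := by
  -- Agreement is propagated from first entry `E` to first entry `D * E`; with this extra `E` the
  -- case of a product `D` is a composition of two steps.
  have key : ∀ D E : Env k A L, (∀ v : Fin n → Env k A L, f (Fin.cons E v) = g (Fin.cons E v)) →
      ∀ v : Fin n → Env k A L, f (Fin.cons (D * E) v) = g (Fin.cons (D * E) v) := by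
    intro D
    induction D using Env.induction with
    | hA a =>
      intro E hE v
      have h1 := hf'.map_iA (Fin.cons E v) 0 a E
      have h2 := hg'.map_iA (Fin.cons E v) 0 a E
      rw [Fin.update_cons_zero, Fin.update_cons_zero] at h1 h2
      rw [h1, h2, hE]
    | hL X =>
      intro E hE v
      have h1 := hf X (Fin.cons E v)
      have h2 := hg X (Fin.cons E v)
      rw [Fin.sum_univ_succ, Fin.cons_zero, Fin.update_cons_zero] at h1 h2
      -- In the equivariance formula every summand but the first still begins with `E`, so all of
      -- them agree and can be cancelled.
      simp only [← Fin.cons_update, hE, Fin.cons_succ] at h1 h2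
      rw [h1] at h2
      exact add_right_cancel h2
    | hadd D D' hD hD' =>
      intro E hE v
      have h1 := hf'.map_add (Fin.cons E v) 0 (D * E) (D' * E)
      have h2 := hg'.map_add (Fin.cons E v) 0 (D * E) (D' * E)
      rw [Fin.update_cons_zero, Fin.update_cons_zero, Fin.update_cons_zero] at h1 h2
      rw [add_mul, h1, h2, hD E hE, hD' E hE]
    | hmul D D' hD hD' =>
      intro E hE v
      rw [mul_assoc]
      exact hD _ (hD' E hE) v
  funext v
  have h1 := key (v 0) 1 h (Fin.tail v)
  rwa [mul_one, Fin.cons_self_tail] at h1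

end Mult

/-- The homogeneous generators of `T n`, defined by `hgen () = 1` and
`hgen (D_0, …, D_n) = (D_0 * unit)(hgen (D_1, …, D_n))`. -/
def hgen : ∀ n : ℕ, (Fin n → Env k A L) → T k A L n
  | 0, _ => (1 : A)
  | n + 1, v => (HomA.act k A L (T k A L n) (T k A L (n + 1)) (v 0) (T.unit n)).1
      (hgen n (Fin.tail v))

theorem hgen_succ (n : ℕ) (v : Fin (n + 1) → Env k A L) :
    hgen (n + 1) v = (HomA.act k A L (T k A L n) (T k A L (n + 1)) (v 0) (T.unit n)).1
      (hgen n (Fin.tail v)) := rfl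

theorem isMult_hgen : ∀ n : ℕ, IsMult (hgen (k := k) (A := A) (L := L) n)
  | 0 => ⟨fun _ i => i.elim0, fun _ i => i.elim0⟩
  | n + 1 => (isMult_hgen n).act_cons (T.unit n)

theorem isEquivar_hgen : ∀ n : ℕ, IsEquivar (hgen (k := k) (A := A) (L := L) n)
  | 0 => fun X v => by
    rw [Finset.univ_eq_empty, Finset.sum_empty]
    exact (iL_smul k A L X (1 : A)).trans (lie_one_eq_zero X)
  | n + 1 => (isEquivar_hgen n).act_cons (T.unit n)

/-- The elements `hgen` generate T n as an A-module, so A-linear maps are determined by their values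
there. -/
theorem hgen_induction : ∀ (n : ℕ) {P : T k A L n → Prop} (_ : ∀ v, P (hgen n v))
    (_ : ∀ x y, P x → P y → P (x + y)) (_ : ∀ (a : A) x, P x → P (Env.iA k A L a • x))
    (x : T k A L n), P x
  | 0, P, h, _, hs, x => by
    have h1 := hs x _ (h Fin.elim0)
    have h2 : Env.iA k A L (x : A) • hgen 0 Fin.elim0 = x :=
      (iA_smul k A L x (1 : A)).trans (mul_one (id x : A))
    rwa [h2] at h1
  | n + 1, P, h, hadd, hs, x => by
    refine Ind.induction_act (M := T k A L n) (P := P) (fun D m => ?_) hadd x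
    refine hgen_induction n (P := fun m => P ((HomA.act k A L (T k A L n) (T k A L (n + 1)) D
      (T.unit n)).1 m)) (fun v => h (Fin.cons D v)) (fun x y hx hy => ?_) (fun a x hx => ?_) m
    · rw [map_add]; exact hadd _ _ hx hy
    · rw [HomA.map_iA]; exact hs a _ hx

theorem T.hom_ext {N : Type u} [AddCommGroup N] [Module k N] [Module (Env k A L) N]
    [IsScalarTower k (Env k A L) N] {n : ℕ} {f g : HomA k A L (T k A L n) N}
    (h : ∀ v, f.1 (hgen n v) = g.1 (hgen n v)) : f = g :=
  HomA.hom_ext (hgen_induction n h (fun x y hx hy => by rw [map_add, map_add, hx, hy])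
    fun a x hx => by rw [HomA.map_iA, HomA.map_iA, hx])

/-- `hgen` is the universal A-multilinear map on n arguments: freeze the first argument, extend in
the remaining ones by induction, and pass from the diagonal tensor product back to the induced
module. -/
theorem T.exists_hom : ∀ (n : ℕ) {N : Type u} [AddCommGroup N] [Module k N] [Module (Env k A L) N]
    [IsScalarTower k (Env k A L) N] (f : (Fin n → Env k A L) → N), IsMult f →
    ∃ F : HomA k A L (T k A L n) N, ∀ v, F.1 (hgen n v) = f v
  | 0, N, _, _, _, _, f, _ => by
    refine ⟨HomA.comp (HomA.comp
      (HomA.ofLinear (LinearMap.toSpanSingleton (Env k A L) N (f Fin.elim0))) (iAHom k A L))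
      (HomA.ofLinear (M := T k A L 0) (N := A) (LinearMap.id : A →ₗ[Env k A L] A)), fun v => ?_⟩
    change Env.iA k A L 1 • f Fin.elim0 = f v
    rw [map_one, one_smul, Subsingleton.elim v Fin.elim0]
  | n + 1, N, _, _, _, _, f, hf => by
    have hcons : ∀ D, IsMult fun v : Fin n → Env k A L => f (Fin.cons D v) := fun D =>
      { map_add := fun v i x y => by simp only [Fin.cons_update, hf.map_add]
        map_iA := fun v i a x => by simp only [Fin.cons_update, hf.map_iA] }
    choose F hF using fun D => T.exists_hom n _ (hcons D)
    have hadd : ∀ D E, F (D + E) = F D + F E := fun D E => T.hom_ext fun v => by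
      refine (hF _ v).trans (Eq.trans ?_ (congrArg₂ (· + ·) (hF D v) (hF E v)).symm)
      have h := hf.map_add (Fin.cons 0 v) 0 D E
      rwa [Fin.update_cons_zero, Fin.update_cons_zero, Fin.update_cons_zero] at h
    have hsmul : ∀ (c : k) D, F (c • D) = c • F D := fun c D => T.hom_ext fun v => by
      refine (hF _ v).trans (Eq.trans ?_ (congrArg (c • ·) (hF D v)).symm)
      have h := hf.map_ksmul (Fin.cons 0 v) 0 c D
      rwa [Fin.update_cons_zero, Fin.update_cons_zero] at h
    have hA : ∀ (a : A) D m, (F (Env.iA k A L a * D)).1 m = Env.iA k A L a • (F D).1 m := by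
      intro a D m
      have h : F (Env.iA k A L a * D) = HomA.actA k A L _ _ a (F D) := T.hom_ext fun v => by
        refine (hF _ v).trans (Eq.trans ?_ (congrArg (Env.iA k A L a • ·) (hF D v)).symm)
        have h := hf.map_iA (Fin.cons 0 v) 0 a D
        rwa [Fin.update_cons_zero, Fin.update_cons_zero] at h
      rw [h]; rfl
    let H : HomA k A L (Tens k A L (Env k A L) (T k A L n)) N :=
      ⟨Tens.lift (LinearMap.mk₂ k (fun D m => (F D).1 m)
        (fun D E m => congrArg (fun F : HomA k A L (T k A L n) N => F.1 m) (hadd D E))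
        (fun c D m => congrArg (fun F : HomA k A L (T k A L n) N => F.1 m) (hsmul c D))
        (fun D m m' => map_add (F D).1 m m')
        (fun c D m => map_smul (F D).1 c m)) fun a D m => (hA a D m).trans ((F D).2 a m).symm,
      fun a x => by
        induction x using Tens.induction with
        | h D m =>
          rw [Tens.iA_smul_tmul]
          exact hA a D m
        | hadd x y hx hy => rw [smul_add, map_add, map_add, smul_add, hx, hy]⟩
    refine ⟨HomA.comp H (HomA.ofLinear Ind.toTens), fun v => ?_⟩
    refine (congrArg H.1 (Ind.toTens_act_unit (v 0) (hgen n (Fin.tail v)))).trans ?_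
    refine (hF (v 0) (Fin.tail v)).trans ?_
    rw [Fin.cons_self_tail]

theorem T.exists_linear {n : ℕ} {N : Type u} [AddCommGroup N] [Module k N] [Module (Env k A L) N]
    [IsScalarTower k (Env k A L) N] (f : (Fin n → Env k A L) → N) (hf : IsMult f)
    (hf' : IsEquivar f) :
    ∃ F : T k A L n →ₗ[Env k A L] N, ∀ v, F (hgen n v) = f v := by
  obtain ⟨F, hF⟩ := T.exists_hom n f hf
  refine ⟨HomA.toLinear F fun X => hgen_induction n (fun v => ?_) (fun x y hx hy => ?_)
    (fun a x hx => ?_), hF⟩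
  · rw [isEquivar_hgen, map_sum, hF, hf']
    simp only [hF]
  · rw [smul_add, map_add, map_add, smul_add, hx, hy]
  · rw [iL_smul_iA_smul, map_add, HomA.map_iA, HomA.map_iA, HomA.map_iA, hx, iL_smul_iA_smul]

end Homogeneous

end

end LieRinehart

namespace LieRinehart

noncomputable section

/-! ### The cocyclic operators in homogeneous coordinates. -/

section Cyclic

variable {k A L : Type u} [CommRing k] [CommRing A] [Algebra k A] [LieRing L] [LieAlgebra k L]
  [Module A L] [LieRingModule L A] [LieRinehartRing A L] [LieRinehartAlgebra k A L]

/-- The homogeneous form `(D_0, …, D_n) ↦ (D_0 * φ)(hgen (D_1, …, D_n))` of a cochain. -/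
def homog {n : ℕ} (φ : C k A L n) (v : Fin (n + 1) → Env k A L) : A :=
  (HomA.act k A L (T k A L n) A (v 0) φ).1 (hgen n (Fin.tail v))

theorem homog_eq {n : ℕ} (φ : C k A L n) (v : Fin (n + 1) → Env k A L) :
    homog φ v = Ind.lift (M := T k A L n) φ (hgen (n + 1) v) :=
  (Ind.lift_act_unit (M := T k A L n) φ (v 0) (hgen n (Fin.tail v))).symm

theorem homog_cons_one {n : ℕ} (φ : C k A L n) (v : Fin n → Env k A L) :
    homog φ (Fin.cons 1 v) = φ.1 (hgen n v) := by
  rw [homog, Fin.cons_zero, Fin.tail_cons]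
  exact congrArg (fun f : HomA k A L (T k A L n) A => f.1 (hgen n v))
    (HomA.act_one (M := T k A L n) (N := A) φ)

theorem isMult_homog {n : ℕ} (φ : C k A L n) : IsMult (homog φ) := (isMult_hgen n).act_cons φ

theorem isEquivar_homog {n : ℕ} (φ : C k A L n) : IsEquivar (homog φ) :=
  (isEquivar_hgen n).act_cons φ

/-- Putting 1 in the first place recovers the values of the cochain on `hgen`, which determine it.
-/
theorem homog_injective (n : ℕ) : Function.Injective (homog (k := k) (A := A) (L := L) (n := n)) :=
  fun φ ψ h => T.hom_ext (N := A) (n := n) fun v => by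
    exact (homog_cons_one φ v).symm.trans ((congrFun h _).trans (homog_cons_one ψ v))

theorem homog_smul {n : ℕ} (c : k) (φ : C k A L n) (v : Fin (n + 1) → Env k A L) :
    homog (c • φ) v = c • homog φ v :=
  congrArg (fun f : HomA k A L (T k A L n) A => f.1 (hgen n (Fin.tail v)))
    (map_smul (HomA.act k A L (T k A L n) A (v 0)) c φ)

/-- The class of `D ⊗ w` in `T (n + 1)`. -/
def T.tmul {n : ℕ} (D : Env k A L) (w : T k A L n) : T k A L (n + 1) :=
  Ind.tmul k A L (M := T k A L n) D w

theorem T.induction {n : ℕ} {P : T k A L (n + 1) → Prop} (h : ∀ D w, P (T.tmul D w))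
    (hadd : ∀ x y, P x → P y → P (x + y)) (x : T k A L (n + 1)) : P x :=
  Ind.induction (M := T k A L n) h hadd x

theorem T.smul_tmul {n : ℕ} (D E : Env k A L) (w : T k A L n) :
    D • T.tmul E w = T.tmul (D * E) w := Ind.smul_tmul (M := T k A L n) D E w

theorem face_zero (n : ℕ) : face k A L n 0 = Ind.counit k A L (T k A L n) := by
  cases n <;> rfl

theorem face_zero_tmul {n : ℕ} (D : Env k A L) (w : T k A L n) :
    face k A L n 0 (T.tmul D w) = D • w := by
  rw [face_zero]
  exact Ind.counit_tmul (M := T k A L n) D w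

theorem face_succ_tmul {n : ℕ} (i : Fin (n + 1)) (D : Env k A L) (w : T k A L (n + 1)) :
    face k A L (n + 1) i.succ (T.tmul D w) = T.tmul D (face k A L n i w) :=
  Ind.map_tmul (M := T k A L (n + 1)) (N := T k A L n) (HomA.ofLinear (face k A L n i)) D w

theorem degen_last_tmul {n : ℕ} (D : Env k A L) (w : T k A L n) :
    (degen k A L (n + 1) (Fin.last (n + 1))).1 (T.tmul D w)
      = T.tmul D ((degen k A L n (Fin.last n)).1 w) :=
  Ind.map_tmul (M := T k A L n) (N := T k A L (n + 1)) (degen k A L n (Fin.last n)) D w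

theorem C.ext {n : ℕ} {φ ψ : C k A L n} (h : ∀ w, φ.1 w = ψ.1 w) : φ = ψ := HomA.hom_ext h

theorem coface_succ_apply {n : ℕ} (φ : C k A L n) (i : Fin (n + 1)) (w : T k A L (n + 1)) :
    (coface k A L n i.succ φ).1 w = φ.1 (face k A L n i w) := rfl

theorem codegen_apply {n : ℕ} (φ : C k A L (n + 1)) (i : Fin (n + 1)) (w : T k A L n) :
    (codegen k A L n i φ).1 w = φ.1 ((degen k A L n i).1 w) := rfl

/-- The multiplication of neighbouring factors becomes the omission of one entry. The counit sends
(∇_D unit)(m) to D(1) m, and by naturality of the connection the inner faces reduce to this case. -/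
theorem face_hgen : ∀ (n : ℕ) (i : Fin (n + 1)) (v : Fin (n + 1) → Env k A L),
    face k A L n i (hgen (n + 1) v)
      = Env.iA k A L (v i • (1 : A)) • hgen n (v ∘ i.succAbove) := by
  have h0 : ∀ (n : ℕ) (v : Fin (n + 1) → Env k A L), face k A L n 0 (hgen (n + 1) v)
      = Env.iA k A L (v 0 • (1 : A)) • hgen n (v ∘ Fin.succAbove 0) := fun n v => by
    rw [face_zero]
    exact Ind.counit_act_unit (M := T k A L n) (v 0) (hgen n (Fin.tail v))
  intro n
  induction n with
  | zero =>
    intro i v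
    obtain rfl : i = 0 := by ext; simp
    exact h0 0 v
  | succ n ih =>
    intro i v
    cases i using Fin.cases with
    | zero => exact h0 (n + 1) v
    | succ i =>
      refine (Ind.map_act_unit (face k A L n i) (v 0) (hgen (n + 1) (Fin.tail v))).trans ?_
      refine (congrArg (HomA.act k A L (T k A L n) (T k A L (n + 1)) (v 0) (T.unit n)).1
        (ih i (Fin.tail v))).trans ?_
      rw [HomA.map_iA, hgen_succ]
      have h1 : Fin.tail (v ∘ i.succ.succAbove) = Fin.tail v ∘ i.succAbove := by
        funext j
        simp [Fin.tail]
      rw [h1]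
      rfl

/-- The `𝒱L`-linear map `D ⊗ w ↦ D(φ(w))`. -/
def C.lift {n : ℕ} (φ : C k A L n) : T k A L (n + 1) →ₗ[Env k A L] A :=
  Ind.lift (M := T k A L n) φ

theorem C.lift_tmul {n : ℕ} (φ : C k A L n) (D : Env k A L) (w : T k A L n) :
    C.lift φ (T.tmul D w) = D • φ.1 w := rfl

theorem lift_coface {n : ℕ} (φ : C k A L n) (i : Fin (n + 2)) (x : T k A L (n + 2)) :
    C.lift (coface k A L n i φ) x = C.lift φ (face k A L (n + 1) i x) := by
  induction x using T.induction with
  | h D w =>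
    cases i using Fin.cases with
    | zero =>
      rw [face_zero_tmul, map_smul, C.lift_tmul]
      rfl
    | succ i => rw [face_succ_tmul, C.lift_tmul, C.lift_tmul, coface_succ_apply]
  | hadd x y hx hy => simp only [map_add, hx, hy]

theorem homog_coface {n : ℕ} (φ : C k A L n) (i : Fin (n + 2)) (v : Fin (n + 2) → Env k A L) :
    homog (coface k A L n i φ) v = (v i • (1 : A)) * homog φ (v ∘ i.succAbove) := by
  refine (homog_eq _ v).trans ((lift_coface φ i _).trans ?_)
  rw [face_hgen, LinearMap.map_smul, iA_smul, homog_eq]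
  rfl

theorem face_last_degen_last : ∀ (n : ℕ) (w : T k A L n),
    face k A L n (Fin.last n) ((degen k A L n (Fin.last n)).1 w) = w
  | 0, w => (Ind.counit_tmul (M := T k A L 0) 1 w).trans (one_smul _ _)
  | n + 1, w => by
    induction w using T.induction with
    | h D w =>
      rw [degen_last_tmul, ← Fin.succ_last, face_succ_tmul, face_last_degen_last n]
    | hadd x y hx hy => rw [map_add, map_add, hx, hy]

theorem degen_last_smul (n : ℕ) (D : Env k A L) (w : T k A L (n + 1)) :
    (degen k A L (n + 1) (Fin.last (n + 1))).1 (D • w)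
      = D • (degen k A L (n + 1) (Fin.last (n + 1))).1 w :=
  (Ind.map (degen k A L n (Fin.last n))).map_smul D w

/-- A cosimplicial identity needed only for the last codegeneracy, the one that occurs in Connes'
operator. The last face is excluded because it cancels that codegeneracy instead. -/
theorem face_castSucc_degen_last : ∀ (n : ℕ) (i : Fin (n + 1)) (_ : i ≠ Fin.last n)
    (w : T k A L (n + 1)),
    face k A L (n + 1) i.castSucc ((degen k A L (n + 1) (Fin.last (n + 1))).1 w)
      = (degen k A L n (Fin.last n)).1 (face k A L n i w)
  | 0, i, hi, _ => absurd (by ext; simp) hi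
  | n + 1, i, hi, w => by
    induction w using T.induction with
    | h D w =>
      rw [degen_last_tmul]
      cases i using Fin.cases with
      | zero => rw [Fin.castSucc_zero, face_zero_tmul, face_zero_tmul, degen_last_smul]
      | succ i =>
        rw [← Fin.succ_castSucc, face_succ_tmul, face_succ_tmul, degen_last_tmul,
          face_castSucc_degen_last n i (fun h => hi (by rw [h]; rfl))]
    | hadd x y hx hy => simp only [map_add, hx, hy]

theorem codegen_coface_last (n : ℕ) (φ : C k A L n) :
    codegen k A L n (Fin.last n) (coface k A L n (Fin.last (n + 1)) φ) = φ :=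
  C.ext fun w => congrArg φ.1 (face_last_degen_last n w)

theorem codegen_coface_castSucc (n : ℕ) (i : Fin (n + 1)) (φ : C k A L (n + 1)) :
    codegen k A L (n + 1) (Fin.last (n + 1)) (coface k A L (n + 1) i.castSucc.castSucc φ)
      = coface k A L n i.castSucc (codegen k A L n (Fin.last n) φ) := by
  refine C.ext fun w => ?_
  rw [codegen_apply]
  cases i using Fin.cases with
  | zero =>
    induction w using T.induction with
    | h D w =>
      rw [degen_last_tmul]
      rfl
    | hadd x y hx hy => rw [map_add, map_add, map_add, hx, hy]
  | succ i =>
    exact (coface_succ_apply φ i.castSucc.castSucc _).trans (congrArg φ.1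
      (face_castSucc_degen_last n i.castSucc (Fin.castSucc_lt_last i).ne w))

theorem coact_succ_tmul_one (n : ℕ) (m : T k A L n) :
    (coact k A L (n + 1)).1 (T.tmul 1 m)
      = (Tens.map (Env k A L) (Ind.unit k A L (T k A L n))).1 ((coact k A L n).1 m) :=
  one_smul (Env k A L) _

/-- The map `(id ⊗ face) ∘ coact`, as a `𝒱L`-linear map. -/
def cycMap (n : ℕ) : T k A L (n + 1) →ₗ[Env k A L] Tens k A L (Env k A L) (T k A L n) :=
  Tens.mapLinear (face k A L n (Fin.last n)) ∘ₗ
    Ind.lift (HomA.comp (Tens.map _ (Ind.unit k A L (T k A L n))) (coact k A L n))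

theorem cycMap_apply (n : ℕ) (x : T k A L (n + 1)) :
    cycMap n x = (Tens.map (Env k A L) (HomA.ofLinear (face k A L n (Fin.last n)))).1
      ((coact k A L (n + 1)).1 x) := rfl

theorem cycMap_zero_comp_unit : HomA.comp (HomA.ofLinear (cycMap (k := k) (A := A) (L := L) 0))
    (T.unit 0) = Tens.mkHom (T k A L 0) 1 := by
  refine T.hom_ext (n := 0) fun v => ?_
  have h : (coact k A L 0).1 (hgen 0 v) = Tens.tmul k A L (1 : Env k A L) (hgen 0 v) := by
    change Env.iA k A L 1 • Tens.tmul k A L (N := T k A L 0) (1 : Env k A L) (1 : A) = _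
    rw [map_one, one_smul]
    rfl
  rw [HomA.comp_apply, HomA.ofLinear_apply, cycMap_apply]
  refine (congrArg (Tens.map (Env k A L) (HomA.ofLinear (face k A L 0 (Fin.last 0)))).1
    ((coact_succ_tmul_one 0 (hgen 0 v)).trans
      (congrArg (Tens.map (Env k A L) (Ind.unit k A L (T k A L 0))).1 h))).trans ?_
  exact congrArg (Tens.tmul k A L 1) ((face_zero_tmul 1 (hgen 0 v)).trans (one_smul _ _))

theorem cycMap_succ_comp_unit (n : ℕ) :
    HomA.comp (HomA.ofLinear (cycMap (k := k) (A := A) (L := L) (n + 1))) (T.unit (n + 1))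
      = HomA.comp (Tens.map (Env k A L) (T.unit n)) (HomA.ofLinear (cycMap n)) := by
  have h : ∀ x : Tens k A L (Env k A L) (T k A L (n + 1)),
      (Tens.map (Env k A L) (HomA.ofLinear (face k A L (n + 1) (Fin.last (n + 1))))).1
        ((Tens.map (Env k A L) (T.unit (n + 1))).1 x)
      = (Tens.map (Env k A L) (T.unit n)).1
        ((Tens.map (Env k A L) (HomA.ofLinear (face k A L n (Fin.last n)))).1 x) := by
    intro x
    induction x using Tens.induction with
    | h D w => exact congrArg (Tens.tmul k A L D) (face_succ_tmul (Fin.last n) 1 w)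
    | hadd x y hx hy => simp only [map_add, hx, hy]
  exact HomA.hom_ext fun m => (congrArg
    (Tens.map (Env k A L) (HomA.ofLinear (face k A L (n + 1) (Fin.last (n + 1))))).1
    (coact_succ_tmul_one (n + 1) m)).trans (h _)

/-- Coaction followed by the counit on the last factor detaches the last entry. By naturality the
leading ∇_D passes through the map, so the claim reduces to fewer entries and finally to a single
one. -/
theorem cycMap_hgen : ∀ (n : ℕ) (v : Fin (n + 1) → Env k A L),
    cycMap n (hgen (n + 1) v) = Tens.tmul k A L (v (Fin.last n)) (hgen n (Fin.init v))
  | 0, v => by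
    have h := HomA.comp_act (cycMap (k := k) (A := A) (L := L) 0) (v 0) (T.unit 0)
    rw [cycMap_zero_comp_unit, Tens.act_mkHom, mul_one] at h
    exact congrArg (fun f => f.1 (hgen 0 (Fin.tail v))) h
  | n + 1, v => by
    have h := HomA.comp_act (cycMap (k := k) (A := A) (L := L) (n + 1)) (v 0) (T.unit (n + 1))
    rw [cycMap_succ_comp_unit, ← HomA.act_comp] at h
    refine (congrArg (fun f => f.1 (hgen (n + 1) (Fin.tail v))) h).trans ?_
    refine (congrArg (HomA.act k A L _ _ (v 0) (Tens.map (Env k A L) (T.unit n))).1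
      (cycMap_hgen n (Fin.tail v))).trans ?_
    exact Tens.act_map (v 0) (T.unit n) _ _

theorem cyc_hgen (n : ℕ) (φ : C k A L (n + 1)) (v : Fin (n + 1) → Env k A L) :
    (cyc k A L (n + 1) φ).1 (hgen (n + 1) v)
      = homog φ (Fin.cons (v (Fin.last n)) (Fin.cons 1 (Fin.init v))) := by
  refine (congrArg (HomA.evalConn (M := T k A L n) φ).1 (cycMap_hgen n v)).trans ?_
  rw [homog, hgen_succ, Fin.tail_cons, Fin.tail_cons, Fin.cons_zero, Fin.cons_zero, HomA.act_one]
  rfl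

theorem finRotate_symm_zero (n : ℕ) : (finRotate (n + 1)).symm 0 = Fin.last n := by
  rw [Equiv.symm_apply_eq, finRotate_last]

theorem finRotate_symm_succ (n : ℕ) (i : Fin n) :
    (finRotate (n + 1)).symm i.succ = i.castSucc := by
  rw [Equiv.symm_apply_eq]
  exact (finRotate_of_lt i.2).symm

/-- Antipode and diagonal multiplication together become a rotation of the arguments. Both sides are
equivariant and multilinear, so it suffices to let the first argument be 1, where `cyc_hgen` gives
the value. -/
theorem homog_cyc : ∀ (n : ℕ) (φ : C k A L n) (v : Fin (n + 1) → Env k A L),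
    homog (cyc k A L n φ) v = homog φ (v ∘ (finRotate (n + 1)).symm)
  | 0, φ, v => by rw [finRotate_one]; rfl
  | n + 1, φ, v => by
    refine congrFun (IsEquivar.ext (isEquivar_homog (cyc k A L (n + 1) φ)) (isMult_homog _)
      ((isEquivar_homog φ).perm (finRotate (n + 2)).symm) ((isMult_homog φ).perm _) fun w => ?_) v
    rw [homog_cons_one, cyc_hgen]
    congr 1
    funext i
    cases i using Fin.cases with
    | zero => rw [Function.comp_apply, finRotate_symm_zero, Fin.cons_zero, ← Fin.succ_last, Fin.cons_succ]
    | succ i =>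
      rw [Function.comp_apply, finRotate_symm_succ, Fin.cons_succ]
      cases i using Fin.cases with
      | zero => rfl
      | succ i => rfl

theorem cyc_coface_zero (n : ℕ) (φ : C k A L n) :
    cyc k A L (n + 1) (coface k A L n 0 φ) = coface k A L n (Fin.last (n + 1)) φ := by
  refine homog_injective _ (funext fun v => ?_)
  rw [homog_cyc, homog_coface, homog_coface, Function.comp_apply, finRotate_symm_zero]
  congr 2
  funext i
  simp only [Function.comp_apply, Fin.succAbove_zero, finRotate_symm_succ, Fin.succAbove_last]

theorem cyc_coface_succ (n : ℕ) (i : Fin (n + 1)) (φ : C k A L n) :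
    cyc k A L (n + 1) (coface k A L n i.succ φ) = coface k A L n i.castSucc (cyc k A L n φ) := by
  refine homog_injective _ (funext fun v => ?_)
  rw [homog_cyc, homog_coface, homog_coface, homog_cyc, Function.comp_apply, finRotate_symm_succ]
  congr 2
  funext j
  simp only [Function.comp_apply]
  cases j using Fin.cases with
  | zero =>
    rw [Fin.succ_succAbove_zero, finRotate_symm_zero, finRotate_symm_zero,
      Fin.succAbove_castSucc_of_le _ _ (Fin.le_last i), Fin.succ_last]
  | succ j =>
    rw [Fin.succ_succAbove_succ, finRotate_symm_succ, finRotate_symm_succ,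
      Fin.castSucc_succAbove_castSucc]

theorem homog_cyc_pow (n m : ℕ) (φ : C k A L n) (v : Fin (n + 1) → Env k A L) :
    homog ((cyc k A L n ^ m) φ) v = homog φ (v ∘ ((finRotate (n + 1))⁻¹ ^ m : Equiv.Perm _)) := by
  induction m generalizing φ with
  | zero => rfl
  | succ m ih =>
    rw [pow_succ, Module.End.mul_apply, ih, homog_cyc, pow_succ]
    rfl

theorem finRotate_pow (n : ℕ) : finRotate (n + 1) ^ (n + 1) = 1 := by
  cases n with
  | zero => rw [finRotate_one]; rfl
  | succ n =>
    have h := (isCycle_finRotate (n := n)).orderOf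
    rw [support_finRotate, Finset.card_univ, Fintype.card_fin] at h
    have h2 := pow_orderOf_eq_one (finRotate (n + 2))
    rwa [h] at h2

theorem cyc_pow (n : ℕ) : cyc k A L n ^ (n + 1) = 1 := by
  refine LinearMap.ext fun φ => homog_injective _ (funext fun v => ?_)
  rw [homog_cyc_pow, inv_pow, finRotate_pow]
  rfl

end Cyclic

end

end LieRinehart

namespace LieRinehart

noncomputable section

/-! ### The mixed complex (C, b, B). -/

section Mixed

variable {k A L : Type u} [CommRing k] [CommRing A] [Algebra k A] [LieRing L] [LieAlgebra k L]
  [Module A L] [LieRingModule L A] [LieRinehartRing A L] [LieRinehartAlgebra k A L]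

/-- The signed coface operators. -/
def cofaceSgn (n : ℕ) (i : Fin (n + 2)) : C k A L n →ₗ[k] C k A L (n + 1) :=
  (-1 : k) ^ (i : ℕ) • coface k A L n i

theorem cofaceSgn_apply (n : ℕ) (i : Fin (n + 2)) (φ : C k A L n) :
    cofaceSgn n i φ = (-1 : k) ^ (i : ℕ) • coface k A L n i φ := rfl

theorem cycSgn_apply (n : ℕ) (φ : C k A L n) :
    cycSgn k A L n φ = (-1 : k) ^ n • cyc k A L n φ := rfl

theorem hochB_eq (n : ℕ) (φ : C k A L n) : hochB k A L n φ = ∑ i, cofaceSgn n i φ :=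
  LinearMap.sum_apply _ _ _

/-- The Hochschild differential without its last summand. -/
def hochB' (n : ℕ) : C k A L n →ₗ[k] C k A L (n + 1) :=
  ∑ i : Fin (n + 1), cofaceSgn n i.castSucc

theorem hochB'_apply (n : ℕ) (φ : C k A L n) :
    hochB' n φ = ∑ i : Fin (n + 1), cofaceSgn n i.castSucc φ := LinearMap.sum_apply _ _ _

/-- The norm operator. -/
def cycNorm (n : ℕ) : Module.End k (C k A L n) := ∑ j ∈ Finset.range (n + 1), cycSgn k A L n ^ j

/-- The extra codegeneracy. -/
def extraCodegen (n : ℕ) : C k A L (n + 1) →ₗ[k] C k A L n :=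
  codegen k A L n (Fin.last n) ∘ₗ cyc k A L (n + 1)

theorem connesB_apply (n : ℕ) (φ : C k A L (n + 1)) :
    connesB k A L n φ = cycNorm n (extraCodegen n (φ - cycSgn k A L (n + 1) φ)) := rfl

theorem cycSgn_pow (n : ℕ) : cycSgn k A L n ^ (n + 1) = 1 := by
  rw [cycSgn, smul_pow, cyc_pow, ← pow_mul, (Nat.even_mul_succ_self n).neg_one_pow, one_smul]

theorem cycNorm_mul_cycSgn (n : ℕ) : cycNorm n * cycSgn k A L n = cycNorm n := by
  have h := geom_sum_mul (cycSgn k A L n) (n + 1)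
  rw [cycSgn_pow, sub_self, mul_sub, mul_one, sub_eq_zero] at h
  exact h

theorem cycSgn_mul_cycNorm (n : ℕ) : cycSgn k A L n * cycNorm n = cycNorm n := by
  have h := mul_geom_sum (cycSgn k A L n) (n + 1)
  rw [cycSgn_pow, sub_self, sub_mul, one_mul, sub_eq_zero] at h
  exact h

theorem cycNorm_mul_cycSgn_pow (n m : ℕ) : cycNorm n * cycSgn k A L n ^ m = cycNorm n := by
  induction m with
  | zero => rw [pow_zero, mul_one]
  | succ m ih => rw [pow_succ, ← mul_assoc, ih, cycNorm_mul_cycSgn]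

theorem cycSgn_cofaceSgn_zero (n : ℕ) (φ : C k A L n) :
    cycSgn k A L (n + 1) (cofaceSgn n 0 φ) = cofaceSgn n (Fin.last (n + 1)) φ := by
  rw [cycSgn_apply, cofaceSgn_apply, cofaceSgn_apply, Fin.val_zero, pow_zero, one_smul,
    cyc_coface_zero, Fin.val_last]

theorem cycSgn_cofaceSgn_succ (n : ℕ) (i : Fin (n + 1)) (φ : C k A L n) :
    cycSgn k A L (n + 1) (cofaceSgn n i.succ φ) = cofaceSgn n i.castSucc (cycSgn k A L n φ) := by
  simp only [cycSgn_apply, cofaceSgn_apply, map_smul, cyc_coface_succ, smul_smul, Fin.val_succ,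
    Fin.val_castSucc]
  congr 1
  ring

/-- With signs included, λ sends δ_0 to the last coface and turns δ_(i+1) into δ_i λ; so b and λb
differ by b'(1 - λ). -/
theorem hochB_sub_cycSgn (n : ℕ) (φ : C k A L n) :
    hochB k A L n φ - cycSgn k A L (n + 1) (hochB k A L n φ) = hochB' n (φ - cycSgn k A L n φ) := by
  have h1 : hochB k A L n φ = hochB' n φ + cofaceSgn n (Fin.last (n + 1)) φ := by
    rw [hochB_eq, Fin.sum_univ_castSucc, hochB'_apply]
  have h2 : cycSgn k A L (n + 1) (hochB k A L n φ)
      = cofaceSgn n (Fin.last (n + 1)) φ + hochB' n (cycSgn k A L n φ) := by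
    rw [hochB_eq, Fin.sum_univ_succ, map_add, cycSgn_cofaceSgn_zero, map_sum, hochB'_apply]
    simp only [cycSgn_cofaceSgn_succ]
  rw [h2, h1, map_sub]
  abel

theorem cycSgn_pow_cofaceSgn (n : ℕ) (i : Fin (n + 2)) : ∀ φ : C k A L n,
    (cycSgn k A L (n + 1) ^ (i : ℕ)) (cofaceSgn n i φ)
      = cofaceSgn n 0 ((cycSgn k A L n ^ (i : ℕ)) φ) := by
  induction i using Fin.induction with
  | zero => exact fun φ => rfl
  | succ i ih =>
    intro φ
    rw [Fin.val_succ, pow_succ, Module.End.mul_apply, cycSgn_cofaceSgn_succ]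
    refine (ih _).trans ?_
    rw [pow_succ, Module.End.mul_apply, Fin.val_castSucc]

/-- The norm absorbs powers of λ, so each signed δ_i may be replaced by λ^i δ_i = δ_0 λ^i. The
powers that occur, 0 to n, add up to the norm in degree n. -/
theorem cycNorm_hochB' (n : ℕ) (φ : C k A L n) :
    cycNorm (n + 1) (hochB' n φ) = cycNorm (n + 1) (cofaceSgn n 0 (cycNorm n φ)) := by
  rw [hochB'_apply, map_sum, cycNorm, cycNorm, LinearMap.sum_apply (Finset.range (n + 1)), map_sum, map_sum,
    Finset.sum_range (n := n + 1)]
  refine Finset.sum_congr rfl fun i _ => ?_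
  rw [← Fin.val_castSucc i, ← cycSgn_pow_cofaceSgn, ← Module.End.mul_apply]
  exact congrArg (fun f : Module.End k (C k A L (n + 1)) => f (cofaceSgn n i.castSucc φ))
    (cycNorm_mul_cycSgn_pow (n + 1) _).symm

/-- Both sides equal N δ_0 N. -/
theorem hochB_cycNorm (n : ℕ) (φ : C k A L n) :
    hochB k A L n (cycNorm n φ) = cycNorm (n + 1) (hochB' n φ) := by
  rw [cycNorm_hochB', hochB_eq]
  have hN : ∀ m, (cycSgn k A L n ^ m) (cycNorm n φ) = cycNorm n φ := fun m => by
    induction m with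
    | zero => rfl
    | succ m ih =>
      rw [pow_succ, Module.End.mul_apply]
      refine (congrArg _ ?_).trans ih
      exact congrArg (fun f : Module.End k (C k A L n) => f φ) (cycSgn_mul_cycNorm n)
  -- λ has order dividing n + 2 in degree n + 1, so the power n + 2 - i inverts λ^i.
  have h : ∀ i : Fin (n + 2), cofaceSgn n i (cycNorm n φ)
      = (cycSgn k A L (n + 1) ^ (n + 2 - (i : ℕ))) (cofaceSgn n 0 (cycNorm n φ)) := fun i => by
    conv_rhs => rw [← hN i, ← cycSgn_pow_cofaceSgn, ← Module.End.mul_apply, ← pow_add,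
      Nat.sub_add_cancel i.2.le, cycSgn_pow]
    rfl
  rw [Finset.sum_congr (rfl : (Finset.univ : Finset (Fin (n + 2))) = Finset.univ) fun i _ => h i]
  refine Eq.trans (Finset.sum_range fun i : ℕ =>
    (cycSgn k A L (n + 1) ^ (n + 2 - i)) (cofaceSgn n 0 (cycNorm n φ))).symm ?_
  rw [← Finset.sum_range_reflect]
  conv_rhs => rw [← cycSgn_mul_cycNorm]
  generalize cofaceSgn n 0 (cycNorm n φ) = ψ
  rw [Module.End.mul_apply, cycNorm, LinearMap.sum_apply, map_sum]
  refine Finset.sum_congr rfl fun i hi => ?_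
  rw [← Module.End.mul_apply, ← pow_succ']
  have := Finset.mem_range.1 hi
  congr 3
  omega

theorem extraCodegen_cofaceSgn_zero (n : ℕ) (φ : C k A L n) :
    extraCodegen n (cofaceSgn n 0 φ) = φ := by
  rw [extraCodegen, LinearMap.comp_apply, cofaceSgn_apply, Fin.val_zero, pow_zero, one_smul,
    cyc_coface_zero, codegen_coface_last]

theorem extraCodegen_cofaceSgn_succ (n : ℕ) (i : Fin (n + 1)) (φ : C k A L (n + 1)) :
    extraCodegen (n + 1) (cofaceSgn (n + 1) i.castSucc.succ φ)
      = - cofaceSgn n i.castSucc (extraCodegen n φ) := by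
  rw [extraCodegen, LinearMap.comp_apply, cofaceSgn_apply, map_smul, map_smul, cyc_coface_succ,
    codegen_coface_castSucc, cofaceSgn_apply, Fin.val_succ, Fin.val_castSucc, pow_succ,
    mul_neg_one, neg_smul]
  rfl

/-- The extra codegeneracy contracts b': it undoes δ_0 and anticommutes with the other cofaces. -/
theorem extraCodegen_hochB' (n : ℕ) (φ : C k A L (n + 1)) :
    extraCodegen (n + 1) (hochB' (n + 1) φ) = φ - hochB' n (extraCodegen n φ) := by
  rw [hochB'_apply, Fin.sum_univ_succ, map_add, Fin.castSucc_zero, extraCodegen_cofaceSgn_zero,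
    map_sum, hochB'_apply, sub_eq_add_neg, ← Finset.sum_neg_distrib]
  simp only [← Fin.succ_castSucc, extraCodegen_cofaceSgn_succ]

theorem cycNorm_sub_cycSgn (n : ℕ) (φ : C k A L n) : cycNorm n (φ - cycSgn k A L n φ) = 0 := by
  rw [map_sub, sub_eq_zero]
  exact congrArg (fun f : Module.End k (C k A L n) => f φ) (cycNorm_mul_cycSgn n).symm

/-- With s the extra codegeneracy, bB = N b' s (1 - λ) and Bb = N s b' (1 - λ). They add up to N (1
- λ) = 0. -/
theorem hochB_connesB (n : ℕ) (φ : C k A L (n + 1)) :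
    hochB k A L n (connesB k A L n φ) + connesB k A L (n + 1) (hochB k A L (n + 1) φ) = 0 := by
  rw [connesB_apply, connesB_apply, hochB_cycNorm, hochB_sub_cycSgn, extraCodegen_hochB',
    map_sub (cycNorm (n + 1)), add_sub_cancel, cycNorm_sub_cycSgn]

theorem connesB_hochB_zero (φ : C k A L 0) : connesB k A L 0 (hochB k A L 0 φ) = 0 := by
  have h : φ - cycSgn k A L 0 φ = 0 := by
    rw [cycSgn_apply, pow_zero, one_smul]
    exact sub_self φ
  rw [connesB_apply, hochB_sub_cycSgn, h, map_zero, map_zero, map_zero]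

/-- The image of B consists of norms, which are fixed by λ, and B begins with 1 - λ. -/
theorem connesB_connesB (n : ℕ) (φ : C k A L (n + 2)) :
    connesB k A L n (connesB k A L (n + 1) φ) = 0 := by
  have h : connesB k A L (n + 1) φ - cycSgn k A L (n + 1) (connesB k A L (n + 1) φ) = 0 := by
    rw [sub_eq_zero, connesB_apply]
    exact congrArg (fun f : Module.End k (C k A L (n + 1)) => f _) (cycSgn_mul_cycNorm (n + 1)).symm
  rw [connesB_apply, h, map_zero, map_zero]

theorem hochB_hochB (n : ℕ) (φ : C k A L n) : hochB k A L (n + 1) (hochB k A L n φ) = 0 := by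
  refine barCochain_injective _ ?_
  rw [← barComplex_d_comp_barCochain, ← barComplex_d_comp_barCochain, ← Category.assoc,
    HomologicalComplex.d_comp_d, Limits.zero_comp, barCochain_zero]

theorem mixedD_zero (f : ∀ m, C k A L m) : mixedD k A L f 0 = connesB k A L 0 (f 1) := rfl

theorem mixedD_succ (f : ∀ m, C k A L m) (m : ℕ) :
    mixedD k A L f (m + 1) = hochB k A L m (f m) + connesB k A L (m + 1) (f (m + 2)) := rfl

theorem mixedD_mixedD (f : ∀ m, C k A L m) : mixedD k A L (mixedD k A L f) = 0 := by
  funext m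
  cases m with
  | zero =>
    rw [mixedD_zero, mixedD_succ, map_add, connesB_hochB_zero, connesB_connesB, add_zero]
    rfl
  | succ m =>
    rw [mixedD_succ, mixedD_succ, map_add (connesB k A L (m + 1)), connesB_connesB, add_zero]
    cases m with
    | zero => rw [mixedD_zero, hochB_connesB]; rfl
    | succ m => rw [mixedD_succ, map_add, hochB_hochB, zero_add, hochB_connesB]; rfl

end Mixed

end

end LieRinehart

namespace LieRinehart

noncomputable section

/-! ### Alternating sums over permutations. -/

section AltSum

variable {V N N' : Type*} [AddCommGroup N] [AddCommGroup N'] {n : ℕ}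

/-- The sum `∑ sgn(σ) f(v ∘ σ)`. -/
def altSum (f : (Fin n → V) → N) (v : Fin n → V) : N :=
  ∑ σ : Equiv.Perm (Fin n), ((Equiv.Perm.sign σ : ℤˣ) : ℤ) • f (v ∘ σ)

theorem altSum_map (g : N →+ N') (f : (Fin n → V) → N) (v : Fin n → V) :
    altSum (fun v => g (f v)) v = g (altSum f v) := by
  simp only [altSum, map_sum, map_zsmul]

theorem altSum_comp_perm (f : (Fin n → V) → N) (v : Fin n → V) (τ : Equiv.Perm (Fin n)) :
    altSum f (v ∘ τ) = ((Equiv.Perm.sign τ : ℤˣ) : ℤ) • altSum f v := by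
  rw [altSum, altSum, Finset.smul_sum]
  refine Fintype.sum_equiv (Equiv.mulLeft τ) _ _ fun σ => ?_
  rw [Equiv.coe_mulLeft, Equiv.Perm.sign_mul, Units.val_mul, ← mul_smul, ← mul_assoc,
    ← Units.val_mul, Int.units_mul_self, Units.val_one, one_mul]
  rfl

theorem altSum_perm (f : (Fin n → V) → N) (v : Fin n → V) (τ : Equiv.Perm (Fin n)) :
    altSum (fun v => f (v ∘ τ)) v = ((Equiv.Perm.sign τ : ℤˣ) : ℤ) • altSum f v := by
  rw [altSum, altSum, Finset.smul_sum]
  refine Fintype.sum_equiv (Equiv.mulRight τ) _ _ fun σ => ?_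
  rw [Equiv.coe_mulRight, Equiv.Perm.sign_mul, Units.val_mul, ← mul_smul, mul_left_comm,
    ← Units.val_mul (Equiv.Perm.sign τ), Int.units_mul_self, Units.val_one, mul_one]
  rfl

theorem altSum_sum {ι : Type*} (s : Finset ι) (c : ι → ℤ) (f : ι → (Fin n → V) → N)
    (v : Fin n → V) :
    altSum (fun v => ∑ i ∈ s, c i • f i v) v = ∑ i ∈ s, c i • altSum (f i) v := by
  simp only [altSum, Finset.smul_sum]
  rw [Finset.sum_comm]
  exact Finset.sum_congr rfl fun i _ => Finset.sum_congr rfl fun σ _ => smul_comm _ _ _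

/-- Expansion of an alternating sum with respect to the first argument. -/
theorem altSum_cons (F : V → (Fin n → V) → N) (v : Fin (n + 1) → V) :
    altSum (fun v : Fin (n + 1) → V => F (v 0) (v ∘ Fin.succ)) v
      = ∑ p : Fin (n + 1), (-1 : ℤ) ^ (p : ℕ) • altSum (F (v p)) (v ∘ p.succAbove) := by
  rw [altSum, ← Equiv.Perm.decomposeFin.symm.sum_comp, Fintype.sum_prod_type]
  refine Finset.sum_congr rfl fun p _ => ?_
  cases p using Fin.cases with
  | zero =>
    rw [Fin.val_zero, pow_zero, one_smul, altSum]
    refine Finset.sum_congr rfl fun σ _ => ?_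
    rw [Equiv.Perm.decomposeFin.symm_sign, if_pos rfl, one_mul, Function.comp_apply,
      Equiv.Perm.decomposeFin_symm_apply_zero]
    congr 2
  | succ p =>
    -- `decomposeFin` brings entry p to the front by a transposition, while `succAbove` keeps the
    -- order of the others; `cycleRange` is the difference. Its sign and that of the transposition
    -- combine to (-1)^p for the successor index.
    have h : ∀ σ : Equiv.Perm (Fin n),
        (v ∘ Equiv.Perm.decomposeFin.symm (p.succ, σ)) ∘ Fin.succ
          = ((v ∘ p.succ.succAbove) ∘ p.cycleRange) ∘ σ := fun σ => by
      funext i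
      simp [Equiv.Perm.decomposeFin_symm_apply_succ, Fin.succAbove_cycleRange]
    have h2 := altSum_comp_perm (F (v p.succ)) (v ∘ p.succ.succAbove) p.cycleRange
    rw [Fin.sign_cycleRange] at h2
    have h3 : ∀ (x y : N), x = (((-1) ^ (p : ℕ) : ℤˣ) : ℤ) • y →
        (-1 : ℤ) ^ (p.succ : ℕ) • y = - x := fun x y hxy => by
      rw [hxy, Fin.val_succ, pow_succ, mul_neg_one, neg_smul]
      simp
    rw [h3 _ _ h2, altSum, ← Finset.sum_neg_distrib]
    refine Finset.sum_congr rfl fun σ _ => ?_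
    rw [Equiv.Perm.decomposeFin.symm_sign, if_neg (Fin.succ_ne_zero p), Function.comp_apply,
      Equiv.Perm.decomposeFin_symm_apply_zero, h]
    simp

/-- Moving entry p to the front by a cycle of sign (-1)^p shows that all n + 1 omissions contribute
the same alternating sum. -/
theorem altSum_alternating_faces (F : V → (Fin n → V) → N) (v : Fin (n + 1) → V) :
    altSum (fun v : Fin (n + 1) → V =>
        ∑ p : Fin (n + 1), (-1 : ℤ) ^ (p : ℕ) • F (v p) (v ∘ p.succAbove)) v
      = (n + 1) • ∑ p : Fin (n + 1), (-1 : ℤ) ^ (p : ℕ) • altSum (F (v p)) (v ∘ p.succAbove) := by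
  rw [altSum_sum, ← altSum_cons]
  have h : ∀ p : Fin (n + 1), (-1 : ℤ) ^ (p : ℕ) •
      altSum (fun v : Fin (n + 1) → V => F (v p) (v ∘ p.succAbove)) v
        = altSum (fun v : Fin (n + 1) → V => F (v 0) (v ∘ Fin.succ)) v := fun p => by
    have h1 := altSum_perm (fun v : Fin (n + 1) → V => F (v 0) (v ∘ Fin.succ)) v p.cycleRange⁻¹
    have h2 : ∀ v : Fin (n + 1) → V, (v ∘ ⇑(p.cycleRange⁻¹)) 0 = v p := fun v =>
      congrArg v (Fin.cycleRange_symm_zero p)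
    have h3 : ∀ v : Fin (n + 1) → V, (v ∘ ⇑(p.cycleRange⁻¹)) ∘ Fin.succ = v ∘ p.succAbove :=
      fun v => funext fun i => congrArg v (Fin.cycleRange_symm_succ p i)
    simp only [h2, h3] at h1
    rw [h1, Equiv.Perm.sign_inv, Fin.sign_cycleRange, ← mul_smul]
    simp [← pow_add, Even.neg_one_pow ⟨(p : ℕ), rfl⟩]
  simp only [h, Finset.sum_const, Finset.card_univ, Fintype.card_fin]

end AltSum

/-! ### Antisymmetrization of the bar complex and of cochains. -/

section Antisym

variable {k A L : Type u} [CommRing k] [CommRing A] [Algebra k A] [LieRing L] [LieAlgebra k L]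
  [Module A L] [LieRingModule L A] [LieRinehartRing A L] [LieRinehartAlgebra k A L]

section Contraction

theorem T.linear_ext {n : ℕ} {N : Type u} [AddCommGroup N] [Module k N] [Module (Env k A L) N]
    [IsScalarTower k (Env k A L) N] {f g : T k A L (n + 1) →ₗ[Env k A L] N}
    (h : ∀ w, f ((T.unit n).1 w) = g ((T.unit n).1 w)) : f = g := by
  refine LinearMap.ext fun x => ?_
  induction x using T.induction with
  | h D w =>
    have h1 : T.tmul D w = D • (T.unit n).1 w := by
      refine Eq.trans ?_ (T.smul_tmul D 1 w).symm
      rw [mul_one]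
    rw [h1, map_smul, map_smul, h]
  | hadd x y hx hy => rw [map_add, map_add, hx, hy]

/-- An endomorphism of the augmented bar complex which vanishes in degree `0` is homotopic to
zero. -/
theorem exists_homotopy (E : ∀ n, T k A L n →ₗ[Env k A L] T k A L n)
    (hE : ∀ n, barD k A L n ∘ₗ E (n + 1) = E n ∘ₗ barD k A L n) (h1 : E 1 = 0) :
    ∀ n, ∃ (h : T k A L (n + 1) →ₗ[Env k A L] T k A L (n + 2))
      (h' : T k A L n →ₗ[Env k A L] T k A L (n + 1)),
      E (n + 1) = barD k A L (n + 1) ∘ₗ h + h' ∘ₗ barD k A L n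
  | 0 => ⟨0, 0, by rw [h1, LinearMap.comp_zero, LinearMap.zero_comp, add_zero]⟩
  | n + 1 => by
    obtain ⟨h, h', hh⟩ := exists_homotopy E hE h1 n
    -- The defect `G` takes values in the cycles, on which w ↦ 1 ⊗ w inverts the differential.
    let G : T k A L (n + 2) →ₗ[Env k A L] T k A L (n + 2) := E (n + 2) - h ∘ₗ barD k A L (n + 1)
    have hG : ∀ x, barD k A L (n + 1) (G x) = 0 := by
      intro x
      have e1 := LinearMap.congr_fun (hE (n + 1)) x
      have e2 := LinearMap.congr_fun hh (barD k A L (n + 1) x)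
      have e3 : barD k A L n (barD k A L (n + 1) x) = 0 := LinearMap.congr_fun (barD_comp k A L n) x
      simp only [LinearMap.comp_apply, LinearMap.add_apply, e3, map_zero, add_zero] at e1 e2
      change barD k A L (n + 1) (E (n + 2) x - h (barD k A L (n + 1) x)) = 0
      rw [map_sub, e1, e2, sub_self]
    -- The contraction is only A-linear, so it is used on elements 1 ⊗ w alone and extended
    -- 𝒱L-linearly from there.
    let H : T k A L (n + 2) →ₗ[Env k A L] T k A L (n + 3) :=
      Ind.lift (M := T k A L (n + 1)) (HomA.comp (T.unit (n + 2))
        (HomA.comp (HomA.ofLinear G) (T.unit (n + 1))))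
    refine ⟨H, h, T.linear_ext fun w => ?_⟩
    have e : H ((T.unit (n + 1)).1 w) = (T.unit (n + 2)).1 (G ((T.unit (n + 1)).1 w)) :=
      one_smul (Env k A L) ((T.unit (n + 2)).1 (G ((T.unit (n + 1)).1 w)))
    rw [LinearMap.add_apply, LinearMap.comp_apply, e, barD_exact _ _ (hG _)]
    exact (sub_add_cancel _ _).symm

end Contraction

section Cochain

theorem C.lift_unit {n : ℕ} (φ : C k A L n) (w : T k A L n) :
    C.lift φ ((T.unit n).1 w) = φ.1 w := one_smul (Env k A L) (φ.1 w)

theorem C.lift_injective {n : ℕ} {φ ψ : C k A L n} (h : C.lift φ = C.lift ψ) : φ = ψ :=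
  C.ext fun w => by rw [← C.lift_unit, h, C.lift_unit]

/-- The cochain defined by a `𝒱L`-linear map on `T (n + 1)`. -/
def C.ofLinear {n : ℕ} (f : T k A L (n + 1) →ₗ[Env k A L] A) : C k A L n :=
  HomA.comp (HomA.ofLinear f) (T.unit n)

theorem C.lift_ofLinear {n : ℕ} (f : T k A L (n + 1) →ₗ[Env k A L] A) :
    C.lift (C.ofLinear f) = f := T.linear_ext fun w => C.lift_unit _ w

theorem C.lift_hochB {n : ℕ} (φ : C k A L n) :
    C.lift (hochB k A L n φ) = C.lift φ ∘ₗ barD k A L (n + 1) := T.linear_ext fun w => by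
  rw [C.lift_unit, hochB_apply, LinearMap.comp_apply, barD_succ_unit, map_sub, C.lift_unit]
  rfl

theorem C.lift_sub {n : ℕ} (φ ψ : C k A L n) : C.lift (φ - ψ) = C.lift φ - C.lift ψ :=
  T.linear_ext fun w => by
    rw [LinearMap.sub_apply, C.lift_unit, C.lift_unit, C.lift_unit]; rfl

theorem C.lift_zero {n : ℕ} : C.lift (0 : C k A L n) = 0 :=
  T.linear_ext fun w => C.lift_unit _ w

theorem homog_eq_lift {n : ℕ} (φ : C k A L n) (v : Fin (n + 1) → Env k A L) :
    homog φ v = C.lift φ (hgen (n + 1) v) := homog_eq φ v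

end Cochain

variable [Algebra ℚ k]

variable (k) in
/-- The inverse of `n!`. -/
def invFactorial (n : ℕ) : k := algebraMap ℚ k ((n.factorial : ℚ)⁻¹)

theorem invFactorial_succ (n : ℕ) : invFactorial k (n + 1) * ((n + 1 : ℕ) : k) = invFactorial k n := by
  have h : ((n + 1 : ℕ) : k) = algebraMap ℚ k ((n + 1 : ℕ) : ℚ) := (map_natCast _ _).symm
  rw [invFactorial, invFactorial, h, ← map_mul]
  congr 1
  rw [Nat.factorial_succ, Nat.cast_mul, mul_inv_rev, mul_assoc, inv_mul_cancel₀, mul_one]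
  exact_mod_cast Nat.succ_ne_zero n

theorem exists_antisym (n : ℕ) : ∃ F : T k A L n →ₗ[Env k A L] T k A L n, ∀ v,
    F (hgen n v) = invFactorial k n • altSum (hgen n) v := by
  have h : ∀ v : Fin n → Env k A L, altSum (hgen n) v
      = ∑ σ : Equiv.Perm (Fin n), (((Equiv.Perm.sign σ : ℤˣ) : ℤ) : k) • hgen n (v ∘ σ) :=
    fun v => by simp only [Int.cast_smul_eq_zsmul]; rfl
  simp only [h]
  exact T.exists_linear _
    ((IsMult.sum _ fun σ => ((isMult_hgen n).perm σ).ksmul _).ksmul _)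
    ((IsEquivar.sum _ fun σ => ((isEquivar_hgen n).perm σ).ksmul _).ksmul _)

/-- The antisymmetrization of the homogeneous generators. -/
def antisym (n : ℕ) : T k A L n →ₗ[Env k A L] T k A L n := (exists_antisym n).choose

theorem antisym_hgen (n : ℕ) (v : Fin n → Env k A L) :
    antisym n (hgen n v) = invFactorial k n • altSum (hgen n) v := (exists_antisym n).choose_spec v

theorem barD_hgen (n : ℕ) (v : Fin (n + 1) → Env k A L) : barD k A L n (hgen (n + 1) v)
    = ∑ p : Fin (n + 1), (-1 : ℤ) ^ (p : ℕ) •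
      Env.iA k A L (v p • (1 : A)) • hgen n (v ∘ p.succAbove) := by
  rw [barD_eq_sum, LinearMap.sum_apply]
  exact Finset.sum_congr rfl fun p _ => congrArg _ (face_hgen n p v)

/-- Alternating over n + 1 letters gives n + 1 equal contributions, which turn 1/(n + 1)! into 1/n!.
This is where the averaging factors are needed for a chain map. -/
theorem barD_antisym (n : ℕ) :
    barD k A L n ∘ₗ antisym (n + 1) = antisym n ∘ₗ barD k A L n := by
  have h : HomA.ofLinear (barD k A L n ∘ₗ antisym (n + 1))
      = HomA.ofLinear (antisym n ∘ₗ barD k A L n) := T.hom_ext fun v => by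
    change barD k A L n (antisym (n + 1) (hgen (n + 1) v)) = antisym n (barD k A L n (hgen (n + 1) v))
    have h1 := altSum_map (barD k A L n).toAddMonoidHom (hgen (n + 1)) v
    have h2 := altSum_alternating_faces
      (fun (D : Env k A L) w => Env.iA k A L (D • (1 : A)) • hgen n w) v
    have h3 : ∀ p, altSum (fun w => Env.iA k A L (v p • (1 : A)) • hgen n w) (v ∘ p.succAbove)
        = Env.iA k A L (v p • (1 : A)) • altSum (hgen n) (v ∘ p.succAbove) := fun p =>
      altSum_map (DistribSMul.toAddMonoidHom (T k A L n) (Env.iA k A L (v p • (1 : A))))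
        (hgen n) (v ∘ p.succAbove)
    have h4 : barD k A L n (altSum (hgen (n + 1)) v) = (n + 1) • ∑ p : Fin (n + 1),
        (-1 : ℤ) ^ (p : ℕ) • Env.iA k A L (v p • (1 : A)) • altSum (hgen n) (v ∘ p.succAbove) := by
      refine h1.symm.trans (Eq.trans ?_ (h2.trans ?_))
      · exact congrArg (fun f => altSum f v) (funext fun w => barD_hgen n w)
      · simp only [h3]
    have h5 : barD k A L n (invFactorial k (n + 1) • altSum (hgen (n + 1)) v)
        = invFactorial k (n + 1) • barD k A L n (altSum (hgen (n + 1)) v) :=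
      (HomA.ofLinear (barD k A L n)).1.map_smul _ _
    rw [antisym_hgen, h5, h4, barD_hgen, map_sum, ← Nat.cast_smul_eq_nsmul k, smul_smul,
      invFactorial_succ, Finset.smul_sum]
    refine Finset.sum_congr rfl fun p _ => ?_
    rw [map_zsmul, LinearMap.map_smul, antisym_hgen, env_smul_smul, smul_comm]
  exact LinearMap.ext fun x => congrArg (fun f => f.1 x) h

theorem antisym_one : antisym (k := k) (A := A) (L := L) 1 = LinearMap.id := by
  have h : HomA.ofLinear (antisym (k := k) (A := A) (L := L) 1) = HomA.ofLinear LinearMap.id :=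
    T.hom_ext fun v => by
      refine (antisym_hgen 1 v).trans ?_
      rw [invFactorial, Nat.factorial_one, Nat.cast_one, inv_one, map_one, one_smul, altSum,
        Fintype.sum_unique]
      have : (default : Equiv.Perm (Fin 1)) = 1 := rfl
      rw [this, Equiv.Perm.sign_one, Units.val_one, one_smul]
      rfl
  exact LinearMap.ext fun x => congrArg (fun f => f.1 x) h

/-- The antisymmetrization of cochains. -/
def antisymC (n : ℕ) : Module.End k (C k A L n) :=
  HomA.precomp A (HomA.comp (HomA.ofLinear (antisym (n + 1))) (T.unit n)) ∘ₗ Ind.liftHom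

theorem C.lift_antisymC {n : ℕ} (φ : C k A L n) :
    C.lift (antisymC n φ) = C.lift φ ∘ₗ antisym (n + 1) := C.lift_ofLinear (C.lift φ ∘ₗ antisym (n + 1))

theorem homog_antisymC {n : ℕ} (φ : C k A L n) (v : Fin (n + 1) → Env k A L) :
    homog (antisymC n φ) v = invFactorial k (n + 1) • altSum (homog φ) v := by
  rw [homog_eq_lift, C.lift_antisymC, LinearMap.comp_apply, antisym_hgen]
  refine ((HomA.ofLinear (C.lift φ)).1.map_smul _ _).trans (congrArg _ ?_)
  refine (altSum_map (C.lift φ).toAddMonoidHom (hgen (n + 1)) v).symm.trans ?_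
  exact congrArg (fun f => altSum f v) (funext fun w => (homog_eq_lift φ w).symm)

/-- The rotation of n + 1 letters has sign (-1)^n, which cancels the sign in λ. -/
theorem cycSgn_antisymC (n : ℕ) (φ : C k A L n) :
    cycSgn k A L n (antisymC n φ) = antisymC n φ := by
  refine homog_injective _ (funext fun v => ?_)
  rw [cycSgn_apply, homog_smul, homog_cyc, homog_antisymC, homog_antisymC, altSum_comp_perm,
    Equiv.Perm.sign_symm, sign_finRotate, Nat.add_sub_cancel, smul_comm _ (invFactorial k (n + 1)),
    ← Int.cast_smul_eq_zsmul k, smul_smul ((-1) ^ n)]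
  simp [← pow_add, Even.neg_one_pow ⟨n, rfl⟩]

theorem connesB_antisymC (n : ℕ) (φ : C k A L (n + 1)) :
    connesB k A L n (antisymC (n + 1) φ) = 0 := by
  rw [connesB_apply, cycSgn_antisymC, sub_self, map_zero, map_zero]

theorem hochB_antisymC (n : ℕ) (φ : C k A L n) :
    hochB k A L n (antisymC n φ) = antisymC (n + 1) (hochB k A L n φ) := C.lift_injective (by
  rw [C.lift_hochB, C.lift_antisymC, C.lift_antisymC, C.lift_hochB, LinearMap.comp_assoc,
    LinearMap.comp_assoc, barD_antisym])

/-- Antisymmetrization minus the identity has the form ∂h + h'∂. Composition with a cocycle kills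
the first term and makes the second the coboundary of the cochain defined by h'. In degree 0 the
difference is zero. -/
theorem antisymC_sub_mem (n : ℕ) (φ : C k A L n) (hφ : φ ∈ hochZ k A L n) :
    antisymC n φ - φ ∈ hochBdry k A L n := by
  have hlift : C.lift (antisymC n φ - φ) = C.lift φ ∘ₗ (antisym (n + 1) - LinearMap.id) := by
    rw [C.lift_sub, C.lift_antisymC, LinearMap.comp_sub, LinearMap.comp_id]
  have hb : C.lift φ ∘ₗ barD k A L (n + 1) = 0 := by
    rw [← C.lift_hochB, LinearMap.mem_ker.1 hφ, C.lift_zero]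
  cases n with
  | zero =>
    rw [antisym_one, sub_self, LinearMap.comp_zero, ← C.lift_zero] at hlift
    rw [C.lift_injective hlift]
    exact Submodule.zero_mem _
  | succ n =>
    obtain ⟨h, h', hh⟩ := exists_homotopy (fun n => antisym (k := k) (A := A) (L := L) n - LinearMap.id)
      (fun n => by rw [LinearMap.comp_sub, LinearMap.sub_comp, barD_antisym]; rfl)
      (by rw [antisym_one, sub_self]) (n + 1)
    refine ⟨C.ofLinear (C.lift φ ∘ₗ h'), C.lift_injective ?_⟩
    rw [C.lift_hochB, C.lift_ofLinear, hlift, hh, LinearMap.comp_add, ← LinearMap.comp_assoc, hb,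
      LinearMap.zero_comp, zero_add, LinearMap.comp_assoc]

end Antisym

end

end LieRinehart

namespace LieRinehart

noncomputable section

/-! ### Splitting of the periodicity sequence. -/

section Periodicity

variable {k A L : Type u} [CommRing k] [CommRing A] [Algebra k A] [LieRing L] [LieAlgebra k L]
  [Module A L] [LieRingModule L A] [LieRinehartRing A L] [LieRinehartAlgebra k A L]

theorem single_mem_Tot (n : ℕ) (φ : C k A L n) : Pi.single n φ ∈ Tot k A L n := fun m hm =>
  Pi.single_eq_of_ne (fun h => hm ⟨h.le, by subst h; exact ⟨m, rfl⟩⟩) φ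

theorem mem_Tot_of_top_eq_zero {n : ℕ} {f : ∀ m, C k A L m} (hf : f ∈ Tot k A L (n + 2))
    (h : f (n + 2) = 0) : f ∈ Tot k A L n := fun m hm => by
  by_cases h1 : m = n + 2
  · rw [h1, h]
  · refine hf m fun h2 => hm ?_
    rw [Nat.even_iff] at h2 ⊢
    omega

theorem eq_zero_of_mem_Tot {n : ℕ} (hn : n < 2) {f : ∀ m, C k A L m} (hf : f ∈ Tot k A L n)
    (h : f n = 0) : f = 0 := funext fun m => by
  by_cases h1 : m = n
  · rw [h1, h]; rfl
  · refine hf m fun h2 => ?_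
    rw [Nat.even_iff] at h2
    omega

theorem mixedD_mem_Tot {n : ℕ} {f : ∀ m, C k A L m} (hf : f ∈ Tot k A L n) :
    mixedD k A L f ∈ Tot k A L (n + 1) := fun m hm => by
  rw [Nat.even_iff] at hm
  cases m with
  | zero =>
    rw [mixedD_zero, hf 1 (by rw [Nat.even_iff]; omega), map_zero]
  | succ m =>
    rw [mixedD_succ, hf m (by rw [Nat.even_iff]; omega), hf (m + 2) (by rw [Nat.even_iff]; omega),
      map_zero, map_zero, add_zero]

theorem mixedD_top {n : ℕ} {f : ∀ m, C k A L m} (hf : f ∈ Tot k A L n) :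
    mixedD k A L f (n + 1) = hochB k A L n (f n) := by
  rw [mixedD_succ, hf (n + 2) (by omega), map_zero, add_zero]

theorem mixedD_single_top (n : ℕ) (φ : C k A L n) :
    mixedD k A L (Pi.single n φ) (n + 1) = hochB k A L n φ := by
  rw [mixedD_top (single_mem_Tot n φ), Pi.single_eq_same]

/-- On antisymmetric cochains b + B reduces to b. -/
theorem mixedD_single_antisymC [Algebra ℚ k] (n : ℕ) (φ : C k A L n) :
    mixedD k A L (Pi.single n (antisymC n φ)) = Pi.single (n + 1) (hochB k A L n (antisymC n φ)) := by
  have hB : ∀ m, connesB k A L m ((Pi.single n (antisymC n φ) : ∀ m, C k A L m) (m + 1)) = 0 :=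
    fun m => by
      by_cases h : m + 1 = n
      · subst h
        rw [Pi.single_eq_same, connesB_antisymC]
      · rw [Pi.single_eq_of_ne h, map_zero]
  funext m
  cases m with
  | zero => rw [mixedD_zero, hB, Pi.single_eq_of_ne (Nat.succ_ne_zero n).symm]
  | succ m =>
    rw [mixedD_succ, hB, add_zero]
    by_cases h : m = n
    · subst h
      rw [Pi.single_eq_same, Pi.single_eq_same]
    · rw [Pi.single_eq_of_ne h, map_zero, Pi.single_eq_of_ne (fun h' => h (Nat.succ.inj h'))]

theorem mixedD_single_mem_cycBdry (n : ℕ) (φ : C k A L n) :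
    mixedD k A L (Pi.single n φ) ∈ cycBdry k A L (n + 1) := ⟨_, single_mem_Tot n φ, rfl⟩

theorem mapI_mapS (n : ℕ) (x : HC k A L n) : mapI k A L (n + 2) (mapS k A L n x) = 0 := by
  obtain ⟨f, rfl⟩ := Submodule.mkQ_surjective _ x
  refine (Submodule.Quotient.mk_eq_zero _).2 ?_
  change f.1 (n + 2) ∈ hochBdry k A L (n + 2)
  rw [f.2.1 (n + 2) (by omega)]
  exact Submodule.zero_mem _

theorem apply_mem_hochBdry_of_mapI_eq_zero {n : ℕ} (f : cycZ k A L n)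
    (hf : mapI k A L n (Submodule.Quotient.mk f) = 0) : f.1 n ∈ hochBdry k A L n := by
  have h : (Submodule.Quotient.mk (⟨f.1 n, apply_mem_hochZ k A L n f.1 f.2⟩ : hochZ k A L n) :
    HH k A L n) = 0 := hf
  exact (Submodule.Quotient.mk_eq_zero ((hochBdry k A L n).submoduleOf (hochZ k A L n))).1 h

theorem eq_zero_of_mapI_eq_zero {n : ℕ} (hn : n < 2) {x : HC k A L n} (hx : mapI k A L n x = 0) :
    x = 0 := by
  obtain ⟨f, rfl⟩ := Submodule.mkQ_surjective _ x
  have h := apply_mem_hochBdry_of_mapI_eq_zero f hx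
  refine (Submodule.Quotient.mk_eq_zero _).2 ?_
  change f.1 ∈ cycBdry k A L n
  cases n with
  | zero =>
    rw [eq_zero_of_mem_Tot hn f.2.1 h]
    exact Submodule.zero_mem _
  | succ n =>
    obtain ⟨u, hu⟩ := h
    have h0 : f.1 - mixedD k A L (Pi.single n u) = 0 :=
      eq_zero_of_mem_Tot hn (Submodule.sub_mem _ f.2.1 (mixedD_mem_Tot (single_mem_Tot n u)))
        (by rw [Pi.sub_apply, mixedD_single_top, hu, sub_self])
    rw [sub_eq_zero.1 h0]
    exact mixedD_single_mem_cycBdry n u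

/-- If the top component is b u, subtracting (b + B)u leaves a cohomologous cocycle without top
component, that is, one from Tot^n. -/
theorem exists_mapS_eq {n : ℕ} {x : HC k A L (n + 2)} (hx : mapI k A L (n + 2) x = 0) :
    ∃ y, mapS k A L n y = x := by
  obtain ⟨f, rfl⟩ := Submodule.mkQ_surjective _ x
  obtain ⟨u, hu⟩ := apply_mem_hochBdry_of_mapI_eq_zero f hx
  have h1 : f.1 - mixedD k A L (Pi.single (n + 1) u) ∈ Tot k A L n :=
    mem_Tot_of_top_eq_zero
      (Submodule.sub_mem _ f.2.1 (mixedD_mem_Tot (single_mem_Tot (n + 1) u)))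
      (by rw [Pi.sub_apply, mixedD_single_top, hu, sub_self])
  have h2 : mixedD k A L (f.1 - mixedD k A L (Pi.single (n + 1) u)) = 0 := by
    rw [map_sub, mixedD_mixedD, sub_zero]
    exact f.2.2
  refine ⟨Submodule.Quotient.mk ⟨_, h1, h2⟩, (Submodule.Quotient.eq _).2 ?_⟩
  change f.1 - mixedD k A L (Pi.single (n + 1) u) - f.1 ∈ cycBdry k A L (n + 2)
  rw [sub_sub_cancel_left]
  exact Submodule.neg_mem _ (mixedD_single_mem_cycBdry (n + 1) u)

variable [Algebra ℚ k]

/-- If f in Tot^n is the coboundary of g in Tot^(n+1), the top component of g is a b-cocycle. It is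
cohomologous to an antisymmetric cocycle, which is closed for b + B and can be discarded; the
corrected g lies in Tot^(n-1). -/
theorem mapS_injective (n : ℕ) : Function.Injective (mapS k A L n) := by
  rw [← LinearMap.ker_eq_bot, Submodule.eq_bot_iff]
  intro x hx
  obtain ⟨f, rfl⟩ := Submodule.mkQ_surjective _ x
  obtain ⟨g, hg, hgf⟩ : f.1 ∈ cycBdry k A L (n + 2) := (Submodule.Quotient.mk_eq_zero
    ((cycBdry k A L (n + 2)).submoduleOf (cycZ k A L (n + 2)))
    (x := Submodule.inclusion (inf_le_inf_right _ (Tot_le k A L n)) f)).1 hx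
  refine (Submodule.Quotient.mk_eq_zero _).2 ?_
  change f.1 ∈ cycBdry k A L n
  have hgZ : g (n + 1) ∈ hochZ k A L (n + 1) := by
    rw [hochZ, LinearMap.mem_ker, ← mixedD_top hg, hgf, f.2.1 (n + 2) (by omega)]
  obtain ⟨u, hu⟩ := antisymC_sub_mem (n + 1) (g (n + 1)) hgZ
  -- Both corrections are closed for b + B, and they are chosen so that the top component cancels.
  let g' := g - Pi.single (n + 1) (antisymC (n + 1) (g (n + 1))) + mixedD k A L (Pi.single n u)
  have hg' : g' ∈ Tot k A L (n + 1) := Submodule.add_mem _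
    (Submodule.sub_mem _ hg (single_mem_Tot _ _)) (mixedD_mem_Tot (single_mem_Tot n u))
  have htop : g' (n + 1) = 0 := by
    change g (n + 1) - (Pi.single (n + 1) (antisymC (n + 1) (g (n + 1))) : ∀ m, C k A L m) (n + 1)
      + mixedD k A L (Pi.single n u) (n + 1) = 0
    rw [Pi.single_eq_same, mixedD_single_top, hu]
    abel
  have hD : mixedD k A L g' = f.1 := by
    rw [map_add, map_sub, mixedD_mixedD, mixedD_single_antisymC, hochB_antisymC,
      LinearMap.mem_ker.1 hgZ, map_zero, Pi.single_zero, sub_zero, add_zero, hgf]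
  cases n with
  | zero =>
    rw [← hD, eq_zero_of_mem_Tot (by omega) hg' htop, map_zero]
    exact Submodule.zero_mem _
  | succ n => exact ⟨g', mem_Tot_of_top_eq_zero hg' htop, hD⟩

/-- The section of `I : HC^n → HH^n` defined by the antisymmetrization of cocycles. -/
def sectionI (n : ℕ) : HH k A L n →ₗ[k] HC k A L n :=
  Submodule.mapQ _ _
    ((LinearMap.single k (C k A L) n ∘ₗ antisymC n ∘ₗ (hochZ k A L n).subtype).codRestrict
      (cycZ k A L n) (fun φ => ⟨single_mem_Tot _ _, by
        have h : hochB k A L n φ.1 = 0 := φ.2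
        change mixedD k A L (Pi.single n (antisymC n φ.1)) = 0
        rw [mixedD_single_antisymC, hochB_antisymC, h, map_zero, Pi.single_zero]⟩)) (by
    rintro ⟨φ, hφ⟩ hφ'
    change Pi.single n (antisymC n φ) ∈ cycBdry k A L n
    change φ ∈ hochBdry k A L n at hφ'
    cases n with
    | zero =>
      obtain rfl : φ = 0 := hφ'
      rw [map_zero, Pi.single_zero]
      exact Submodule.zero_mem _
    | succ n =>
      obtain ⟨ψ, rfl⟩ := hφ'
      rw [← hochB_antisymC, ← mixedD_single_antisymC]
      exact mixedD_single_mem_cycBdry n _)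

theorem mapI_sectionI (n : ℕ) (y : HH k A L n) : mapI k A L n (sectionI n y) = y := by
  obtain ⟨φ, rfl⟩ := Submodule.mkQ_surjective _ y
  refine (Submodule.Quotient.eq _).2 ?_
  change (Pi.single n (antisymC n φ.1) : ∀ m, C k A L m) n - φ.1 ∈ hochBdry k A L n
  rw [Pi.single_eq_same]
  exact antisymC_sub_mem n φ.1 φ.2

/-- Removing the part of a class that comes from the section leaves a class in the kernel of I,
which is the image of the injective map S. -/
theorem exists_retraction (n : ℕ) : ∃ R : HC k A L (n + 2) →ₗ[k] HC k A L n,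
    ∀ x, mapS k A L n (R x) = x - sectionI (n + 2) (mapI k A L (n + 2) x) := by
  let e := LinearEquiv.ofInjective (mapS k A L n) (mapS_injective n)
  let g : HC k A L (n + 2) →ₗ[k] LinearMap.range (mapS k A L n) :=
    (LinearMap.id - sectionI (n + 2) ∘ₗ mapI k A L (n + 2)).codRestrict _ fun x =>
      exists_mapS_eq (by
        change mapI k A L (n + 2) (x - sectionI (n + 2) (mapI k A L (n + 2) x)) = 0
        rw [map_sub, mapI_sectionI, sub_self])
  refine ⟨e.symm.toLinearMap ∘ₗ g, fun x => ?_⟩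
  exact congrArg Subtype.val (e.apply_symm_apply (g x))

/-- The retraction of the periodicity operator which vanishes on the image of the section. -/
def retractS (n : ℕ) : HC k A L (n + 2) →ₗ[k] HC k A L n := (exists_retraction n).choose

theorem mapS_retractS (n : ℕ) (x : HC k A L (n + 2)) :
    mapS k A L n (retractS n x) = x - sectionI (n + 2) (mapI k A L (n + 2) x) :=
  (exists_retraction n).choose_spec x

theorem retractS_mapS (n : ℕ) (x : HC k A L n) : retractS n (mapS k A L n x) = x :=
  mapS_injective n (by rw [mapS_retractS, mapI_mapS, map_zero, sub_zero])

theorem retractS_sectionI (n : ℕ) (y : HH k A L (n + 2)) : retractS n (sectionI (n + 2) y) = 0 :=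
  mapS_injective n (by rw [mapS_retractS, mapI_sectionI, sub_self, map_zero])

/-- The components of a cyclic cohomology class. -/
def hcComp : ∀ i n m : ℕ, 2 * i + m = n → (HC k A L n →ₗ[k] HH k A L m)
  | 0, n, m, h => by
    obtain rfl : m = n := by omega
    exact mapI k A L m
  | i + 1, n + 2, m, h => hcComp i n m (by omega) ∘ₗ retractS n
  | i + 1, 0, m, h => absurd h (by omega)
  | i + 1, 1, m, h => absurd h (by omega)

theorem hcComp_zero (n : ℕ) (h : 2 * 0 + n = n) : hcComp (k := k) (A := A) (L := L) 0 n n h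
    = mapI k A L n := by
  rw [hcComp]

theorem hcComp_succ (i n m : ℕ) (h : 2 * i + m = n) (h' : 2 * (i + 1) + m = n + 2) :
    hcComp (k := k) (A := A) (L := L) (i + 1) (n + 2) m h' = hcComp i n m h ∘ₗ retractS n := by
  rw [hcComp]

variable (k A L) in
/-- The decomposition of the cyclic cohomology. -/
def hcPi (n : ℕ) : HC k A L n →ₗ[k] ∀ i : {i : ℕ × ℕ // 2 * i.1 + i.2 = n}, HH k A L i.1.2 :=
  LinearMap.pi fun i => hcComp i.1.1 n i.1.2 i.2

theorem hcPi_apply (n i m : ℕ) (h : 2 * i + m = n) (x : HC k A L n) :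
    hcPi k A L n x ⟨(i, m), h⟩ = hcComp i n m h x := rfl

theorem hcPi_zero (n : ℕ) (h : 2 * 0 + n = n) (x : HC k A L n) :
    hcPi k A L n x ⟨(0, n), h⟩ = mapI k A L n x := by
  rw [hcPi_apply, hcComp_zero]

theorem hcPi_mapS (n i m : ℕ) (h : 2 * i + m = n) (h' : 2 * (i + 1) + m = n + 2)
    (x : HC k A L n) :
    hcPi k A L (n + 2) (mapS k A L n x) ⟨(i + 1, m), h'⟩ = hcPi k A L n x ⟨(i, m), h⟩ := by
  rw [hcPi_apply, hcComp_succ i n m h, LinearMap.comp_apply, retractS_mapS]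
  rfl

/-- Induction by steps of two: the component of index 0 vanishes, so the class is S of its
retraction, whose components are the remaining ones. In degrees 0 and 1 the map I alone is
injective. -/
theorem hcPi_injective (n : ℕ) : Function.Injective (hcPi k A L n) := by
  rw [← LinearMap.ker_eq_bot, Submodule.eq_bot_iff]
  induction n using Nat.twoStepInduction with
  | zero =>
    exact fun x hx => eq_zero_of_mapI_eq_zero (by omega)
      ((hcPi_zero 0 rfl x).symm.trans (congrFun hx _))
  | one =>
    exact fun x hx => eq_zero_of_mapI_eq_zero (by omega)
      ((hcPi_zero 1 rfl x).symm.trans (congrFun hx _))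
  | more n ih _ =>
    intro x hx
    have h0 : mapI k A L (n + 2) x = 0 :=
      (hcPi_zero (n + 2) (by omega) x).symm.trans (congrFun hx _)
    have h1 : retractS n x = 0 := ih _ (funext fun ⟨⟨i, m⟩, h⟩ => by
      have h2 := congrFun hx ⟨(i + 1, m), show 2 * (i + 1) + m = n + 2 by
        have h3 : 2 * i + m = n := h
        omega⟩
      rw [hcPi_apply, hcComp_succ i n m h] at h2
      exact h2)
    have h2 := mapS_retractS n x
    rw [h1, h0, map_zero, map_zero, sub_zero] at h2
    exact h2.symm

theorem hcPi_sectionI_of_lt {n : ℕ} (hn : n < 2)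
    (y : ∀ i : {i : ℕ × ℕ // 2 * i.1 + i.2 = n}, HH k A L i.1.2) :
    hcPi k A L n (sectionI n (y ⟨(0, n), by omega⟩)) = y := funext fun ⟨⟨i, m⟩, h⟩ => by
  have h1 : 2 * i + m = n := h
  obtain rfl : i = 0 := by omega
  obtain rfl : m = n := by omega
  rw [hcPi_zero, mapI_sectionI]

theorem hcPi_surjective (n : ℕ) : Function.Surjective (hcPi k A L n) := by
  induction n using Nat.twoStepInduction with
  | zero => exact fun y => ⟨_, hcPi_sectionI_of_lt (by omega) y⟩
  | one => exact fun y => ⟨_, hcPi_sectionI_of_lt (by omega) y⟩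
  | more n ih _ =>
    intro y
    obtain ⟨x', hx'⟩ := ih fun i => y ⟨(i.1.1 + 1, i.1.2), by
      have := i.2
      change 2 * (i.1.1 + 1) + i.1.2 = n + 2
      omega⟩
    refine ⟨sectionI (n + 2) (y ⟨(0, n + 2), by omega⟩) + mapS k A L n x',
      funext fun ⟨⟨i, m⟩, h⟩ => ?_⟩
    have h1 : 2 * i + m = n + 2 := h
    rw [map_add, Pi.add_apply]
    cases i with
    | zero =>
      obtain rfl : m = n + 2 := by omega
      rw [hcPi_zero, hcPi_zero, mapI_sectionI, mapI_mapS, add_zero]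
    | succ i =>
      rw [hcPi_mapS n i m (by omega), hx', hcPi_apply, hcComp_succ i n m (by omega),
        LinearMap.comp_apply, retractS_sectionI, map_zero, zero_add]

end Periodicity

end

end LieRinehart

namespace LieRinehart

noncomputable section

/-! ### The decomposition of cyclic cohomology. -/

section CyclicCohomology

variable {k A L : Type u} [CommRing k] [CommRing A] [Algebra k A] [LieRing L] [LieAlgebra k L]
  [Module A L] [LieRingModule L A] [LieRinehartRing A L] [LieRinehartAlgebra k A L]

/-- Pairs (i, m) with 2i + m = n index the summands without subtraction of natural numbers;
finiteness turns the product of components into the direct sum. -/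
instance finite_degreePairs (n : ℕ) : Finite {i : ℕ × ℕ // 2 * i.1 + i.2 = n} :=
  ((Set.finite_Iic (n, n)).subset fun i (h : 2 * i.1 + i.2 = n) =>
    Prod.mk_le_mk.2 ⟨by omega, by omega⟩).to_subtype

variable [Algebra ℚ k] (hP : ∀ n, Projective ((barComplex k A L).X n))
  (hQ : QuasiIso (barAug k A L))

/-- Cyclic cohomology is the direct sum of the even shifts of Lie–Rinehart cohomology. -/
def hcEquiv (n : ℕ) : HC k A L n ≃ₗ[k]
    ⨁ i : {i : ℕ × ℕ // 2 * i.1 + i.2 = n}, LRCohomology k A L i.1.2 :=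
  haveI := Fintype.ofFinite {i : ℕ × ℕ // 2 * i.1 + i.2 = n}
  ((LinearEquiv.ofBijective (hcPi k A L n) ⟨hcPi_injective n, hcPi_surjective n⟩).trans
    (LinearEquiv.piCongrRight fun i => hochEquivLR hP hQ i.1.2)).trans
    (DirectSum.linearEquivFunOnFintype k {i : ℕ × ℕ // 2 * i.1 + i.2 = n}
      fun i => LRCohomology k A L i.1.2).symm

theorem hcEquiv_apply (n : ℕ) (x : HC k A L n) (i : {i : ℕ × ℕ // 2 * i.1 + i.2 = n}) :
    hcEquiv hP hQ n x i = hochEquivLR hP hQ i.1.2 (hcPi k A L n x i) :=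
  haveI := Fintype.ofFinite {i : ℕ × ℕ // 2 * i.1 + i.2 = n}
  congrFun ((DirectSum.linearEquivFunOnFintype k {i : ℕ × ℕ // 2 * i.1 + i.2 = n}
    fun i => LRCohomology k A L i.1.2).apply_symm_apply
      fun i => hochEquivLR hP hQ i.1.2 (hcPi k A L n x i)) i

end CyclicCohomology

end

end LieRinehart

theorem mainTheorem10 (k A L : Type u) [CommRing k] [Algebra ℚ k] [CommRing A] [Algebra k A]
    [LieRing L] [LieAlgebra k L] [Module A L] [LieRingModule L A] [LieRinehartRing A L]
    [LieRinehartAlgebra k A L] [Module.Finite A L] [Module.Projective A L]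
    (hrank : ∃ r : ℕ, ∀ p : PrimeSpectrum A, Module.rankAtStalk L p = r) :
    -- the cochain spaces are the completed tensor powers of the jet space
    (∀ n : ℕ, ∃ e : LieRinehart.completedTensor k A L n ≃ₗ[k] LieRinehart.C k A L (n + 1),
      ∀ (x : LieRinehart.completedTensor k A L n) (p : ℕ)
        (y : LieRinehart.Jet k A L ⊗[k] LieRinehart.C k A L n),
        x.1 p = (LieRinehart.tensorFil k A L n p).mkQ y →
          e x - LieRinehart.pair k A L n y ∈ LieRinehart.cochFil k A L (n + 1) p) ∧
    -- the bar complex is a projective resolution of `A`, and it induces the isomorphisms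
    ∃ (hP : ∀ n : ℕ, Projective ((LieRinehart.barComplex k A L).X n))
      (hQ : QuasiIso (LieRinehart.barAug k A L))
      (hh : ∀ n : ℕ, LieRinehart.HH k A L n ≃ₗ[k] LieRinehart.LRCohomology k A L n)
      (hc : ∀ n : ℕ, LieRinehart.HC k A L n ≃ₗ[k]
        ⨁ i : {i : ℕ × ℕ // 2 * i.1 + i.2 = n}, LieRinehart.LRCohomology k A L i.1.2),
      (∀ (n : ℕ) (φ : LieRinehart.hochZ k A L n),
        ∃ h : (LieRinehart.barRes k A L hP hQ).complex.d (n + 1) n ≫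
            LieRinehart.barCochain φ.1 = 0,
          hh n (Submodule.Quotient.mk φ)
            = (LieRinehart.barRes k A L hP hQ).extMk (LieRinehart.barCochain φ.1) (n + 1) rfl h) ∧
      (∀ (n : ℕ) (x : LieRinehart.HC k A L n) (h : 2 * 0 + n = n),
        hc n x ⟨(0, n), h⟩ = hh n (LieRinehart.mapI k A L n x)) ∧
      (∀ (n i m : ℕ) (x : LieRinehart.HC k A L n) (h : 2 * i + m = n)
        (h' : 2 * (i + 1) + m = n + 2),
        hc (n + 2) (LieRinehart.mapS k A L n x) ⟨(i + 1, m), h'⟩ = hc n x ⟨(i, m), h⟩) := by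
  have hP := fun n => LieRinehart.projective_barComplex_X (k := k) (A := A) (L := L) n
  have hQ := LieRinehart.quasiIso_barAug (k := k) (A := A) (L := L)
  refine ⟨fun n => LieRinehart.exists_completedTensor_equiv n, hP, hQ,
    LieRinehart.hochEquivLR hP hQ, LieRinehart.hcEquiv hP hQ, fun n φ =>
      ⟨LieRinehart.barRes_d_comp_barCochain hP hQ φ, LieRinehart.hochEquivLR_mk hP hQ n φ⟩,
    fun n x h => ?_, fun n i m x h h' => ?_⟩
  · rw [LieRinehart.hcEquiv_apply, LieRinehart.hcPi_zero]
  · rw [LieRinehart.hcEquiv_apply, LieRinehart.hcEquiv_apply, LieRinehart.hcPi_mapS n i m h]
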